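/- All manifolds and maps are smooth. Let $V$ be a compact manifold with boundary and let $h:V\to V$ be a diffeomorphism which is the identity near $\partial V$. Let $\mathcal{MT}(V,h)$ be the mapping torus of $h$, so that $\partial \mathcal{MT}(V,h)=\partial V\times S^1$, and put $$\mathrm{OB}(V,h)=\mathcal{MT}(V,h)\cup_{\mathrm{id}}\big(\partial V\times D^2\big),$$ glued along $\partial V\times S^1$. An open book decomposition of a closed manifold $M$ is such a pair $(V,h)$ for which $M$ is diffeomorphic to $\mathrm{OB}(V,h)$. One says that $\mathrm{OB}(V_1,h_1)$ spun embeds in $\mathrm{OB}(V_2,h_2)$ if there is a proper embedding $g:(V_1,\partial V_1)\to(V_2,\partial V_2)$ such that $g\circ h_1$ is isotopic to $h_2\circ g$ through proper embeddings, relative to the boundary. Let $n\ge 4$. Then $(D^{n-1},\mathrm{id})$ is an open book decomposition of $S^n$, where $D^{n-1}$ is the closed unit disk in $\mathbb{R}^{n-1}$, and for every open book decomposition $(V,h)$ of $S^{n-2}$, $\mathrm{OB}(V,h)$ spun embeds in $S^n=\mathrm{OB}(D^{n-1},\mathrm{id})$. -/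

import Mathlib

open scoped Manifold ContDiff Topology

noncomputable section

namespace OpenBook

/-! ### Spheres and closed disks as smooth manifolds -/

/-- The unit sphere `S^n` in `ℝ^(n+1)`, with Mathlib's smooth structure. -/
abbrev UnitSphere (n : ℕ) : Type := Metric.sphere (0 : EuclideanSpace ℝ (Fin (n + 1))) 1

/-- The closed unit disk `D^m` in `ℝ^m`. -/
abbrev Disk (m : ℕ) : Type := Metric.closedBall (0 : EuclideanSpace ℝ (Fin m)) 1

section DiskCharts

theorem norm_units_smul {m : ℕ} (s : ℤˣ) (x : EuclideanSpace ℝ (Fin m)) : ‖s • x‖ = ‖x‖ := by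
  rcases Int.units_eq_one_or s with rfl | rfl <;> simp [Units.smul_def]

theorem units_smul_smul {m : ℕ} (s : ℤˣ) (x : EuclideanSpace ℝ (Fin m)) : s • s • x = x := by
  rw [smul_smul]
  simp

theorem norm_smul_disk_le {m : ℕ} (s : ℤˣ) (x : Disk m) : ‖s • x.1‖ ≤ 1 := by
  rw [norm_units_smul]
  exact mem_closedBall_zero_iff.1 x.2

variable {m : ℕ} [NeZero m]

/-- The first basis vector of `ℝ^m`. -/
def e₀ (m : ℕ) [NeZero m] : EuclideanSpace ℝ (Fin m) := EuclideanSpace.single 0 1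

/-- The inversion `x ↦ -e₀ + 2 (x + e₀) / ‖x + e₀‖²` in the sphere of radius `√2` about `-e₀`. It is
an involution of `ℝ^m ∖ {-e₀}` which exchanges the closed unit disk (minus `-e₀`) with the closed
half-space `{x | 0 ≤ x 0}`. -/
def inv (x : EuclideanSpace ℝ (Fin m)) : EuclideanSpace ℝ (Fin m) :=
  (2 / ‖x + e₀ m‖ ^ 2) • (x + e₀ m) - e₀ m

theorem norm_e₀ : ‖e₀ m‖ = 1 := by simp [e₀]

theorem norm_add_e₀_sq (x : EuclideanSpace ℝ (Fin m)) :
    ‖x + e₀ m‖ ^ 2 = ‖x‖ ^ 2 + 2 * x 0 + 1 := by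
  rw [norm_add_sq_real, norm_e₀, e₀, EuclideanSpace.inner_single_right]
  simp

theorem norm_add_e₀_sq_pos {x : EuclideanSpace ℝ (Fin m)} (hx : x ≠ -e₀ m) :
    0 < ‖x + e₀ m‖ ^ 2 := by
  have : x + e₀ m ≠ 0 := fun h => hx (eq_neg_of_add_eq_zero_left h)
  positivity

theorem inv_ne {x : EuclideanSpace ℝ (Fin m)} (hx : x ≠ -e₀ m) : inv x ≠ -e₀ m := by
  intro h
  have h1 : x + e₀ m ≠ 0 := fun h => hx (eq_neg_of_add_eq_zero_left h)
  have h2 := norm_add_e₀_sq_pos hx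
  have h3 : (2 / ‖x + e₀ m‖ ^ 2) • (x + e₀ m) = 0 := by
    rw [inv, sub_eq_iff_eq_add] at h
    simpa using h
  rcases smul_eq_zero.1 h3 with h4 | h4
  · exact (div_pos two_pos h2).ne' h4
  · exact h1 h4

theorem inv_inv {x : EuclideanSpace ℝ (Fin m)} (hx : x ≠ -e₀ m) : inv (inv x) = x := by
  have h2 := norm_add_e₀_sq_pos hx
  have h3 : inv x + e₀ m = (2 / ‖x + e₀ m‖ ^ 2) • (x + e₀ m) := by simp [inv]
  have h4 : ‖inv x + e₀ m‖ ^ 2 = 4 / ‖x + e₀ m‖ ^ 2 := by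
    rw [h3, norm_smul, mul_pow, Real.norm_eq_abs, sq_abs, div_pow, sq (‖x + e₀ m‖ ^ 2),
      div_mul_eq_mul_div, mul_div_mul_right _ _ h2.ne']
    norm_num
  rw [inv, h4, h3, smul_smul]
  have : 2 / (4 / ‖x + e₀ m‖ ^ 2) * (2 / ‖x + e₀ m‖ ^ 2) = 1 := by
    generalize ‖x + e₀ m‖ ^ 2 = c at h2
    field_simp
    norm_num
  rw [this]
  simp

theorem inv_apply_zero {x : EuclideanSpace ℝ (Fin m)} (hx : x ≠ -e₀ m) :
    inv x 0 = (1 - ‖x‖ ^ 2) / ‖x + e₀ m‖ ^ 2 := by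
  have h2 := norm_add_e₀_sq_pos hx
  have h5 : inv x 0 = 2 / ‖x + e₀ m‖ ^ 2 * (x 0 + 1) - 1 := by
    simp only [inv, PiLp.sub_apply, PiLp.smul_apply, PiLp.add_apply, smul_eq_mul]
    simp [e₀]
  rw [h5, eq_div_iff h2.ne', sub_mul, mul_right_comm, div_mul_cancel₀ _ h2.ne', norm_add_e₀_sq]
  ring

theorem inv_nonneg {x : EuclideanSpace ℝ (Fin m)} (hx : x ≠ -e₀ m) (h : ‖x‖ ≤ 1) :
    0 ≤ inv x 0 := by
  rw [inv_apply_zero hx]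
  have : ‖x‖ ^ 2 ≤ 1 := pow_le_one₀ (norm_nonneg _) h
  exact div_nonneg (by linarith) (norm_add_e₀_sq_pos hx).le

theorem ne_of_nonneg {z : EuclideanSpace ℝ (Fin m)} (hz : 0 ≤ z 0) : z ≠ -e₀ m := by
  rintro rfl
  simp [e₀] at hz
  linarith

theorem norm_inv_le {z : EuclideanSpace ℝ (Fin m)} (hz : 0 ≤ z 0) : ‖inv z‖ ≤ 1 := by
  have h0 := ne_of_nonneg hz
  have h1 := inv_apply_zero (inv_ne h0)
  rw [inv_inv h0] at h1
  rw [h1] at hz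
  have h2 := norm_add_e₀_sq_pos (inv_ne h0)
  have h3 : 0 ≤ 1 - ‖inv z‖ ^ 2 := by
    by_contra h
    exact absurd hz (not_le.2 (div_neg_of_neg_of_pos (not_le.1 h) h2))
  nlinarith [norm_nonneg (inv z)]

theorem contDiffOn_inv : ContDiffOn ℝ ∞ (inv (m := m)) {x | x ≠ -e₀ m} := by
  have h1 : ContDiffOn ℝ ∞ (fun x : EuclideanSpace ℝ (Fin m) => x + e₀ m) {x | x ≠ -e₀ m} :=
    (contDiff_id.add contDiff_const).contDiffOn
  have h2 : ContDiffOn ℝ ∞ (fun x : EuclideanSpace ℝ (Fin m) => 2 / ‖x + e₀ m‖ ^ 2)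
      {x | x ≠ -e₀ m} :=
    contDiffOn_const.div (h1.norm_sq ℝ) fun x hx => (norm_add_e₀_sq_pos hx).ne'
  exact (h2.smul h1).sub contDiffOn_const

/-- The map `inv` with values in the half-space (with a junk value at points where it does not lie in
the half-space). -/
def toHalf (x : EuclideanSpace ℝ (Fin m)) : EuclideanHalfSpace m :=
  if h : 0 ≤ inv x 0 then ⟨inv x, h⟩ else 0

theorem toHalf_val {x : EuclideanSpace ℝ (Fin m)} (hx : x ≠ -e₀ m) (h : ‖x‖ ≤ 1) :
    (toHalf x).1 = inv x := by
  rw [toHalf, dif_pos (inv_nonneg hx h)]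

/-- The two charts of the closed disk, one for each sign `s = ±1`: the chart `x ↦ inv (s x)` from
`D^m ∖ {-s e₀}` onto the closed half-space. -/
def diskChart (s : ℤˣ) : OpenPartialHomeomorph (Disk m) (EuclideanHalfSpace m) where
  toFun x := toHalf (s • x.1)
  invFun z := ⟨s • inv z.1, by
    rw [mem_closedBall_zero_iff, norm_units_smul]
    exact norm_inv_le z.2⟩
  source := {x | s • x.1 ≠ -e₀ m}
  target := Set.univ
  map_source' _ _ := Set.mem_univ _
  map_target' z _ := by
    change s • s • inv z.1 ≠ -e₀ m
    rw [units_smul_smul]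
    exact inv_ne (ne_of_nonneg z.2)
  left_inv' x hx := by
    apply Subtype.ext
    change s • inv (toHalf (s • x.1)).1 = x.1
    rw [toHalf_val hx (norm_smul_disk_le s x), inv_inv hx, units_smul_smul]
  right_inv' z _ := by
    apply EuclideanHalfSpace.ext
    change (toHalf (s • s • inv z.1)).1 = z.1
    rw [units_smul_smul, toHalf_val (inv_ne (ne_of_nonneg z.2)) (norm_inv_le z.2),
      inv_inv (ne_of_nonneg z.2)]
  open_source := isOpen_ne_fun (continuous_subtype_val.const_smul s) continuous_const
  open_target := isOpen_univ
  continuousOn_toFun := by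
    have hi : Topology.IsInducing (Subtype.val : EuclideanHalfSpace m → _) :=
      Topology.IsInducing.subtypeVal
    rw [hi.continuousOn_iff]
    have h : ContinuousOn (fun x : Disk m => inv (s • x.1)) {x | s • x.1 ≠ -e₀ m} :=
      contDiffOn_inv.continuousOn.comp (continuous_subtype_val.const_smul s).continuousOn
        fun x hx => hx
    exact h.congr fun x hx => toHalf_val hx (norm_smul_disk_le s x)
  continuousOn_invFun := by
    rw [Topology.IsInducing.subtypeVal.continuousOn_iff]
    have hc : Continuous (Subtype.val : EuclideanHalfSpace m → _) := continuous_subtype_val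
    have h : ContinuousOn (fun z : EuclideanHalfSpace m => inv z.1) Set.univ :=
      contDiffOn_inv.continuousOn.comp hc.continuousOn fun z _ => ne_of_nonneg z.2
    exact h.const_smul s

theorem exists_mem_diskChart_source (x : Disk m) : ∃ s : ℤˣ, x ∈ (diskChart (m := m) s).source := by
  by_cases h : x.1 = -e₀ m
  · refine ⟨-1, ?_⟩
    change (-1 : ℤˣ) • x.1 ≠ -e₀ m
    rw [h]
    intro h'
    have := congrArg (fun y : EuclideanSpace ℝ (Fin m) => y 0) h'
    simp [e₀] at this
    linarith
  · exact ⟨1, by change (1 : ℤˣ) • x.1 ≠ -e₀ m; simpa using h⟩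

/-- The closed disk `D^m` as a manifold with boundary modelled on the half-space of `ℝ^m`. -/
instance instChartedSpaceDisk : ChartedSpace (EuclideanHalfSpace m) (Disk m) where
  atlas := Set.range diskChart
  chartAt x := diskChart (Classical.choose (exists_mem_diskChart_source x))
  mem_chart_source x := Classical.choose_spec (exists_mem_diskChart_source x)
  chart_mem_atlas _ := Set.mem_range_self _

instance instIsManifoldDisk : IsManifold (𝓡∂ m) ∞ (Disk m) := by
  apply isManifold_of_contDiffOn
  rintro _ _ ⟨s, rfl⟩ ⟨s', rfl⟩
  have key : ContDiffOn ℝ ∞ (fun z : EuclideanSpace ℝ (Fin m) => inv (s' • s • inv z))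
      {z | 0 ≤ z 0 ∧ s' • s • inv z ≠ -e₀ m} := by
    refine contDiffOn_inv.comp (t := {x | x ≠ -e₀ m}) ?_ fun z hz => hz.2
    have h1 : ContDiffOn ℝ ∞ (inv (m := m)) {z | 0 ≤ z 0 ∧ s' • s • inv z ≠ -e₀ m} :=
      contDiffOn_inv.mono fun z hz => ne_of_nonneg hz.1
    rcases Int.units_eq_one_or (s' * s) with h | h
    · exact h1.congr fun z _ => by rw [smul_smul, h, one_smul]
    · exact h1.neg.congr fun z _ => by rw [smul_smul, h]; simp [Units.smul_def]
  have hmem : ∀ z ∈ (𝓡∂ m).symm ⁻¹' ((diskChart s).symm ≫ₕ diskChart s').source ∩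
      Set.range (𝓡∂ m), 0 ≤ z 0 ∧ s' • s • inv z ≠ -e₀ m := by
    rintro _ ⟨hz, z, rfl⟩
    have hz' := hz.2
    rw [Set.mem_preimage, (𝓡∂ m).left_inv] at hz'
    exact ⟨z.2, hz'⟩
  refine (key.mono hmem).congr ?_
  rintro z ⟨hz, w, rfl⟩
  have h : s' • s • inv w.1 ≠ -e₀ m := (hmem _ ⟨hz, w, rfl⟩).2
  have hw : (𝓡∂ m).symm ((𝓡∂ m) w) = w := (𝓡∂ m).left_inv w
  simp only [Function.comp_apply]
  rw [hw]
  exact toHalf_val h (norm_smul_disk_le s' ((diskChart s).symm w))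

end DiskCharts

/-- The point `exp (2 π i t)` of the boundary circle of `D²`. -/
def circlePoint (t : ℝ) : Disk 2 :=
  ⟨!₂[Real.cos (2 * Real.pi * t), Real.sin (2 * Real.pi * t)], by
    rw [mem_closedBall_zero_iff, EuclideanSpace.norm_eq]
    simp⟩

/-! ### Open book decompositions -/

section OpenBooks

variable {k : ℕ}

/-- The boundary `∂V` of a `(k+1)`-dimensional manifold with boundary `V`. -/
abbrev Bdry (k : ℕ) (V : Type*) [TopologicalSpace V] [ChartedSpace (EuclideanHalfSpace (k + 1)) V] :
    Set V :=
  (𝓡∂ (k + 1)).boundary V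

/-- `(V, h)` is an open book decomposition of the `(k+2)`-manifold `M`: `h` is a diffeomorphism of the
compact manifold with boundary `V` which is the identity near `∂V`, and `M` is diffeomorphic to the
manifold `MT(V, h) ∪_id ∂V × D²` obtained by gluing along `∂MT(V, h) = ∂V × S¹ = ∂(∂V × D²)`.

Here the mapping torus `MT(V, h)` is the quotient of `V × ℝ` by `(x, t + 1) ∼ (h x, t)`. The manifold
`∂V` carries the (unique) smooth structure for which it is a smooth submanifold of `V`. The
diffeomorphism from the glued manifold to `M` is given by its restrictions to the two pieces:
a smooth map `α` on `V × ℝ` that induces a codimension `0` embedding of `MT(V, h)`, and a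
codimension `0` embedding `β` of `∂V × D²`; the two images cover `M` and meet exactly in the way
prescribed by the gluing. -/
structure IsOpenBookDecomposition (V : Type*) [TopologicalSpace V]
    [ChartedSpace (EuclideanHalfSpace (k + 1)) V]
    (h : V ≃ₘ⟮𝓡∂ (k + 1), 𝓡∂ (k + 1)⟯ V)
    (M : Type*) [TopologicalSpace M] [ChartedSpace (EuclideanSpace ℝ (Fin (k + 2))) M] : Prop where
  compact_page : CompactSpace V
  eq_self_near_boundary : ∀ᶠ x in 𝓝ˢ (Bdry k V), h x = x
  exists_diffeomorph : ∃ _ : ChartedSpace (EuclideanSpace ℝ (Fin k)) (Bdry k V),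
    IsManifold (𝓡 k) ∞ (Bdry k V) ∧
    Manifold.IsSmoothEmbedding (𝓡 k) (𝓡∂ (k + 1)) ∞ (Subtype.val : Bdry k V → V) ∧
    ∃ (α : V × ℝ → M) (β : Bdry k V × Disk 2 → M),
      -- `α` descends to a smooth embedding of the mapping torus
      Manifold.IsImmersion ((𝓡∂ (k + 1)).prod 𝓘(ℝ, ℝ)) (𝓡 (k + 2)) ∞ α ∧
      (∀ x y : V, ∀ s t : ℝ, α (x, s) = α (y, t) ↔
        ∃ j : ℤ, s = t + j ∧ y = ((h.toEquiv : Equiv.Perm V) ^ j) x) ∧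
      -- `β` is a smooth embedding
      Manifold.IsSmoothEmbedding ((𝓡 k).prod (𝓡∂ 2)) (𝓡 (k + 2)) ∞ β ∧
      -- the images cover `M`, and they are glued by the identity of `∂V × S¹`
      Set.range α ∪ Set.range β = Set.univ ∧
      (∀ (x : V) (t : ℝ) (b : Bdry k V) (z : Disk 2),
        α (x, t) = β (b, z) ↔ x = b ∧ z = circlePoint t)

end OpenBooks

/-! ### Spun embeddings -/

section Spun

variable {k l : ℕ}

/-- A proper embedding `(V, ∂V) → (W, ∂W)`: a smooth embedding which maps `∂V` to `∂W` and the
interior of `V` to the interior of `W`. (With Mathlib's notion of an immersion between manifolds with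
boundary, such a map is automatically transverse to `∂W`.) -/
structure IsProperEmbedding {V W : Type*}
    [TopologicalSpace V] [ChartedSpace (EuclideanHalfSpace (k + 1)) V]
    [TopologicalSpace W] [ChartedSpace (EuclideanHalfSpace (l + 1)) W] (g : V → W) : Prop where
  isSmoothEmbedding : Manifold.IsSmoothEmbedding (𝓡∂ (k + 1)) (𝓡∂ (l + 1)) ∞ g
  preimage_boundary : g ⁻¹' Bdry l W = Bdry k V

/-- The maps `g₀` and `g₁` are isotopic relative to the boundary: they are joined by a smooth path
of proper embeddings, all of which agree on `∂V`. -/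
def IsotopicRelBdry {V W : Type*}
    [TopologicalSpace V] [ChartedSpace (EuclideanHalfSpace (k + 1)) V]
    [TopologicalSpace W] [ChartedSpace (EuclideanHalfSpace (l + 1)) W] (g₀ g₁ : V → W) : Prop :=
  ∃ G : V × Set.Icc (0 : ℝ) 1 → W,
    ContMDiff ((𝓡∂ (k + 1)).prod (𝓡∂ 1)) (𝓡∂ (l + 1)) ∞ G ∧
    (∀ s, IsProperEmbedding (k := k) (l := l) fun x => G (x, s)) ∧
    (∀ x, G (x, 0) = g₀ x) ∧ (∀ x, G (x, 1) = g₁ x) ∧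
    (∀ x ∈ Bdry k V, ∀ s, G (x, s) = g₀ x)

/-- `OB(V, h)` spun embeds in `OB(W, h')`: there is a proper embedding `g` of the page `V` in the
page `W` such that `g ∘ h` is isotopic to `h' ∘ g` relative to the boundary. -/
def SpunEmbeds (V : Type*) [TopologicalSpace V] [ChartedSpace (EuclideanHalfSpace (k + 1)) V]
    (h : V ≃ₘ⟮𝓡∂ (k + 1), 𝓡∂ (k + 1)⟯ V)
    (W : Type*) [TopologicalSpace W] [ChartedSpace (EuclideanHalfSpace (l + 1)) W]
    (h' : W ≃ₘ⟮𝓡∂ (l + 1), 𝓡∂ (l + 1)⟯ W) : Prop :=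
  ∃ g : V → W, IsProperEmbedding (k := k) (l := l) g ∧
    IsotopicRelBdry (k := k) (l := l) (g ∘ h) (h' ∘ g)

end Spun

end OpenBook

end

/-! Regard the sphere `S^(n-2)` as the boundary of `D^(n-1)`. An open book decomposition supplies a
family of pages `α (·, t)` in this sphere with `α (·, 1) = α (h ·, 0)`. Pushed into the disk, the
family is an isotopy between `g ∘ h` and `g`, where `g` is the page at time `0`; as the disk carries
the identity monodromy, this is what a spun embedding asks for. Two corrections make it an isotopy
of proper embeddings relative to the boundary.

The boundary of `α (·, t)` turns with `t` around the binding. So the page is prolonged inside `β (∂V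
× D²)` along the ray of angle `t` to the core `∂V × 0`, which does not move. The prolongation takes
place in a collar of `∂V` with height `f` and projection `r`: for `f < 2` the map is `β (r x, spin
(f x) t)`, and from there `pushIn` spreads the rest of the collar over the whole collar again. This
is `spun`.

To enter the disk, `spun` is multiplied by a radius `profile (f x)`, which is `1` on `∂V` and
decreases with slope `-1/8`, so that the page meets the sphere transversely along its boundary. The
radius also remembers the height. Hence it does no harm that `spun` forgets the height on part of
the collar: up to height `7/2` the height is read off the radius, and from height `3` on `spun` is
the page embedding itself. Outside the collar the radius is constant, since there `h` may change the
height; in the collar `h` is the identity.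

The collar needs a boundary defining function `f`, a sum of bump functions times chart coordinates,
and a retraction `r` of a neighbourhood onto `∂V`. The latter comes from `β`: extend the core map `b
↦ β (b, 0)` to a vector-valued map on `V`, normalize it, invert `β` and project to `∂V`
(`exists_retraction`). Then `(r, f)` is inverted near the boundary (`exists_collarChart`,
`exists_collarParam`), by an inverse function theorem for half-spaces that rests on odd reflection.

Immersions are understood as normal forms in charts of manifolds with boundary. An injective
derivative is therefore not enough at boundary points: the map has to extend to a local
diffeomorphism of the product with a complement that respects the half-spaces
(`isImmersionAtOfComplement_of_charts`). Injectivity of derivatives is checked by following kernels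
through smooth left inverses.

For the first claim, `S^n` in `ℝ^(n-1) × ℝ²` is the radial image of `∂(D^(n-1) × D²)`, whose faces
`D^(n-1) × S¹` and `S^(n-2) × D²` are the mapping torus of the identity and the neighbourhood of the
binding. -/

noncomputable section

open Set Filter Manifold

namespace OpenBook

/-! ### Local diffeomorphisms of the model space as changes of charts -/

section Charts

variable {E H M : Type*} [NormedAddCommGroup E] [NormedSpace ℝ E] [TopologicalSpace H]
  {I : ModelWithCorners ℝ E H} [TopologicalSpace M] [ChartedSpace H M]

/-- Mutually inverse smooth maps between relatively open subsets of the range of a model with corners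
give a local diffeomorphism of the model space. -/
theorem exists_openPartialHomeomorph_model {S T : Set E} (hS : IsOpen S) (hT : IsOpen T) {F G : E → E}
    (hF : MapsTo F (S ∩ range I) (T ∩ range I)) (hG : MapsTo G (T ∩ range I) (S ∩ range I))
    (hGF : ∀ x ∈ S ∩ range I, G (F x) = x) (hFG : ∀ y ∈ T ∩ range I, F (G y) = y)
    (hFs : ContDiffOn ℝ ∞ F (S ∩ range I)) (hGs : ContDiffOn ℝ ∞ G (T ∩ range I)) :
    ∃ e : OpenPartialHomeomorph H H, e.source = I ⁻¹' S ∧ e.target = I ⁻¹' T ∧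
      (∀ x, I x ∈ S → I (e x) = F (I x)) ∧ (∀ y, I y ∈ T → I (e.symm y) = G (I y)) ∧
      e ∈ contDiffGroupoid ∞ I := by
  have h1 : ∀ x, I x ∈ S → I (I.symm (F (I x))) = F (I x) := fun x hx =>
    I.right_inv (hF ⟨hx, mem_range_self x⟩).2
  have h2 : ∀ y, I y ∈ T → I (I.symm (G (I y))) = G (I y) := fun x hx =>
    I.right_inv (hG ⟨hx, mem_range_self x⟩).2
  let e : OpenPartialHomeomorph H H :=
    { toFun := fun x => I.symm (F (I x))
      invFun := fun y => I.symm (G (I y))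
      source := I ⁻¹' S
      target := I ⁻¹' T
      map_source' := fun x hx => by
        change I _ ∈ T
        rw [h1 x hx]; exact (hF ⟨hx, mem_range_self x⟩).1
      map_target' := fun x hx => by
        change I _ ∈ S
        rw [h2 x hx]; exact (hG ⟨hx, mem_range_self x⟩).1
      left_inv' := fun x hx => by
        rw [h1 x hx, hGF _ ⟨hx, mem_range_self x⟩, I.left_inv]
      right_inv' := fun x hx => by
        rw [h2 x hx, hFG _ ⟨hx, mem_range_self x⟩, I.left_inv]
      open_source := hS.preimage I.continuous
      open_target := hT.preimage I.continuous
      continuousOn_toFun := I.continuous_symm.comp_continuousOn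
        (hFs.continuousOn.comp I.continuous.continuousOn fun x hx => ⟨hx, mem_range_self x⟩)
      continuousOn_invFun := I.continuous_symm.comp_continuousOn
        (hGs.continuousOn.comp I.continuous.continuousOn fun x hx => ⟨hx, mem_range_self x⟩) }
  refine ⟨e, rfl, rfl, h1, h2, ?_⟩
  rw [contDiffGroupoid, mem_groupoid_of_pregroupoid]
  constructor
  · refine (hFs.mono ?_).congr ?_
    · rintro _ ⟨hx, x, rfl⟩
      rw [mem_preimage, I.left_inv] at hx
      exact ⟨hx, mem_range_self x⟩
    · rintro _ ⟨hx, x, rfl⟩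
      rw [mem_preimage, I.left_inv] at hx
      simp only [Function.comp_apply, I.left_inv]
      exact h1 x hx
  · refine (hGs.mono ?_).congr ?_
    · rintro _ ⟨hx, x, rfl⟩
      rw [mem_preimage, I.left_inv] at hx
      exact ⟨hx, mem_range_self x⟩
    · rintro _ ⟨hx, x, rfl⟩
      rw [mem_preimage, I.left_inv] at hx
      simp only [Function.comp_apply, I.left_inv]
      exact h2 x hx

theorem trans_mem_maximalAtlas [IsManifold I ∞ M] {φ : OpenPartialHomeomorph M H}
    (hφ : φ ∈ IsManifold.maximalAtlas I ∞ M) {e : OpenPartialHomeomorph H H}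
    (he : e ∈ contDiffGroupoid ∞ I) : φ ≫ₕ e ∈ IsManifold.maximalAtlas I ∞ M := by
  apply OpenPartialHomeomorph.mem_maximalAtlas_of_contMDiffOn
  · exact (contMDiffOn_of_mem_contDiffGroupoid he).comp
      ((contMDiffOn_of_mem_maximalAtlas hφ).mono (by simp)) (by intro; simp)
  · exact (contMDiffOn_symm_of_mem_maximalAtlas hφ).comp
      ((contMDiffOn_of_mem_contDiffGroupoid ((contDiffGroupoid ∞ I).symm he)).mono
        (by intro; simp +contextual)) (by intro; simp)

end Charts

/-! ### Inverse function theorem in the interior -/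

section InverseFunction

/-- The inverse function theorem, with a smooth inverse on the whole target. -/
theorem exists_openPartialHomeomorph_of_hasFDerivAt {E₁ E₂ : Type*} [NormedAddCommGroup E₁]
    [NormedSpace ℝ E₁] [CompleteSpace E₁] [NormedAddCommGroup E₂] [NormedSpace ℝ E₂]
    {Φ : E₁ → E₂} {W : Set E₁} (hW : IsOpen W)
    (hΦ : ContDiffOn ℝ ∞ Φ W) {q : E₁} (hq : q ∈ W) {A : E₁ ≃L[ℝ] E₂}
    (hA : HasFDerivAt Φ (A : E₁ →L[ℝ] E₂) q) :
    ∃ e : OpenPartialHomeomorph E₁ E₂, q ∈ e.source ∧ e.source ⊆ W ∧ (∀ x, e x = Φ x) ∧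
      ContDiffOn ℝ ∞ e.symm e.target := by
  have hat : ContDiffAt ℝ ∞ Φ q := hΦ.contDiffAt (hW.mem_nhds hq)
  let e₀ := hat.toOpenPartialHomeomorph Φ hA (by simp)
  have hc : ContinuousOn (fderiv ℝ Φ) W := hΦ.continuousOn_fderiv_of_isOpen hW (by simp)
  -- Invertibility of the derivative is an open condition. Restricting to it makes the inverse
  -- smooth on the whole target, not only at the image of `q`.
  let W' : Set E₁ := W ∩ fderiv ℝ Φ ⁻¹' range ((↑) : (E₁ ≃L[ℝ] E₂) → E₁ →L[ℝ] E₂)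
  have hW' : IsOpen W' := hc.isOpen_inter_preimage hW ContinuousLinearEquiv.isOpen
  refine ⟨e₀.restrOpen W' hW', ⟨hat.mem_toOpenPartialHomeomorph_source hA (by simp), hq, A, ?_⟩,
    fun x hx => hx.2.1, fun x => rfl, ?_⟩
  · exact hA.fderiv.symm
  · intro y hy
    set e := e₀.restrOpen W' hW' with he
    have hy' : e.symm y ∈ e.source := e.map_target hy
    obtain ⟨B, hB⟩ := hy'.2.2
    have hd : HasFDerivAt e (B : E₁ →L[ℝ] E₂) (e.symm y) := by
      have : DifferentiableAt ℝ Φ (e.symm y) :=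
        (hΦ.contDiffAt (hW.mem_nhds hy'.2.1)).differentiableAt (by simp)
      rw [hB]
      exact this.hasFDerivAt
    exact (e.contDiffAt_symm hy hd (hΦ.contDiffAt (hW.mem_nhds hy'.2.1))).contDiffWithinAt

end InverseFunction

/-! ### Immersions from extensions to local diffeomorphisms -/

section Immersion

variable {E H M E' H' N F : Type*} [NormedAddCommGroup E] [NormedSpace ℝ E] [TopologicalSpace H]
  {I : ModelWithCorners ℝ E H} [TopologicalSpace M] [ChartedSpace H M]
  [NormedAddCommGroup E'] [NormedSpace ℝ E'] [TopologicalSpace H']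
  {I' : ModelWithCorners ℝ E' H'} [TopologicalSpace N] [ChartedSpace H' N]
  [NormedAddCommGroup F] [NormedSpace ℝ F]

/-- A map which in charts is the restriction to `E × 0` of a local diffeomorphism of `E × F` is an
immersion. -/
theorem isImmersionAtOfComplement_of_charts [IsManifold I ∞ M] [IsManifold I' ∞ N]
    [CompleteSpace E] [CompleteSpace F]
    {f : M → N} {x : M} (hf : ContinuousAt f x) {φ : OpenPartialHomeomorph M H}
    (hφ : φ ∈ IsManifold.maximalAtlas I ∞ M) (hx : x ∈ φ.source) {ψ : OpenPartialHomeomorph N H'}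
    (hψ : ψ ∈ IsManifold.maximalAtlas I' ∞ N) (hfx : f x ∈ ψ.source)
    {Φ : E × F → E'} {W : Set (E × F)} (hW : IsOpen W) (hΦ : ContDiffOn ℝ ∞ Φ W)
    (hxW : (φ.extend I x, 0) ∈ W) {A : (E × F) ≃L[ℝ] E'}
    (hA : HasFDerivAt Φ (A : E × F →L[ℝ] E') (φ.extend I x, 0)) (K : (E × F) ≃L[ℝ] E')
    (hK : ∀ q ∈ W, Φ q ∈ range I' ↔ K q ∈ range I')
    (hΦf : ∀ᶠ y in 𝓝 x, ψ.extend I' (f y) = Φ (φ.extend I y, 0)) :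
    IsImmersionAtOfComplement F I I' ∞ f x := by
  obtain ⟨e, hqe, heW, heΦ, hes⟩ := exists_openPartialHomeomorph_of_hasFDerivAt hW hΦ hxW hA
  have heK : ∀ q ∈ e.source, e q ∈ range I' ↔ K q ∈ range I' := fun q hq => by
    rw [heΦ]; exact hK q (heW hq)
  have hT : IsOpen (K.symm ⁻¹' e.source) := e.open_source.preimage K.symm.continuous
  -- The chart `ψ` is corrected by `K ∘ Φ⁻¹`, after which `f` reads `u ↦ K (u, 0)`. By `hK` the
  -- correction preserves the range of the model with corners, so the result is again a chart.
  obtain ⟨e', he's, he't, he'1, he'2, he'g⟩ := exists_openPartialHomeomorph_model (I := I')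
    (S := e.target) (T := K.symm ⁻¹' e.source) (F := fun y => K (e.symm y))
    (G := fun z => e (K.symm z)) e.open_target hT
    (fun y hy => ⟨by simpa using e.map_target hy.1, by
      rw [← heK _ (e.map_target hy.1), e.right_inv hy.1]; exact hy.2⟩)
    (fun z hz => ⟨e.map_source hz.1, by
      rw [heK _ hz.1, K.apply_symm_apply]; exact hz.2⟩)
    (fun y hy => by simp [e.right_inv hy.1])
    (fun z hz => by simp [e.left_inv hz.1])
    (K.contDiff.comp_contDiffOn (hes.mono inter_subset_left))
    (((hΦ.congr fun x _ => heΦ x).comp K.symm.contDiff.contDiffOn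
      (fun z hz => heW hz)).mono inter_subset_left)
  obtain ⟨U, hUs, hUo, hxU⟩ := mem_nhds_iff.1 hΦf
  have hc : ContinuousAt (fun y => (φ.extend I y, (0 : F))) x :=
    (φ.continuousAt_extend hx).prodMk continuousAt_const
  obtain ⟨U', hUs', hUo', hxU'⟩ := mem_nhds_iff.1 (hc (e.open_source.mem_nhds hqe))
  refine IsImmersionAtOfComplement.mk_of_continuousAt hf K (φ.restr (U ∩ U')) (ψ ≫ₕ e') ?_ ?_
    (restr_mem_maximalAtlas _ hφ (hUo.inter hUo')) (trans_mem_maximalAtlas hψ he'g) ?_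
  · rw [φ.restr_source' _ (hUo.inter hUo')]
    exact ⟨hx, hxU, hxU'⟩
  · rw [OpenPartialHomeomorph.trans_source, he's]
    refine ⟨hfx, ?_⟩
    change ψ.extend I' (f x) ∈ e.target
    rw [hUs hxU, ← heΦ]
    exact e.map_source hqe
  · intro u hu
    have hu' : ((φ.restr (U ∩ U')).extend I).symm u ∈ (φ.restr (U ∩ U')).source := by
      have := ((φ.restr (U ∩ U')).extend I).map_target hu
      rwa [OpenPartialHomeomorph.extend_source] at this
    set y := ((φ.restr (U ∩ U')).extend I).symm u with hy
    have hyu : φ.extend I y = u := ((φ.restr (U ∩ U')).extend I).right_inv hu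
    rw [φ.restr_source' _ (hUo.inter hUo')] at hu'
    have h1 : ψ.extend I' (f y) = e (u, 0) := by
      rw [hUs hu'.2.1, hyu, heΦ]
    have h2 : (u, (0 : F)) ∈ e.source := by
      rw [← hyu]; exact hUs' hu'.2.2
    change I' (e' (ψ (f y))) = K (u, 0)
    have h3 : I' (ψ (f y)) = e (u, 0) := h1
    rw [he'1 _ (by rw [h3]; exact e.map_source h2), h3, e.left_inv h2]

end Immersion

/-! ### Inverse function theorem at boundary points -/

section HalfSpaceInverse

/-- The inverse of a local homeomorphism which is smooth within a set with unique derivatives is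
smooth within the corresponding set. -/
theorem contDiffOn_symm_of_isInvertible {E : Type*} [NormedAddCommGroup E] [NormedSpace ℝ E]
    [CompleteSpace E] {e : OpenPartialHomeomorph E E} {R : Set E} (hR : UniqueDiffOn ℝ R)
    (hm : MapsTo e.symm (e.target ∩ R) R)
    (hs : ContDiffOn ℝ ∞ e (e.source ∩ R))
    (hinv : ∀ x ∈ e.source ∩ R, (fderivWithin ℝ e (e.source ∩ R) x).IsInvertible) :
    ContDiffOn ℝ ∞ e.symm (e.target ∩ R) := by
  set s := e.source ∩ R with hs_def
  set t := e.target ∩ R with ht_def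
  have hus : UniqueDiffOn ℝ s := by rw [hs_def, inter_comm]; exact hR.inter e.open_source
  have hut : UniqueDiffOn ℝ t := by rw [ht_def, inter_comm]; exact hR.inter e.open_target
  have hts : MapsTo e.symm t s := fun y hy => ⟨e.map_target hy.1, hm hy⟩
  have hder : ∀ y ∈ t, HasFDerivWithinAt e.symm
      (fderivWithin ℝ e s (e.symm y)).inverse t y := by
    intro y hy
    obtain ⟨B, hB⟩ := hinv _ (hts hy)
    rw [← hB, ContinuousLinearMap.inverse_equiv]
    refine HasFDerivWithinAt.of_local_left_inverse (f := e) (s := t) (t := s) ?_ ?_ hy ?_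
    · exact tendsto_nhdsWithin_of_tendsto_nhds_of_eventually_within _
        ((e.symm.continuousAt hy.1).tendsto.mono_left nhdsWithin_le_nhds)
        (eventually_mem_nhdsWithin.mono fun z hz => hts hz)
    · rw [hB]
      exact ((hs.differentiableOn (by simp)) _ (hts hy)).hasFDerivWithinAt
    · exact eventually_mem_nhdsWithin.mono fun z hz => e.right_inv hz.1
  -- Bootstrapping: the derivative of the inverse is inversion of linear maps after `fderivWithin e`
  -- after `e.symm`, so it is as smooth as `e.symm`, which gains one degree.
  rw [contDiffOn_infty]
  intro n
  induction n with
  | zero => exact contDiffOn_zero.2 (e.symm.continuousOn.mono inter_subset_left)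
  | succ n ih =>
    push_cast
    rw [contDiffOn_succ_iff_hasFDerivWithinAt_of_uniqueDiffOn hut]
    refine ⟨by simp, fun y => (fderivWithin ℝ e s (e.symm y)).inverse, ?_, hder⟩
    have h1 : ContDiffOn ℝ n (fderivWithin ℝ e s) s :=
      (((contDiffOn_infty_iff_fderivWithin hus).1 hs).2).of_le (by exact_mod_cast le_top)
    intro y hy
    exact ((hinv _ (hts hy)).contDiffAt_map_inverse (n := n)).comp_contDiffWithinAt y
      ((h1.comp ih hts) y hy)

variable {m : ℕ} [NeZero m]

/-- The vector `x` with its first coordinate replaced by `c`. -/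
def setFirst (c : ℝ) (x : EuclideanSpace ℝ (Fin m)) : EuclideanSpace ℝ (Fin m) :=
  WithLp.toLp 2 (Function.update x.ofLp 0 c)

@[simp] theorem setFirst_zero (c : ℝ) (x : EuclideanSpace ℝ (Fin m)) : setFirst c x 0 = c := by
  simp [setFirst]

theorem setFirst_of_ne (c : ℝ) (x : EuclideanSpace ℝ (Fin m)) {i : Fin m} (hi : i ≠ 0) :
    setFirst c x i = x i := by
  simp [setFirst, hi]

theorem setFirst_self (x : EuclideanSpace ℝ (Fin m)) : setFirst (x 0) x = x := by
  ext i
  by_cases hi : i = 0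
  · subst hi; simp
  · exact setFirst_of_ne _ _ hi

theorem norm_setFirst_sub_le {c d : ℝ} {x y : EuclideanSpace ℝ (Fin m)}
    (h : |c - d| ≤ |x 0 - y 0|) : ‖setFirst c x - setFirst d y‖ ≤ ‖x - y‖ := by
  rw [EuclideanSpace.norm_eq, EuclideanSpace.norm_eq]
  refine Real.sqrt_le_sqrt (Finset.sum_le_sum fun i _ => ?_)
  by_cases hi : i = 0
  · subst hi
    simpa using sq_le_sq.2 (by simpa using h)
  · simp [setFirst_of_ne _ _ hi]

/-- The extension of a map from the half-space to the whole space by odd reflection. -/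
def reflectExtend (F : EuclideanSpace ℝ (Fin m) → EuclideanSpace ℝ (Fin m))
    (x : EuclideanSpace ℝ (Fin m)) : EuclideanSpace ℝ (Fin m) :=
  (2 : ℝ) • F (setFirst (max (x 0) 0) x) - F (setFirst |x 0| x)

theorem reflectExtend_of_nonneg (F : EuclideanSpace ℝ (Fin m) → EuclideanSpace ℝ (Fin m))
    {x : EuclideanSpace ℝ (Fin m)} (hx : 0 ≤ x 0) : reflectExtend F x = F x := by
  rw [reflectExtend, max_eq_left hx, abs_of_nonneg hx, setFirst_self, two_smul, add_sub_cancel_right]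

/-- Reflection reproduces linear maps. Subtracting a linear map from the extension of `F` therefore
leaves only remainders of `F` at points of the half-space. -/
theorem two_smul_setFirst_max_sub (x : EuclideanSpace ℝ (Fin m)) :
    (2 : ℝ) • setFirst (max (x 0) 0) x - setFirst |x 0| x = x := by
  ext i
  by_cases hi : i = 0
  · subst hi
    simp only [PiLp.sub_apply, PiLp.smul_apply, setFirst_zero, smul_eq_mul]
    rcases le_total 0 (x 0) with h | h
    · rw [max_eq_left h, abs_of_nonneg h]; ring
    · rw [max_eq_right h, abs_of_nonpos h]; ring
  · simp only [PiLp.sub_apply, PiLp.smul_apply, setFirst_of_ne _ _ hi, smul_eq_mul]; ring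

theorem norm_setFirst_max_sub_le (x y : EuclideanSpace ℝ (Fin m)) :
    ‖setFirst (max (x 0) 0) x - setFirst (max (y 0) 0) y‖ ≤ ‖x - y‖ :=
  norm_setFirst_sub_le (abs_max_sub_max_le_abs _ _ _)

theorem norm_setFirst_abs_sub_le (x y : EuclideanSpace ℝ (Fin m)) :
    ‖setFirst |x 0| x - setFirst |y 0| y‖ ≤ ‖x - y‖ :=
  norm_setFirst_sub_le (abs_abs_sub_abs_le_abs_sub _ _)

/-- The modification of the first coordinate is 1-Lipschitz and fixes the boundary point `p`, so it
preserves balls about `p`. -/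
theorem setFirst_max_mem_ball {x p : EuclideanSpace ℝ (Fin m)} (hp : p 0 = 0) {r : ℝ}
    (hx : x ∈ Metric.ball p r) : setFirst (max (x 0) 0) x ∈ Metric.ball p r := by
  have h := norm_setFirst_max_sub_le x p
  have hp' := setFirst_self p
  rw [hp] at hp'
  rw [hp, max_self, hp'] at h
  rw [mem_ball_iff_norm] at hx ⊢
  exact h.trans_lt hx

theorem setFirst_abs_mem_ball {x p : EuclideanSpace ℝ (Fin m)} (hp : p 0 = 0) {r : ℝ}
    (hx : x ∈ Metric.ball p r) : setFirst |x 0| x ∈ Metric.ball p r := by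
  have h := norm_setFirst_abs_sub_le x p
  have hp' := setFirst_self p
  rw [hp] at hp'
  rw [hp, abs_zero, hp'] at h
  rw [mem_ball_iff_norm] at hx ⊢
  exact h.trans_lt hx

/-- The extension by odd reflection is strictly differentiable at boundary points. -/
theorem hasStrictFDerivAt_reflectExtend {F : EuclideanSpace ℝ (Fin m) → EuclideanSpace ℝ (Fin m)}
    {S : Set (EuclideanSpace ℝ (Fin m))} (hS : IsOpen S)
    (hF : ContDiffOn ℝ ∞ F (S ∩ {u | 0 ≤ u 0})) {p : EuclideanSpace ℝ (Fin m)} (hp : p ∈ S)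
    (hp0 : p 0 = 0) :
    HasStrictFDerivAt (reflectExtend F) (fderivWithin ℝ F (S ∩ {u | 0 ≤ u 0}) p) p := by
  set R : Set (EuclideanSpace ℝ (Fin m)) := {u | 0 ≤ u 0} with hR
  have hRu : UniqueDiffOn ℝ R := by
    have := (𝓡∂ m).uniqueDiffOn
    rwa [range_modelWithCornersEuclideanHalfSpace] at this
  have hu : UniqueDiffOn ℝ (S ∩ R) := by rw [inter_comm]; exact hRu.inter hS
  have hpR : p ∈ R := hp0.ge
  set A := fderivWithin ℝ F (S ∩ R) p with hA
  apply HasStrictFDerivAt.of_isLittleO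
  rw [Asymptotics.isLittleO_iff]
  intro c hc
  have hcont : ContinuousOn (fderivWithin ℝ F (S ∩ R)) (S ∩ R) :=
    hF.continuousOn_fderivWithin hu (by simp)
  have h1 : ∀ᶠ u in 𝓝[S ∩ R] p, ‖fderivWithin ℝ F (S ∩ R) u - A‖ < c / 3 := by
    have := (hcont p ⟨hp, hpR⟩) (Metric.ball_mem_nhds _ (by positivity : 0 < c / 3))
    filter_upwards [this] with u hu
    exact mem_ball_iff_norm.1 hu
  rw [eventually_nhdsWithin_iff] at h1
  obtain ⟨r, hr, hball⟩ := Metric.mem_nhds_iff.1 (h1.and (hS.mem_nhds hp))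
  -- Mean value inequality on the convex half-ball. The constant `c / 3` pays for the coefficients
  -- `2` and `1` of the reflection.
  have hlip : ∀ x ∈ Metric.ball p r ∩ R, ∀ y ∈ Metric.ball p r ∩ R,
      ‖F y - F x - A (y - x)‖ ≤ c / 3 * ‖y - x‖ := by
    intro x hx y hy
    have hsub : Metric.ball p r ∩ R ⊆ S ∩ R := fun z hz => ⟨(hball hz.1).2, hz.2⟩
    refine Convex.norm_image_sub_le_of_norm_hasFDerivWithin_le' (𝕜 := ℝ) (s := Metric.ball p r ∩ R)
      (f' := fderivWithin ℝ F (S ∩ R)) (fun z hz => ?_)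
      (fun z hz => ((hball hz.1).1 (hsub hz)).le)
      ((convex_ball p r).inter EuclideanHalfSpace.convex) hx hy
    exact ((hF.differentiableOn (by simp)) z (hsub hz)).hasFDerivWithinAt.mono hsub
  have hb : Metric.ball p r ∈ 𝓝 p := Metric.ball_mem_nhds _ hr
  filter_upwards [prod_mem_nhds hb hb] with ⟨x, y⟩ ⟨hx, hy⟩
  simp only
  have hx1 : setFirst (max (x 0) 0) x ∈ Metric.ball p r ∩ R :=
    ⟨setFirst_max_mem_ball hp0 hx, by simp [hR]⟩
  have hy1 : setFirst (max (y 0) 0) y ∈ Metric.ball p r ∩ R :=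
    ⟨setFirst_max_mem_ball hp0 hy, by simp [hR]⟩
  have hx2 : setFirst |x 0| x ∈ Metric.ball p r ∩ R :=
    ⟨setFirst_abs_mem_ball hp0 hx, by simp [hR]⟩
  have hy2 : setFirst |y 0| y ∈ Metric.ball p r ∩ R :=
    ⟨setFirst_abs_mem_ball hp0 hy, by simp [hR]⟩
  have e1 := (hlip _ hy1 _ hx1).trans
    (mul_le_mul_of_nonneg_left (norm_setFirst_max_sub_le x y) (by positivity))
  have e2 := (hlip _ hy2 _ hx2).trans
    (mul_le_mul_of_nonneg_left (norm_setFirst_abs_sub_le x y) (by positivity))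
  have e3 : reflectExtend F x - reflectExtend F y - A (x - y) =
      (2 : ℝ) • (F (setFirst (max (x 0) 0) x) - F (setFirst (max (y 0) 0) y) -
        A (setFirst (max (x 0) 0) x - setFirst (max (y 0) 0) y)) -
      (F (setFirst |x 0| x) - F (setFirst |y 0| y) -
        A (setFirst |x 0| x - setFirst |y 0| y)) := by
    nth_rw 2 [← two_smul_setFirst_max_sub x, ← two_smul_setFirst_max_sub y]
    simp only [reflectExtend, map_sub, map_smul]
    module
  rw [e3]
  refine (norm_sub_le _ _).trans ?_
  rw [norm_smul, Real.norm_two]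
  linarith

/-- The inverse function theorem at boundary points of a half-space. -/
theorem exists_openPartialHomeomorph_halfSpace
    {F : EuclideanSpace ℝ (Fin m) → EuclideanSpace ℝ (Fin m)}
    {S : Set (EuclideanSpace ℝ (Fin m))} (hS : IsOpen S)
    (hF : ContDiffOn ℝ ∞ F (S ∩ {u | 0 ≤ u 0}))
    (hF0 : ∀ u ∈ S, 0 ≤ u 0 → 0 ≤ F u 0) (hF1 : ∀ u ∈ S, 0 ≤ u 0 → (F u 0 = 0 ↔ u 0 = 0))
    {p : EuclideanHalfSpace m} (hp : p.1 ∈ S) (hp0 : p.1 0 = 0)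
    (hinv : (fderivWithin ℝ F (S ∩ {u | 0 ≤ u 0}) p.1).IsInvertible) :
    ∃ e : OpenPartialHomeomorph (EuclideanHalfSpace m) (EuclideanHalfSpace m),
      p ∈ e.source ∧ (∀ x ∈ e.source, x.1 ∈ S ∧ (e x).1 = F x.1) ∧
      e ∈ contDiffGroupoid ∞ (𝓡∂ m) := by
  have hst := hasStrictFDerivAt_reflectExtend hS hF hp hp0
  set R : Set (EuclideanSpace ℝ (Fin m)) := {u | 0 ≤ u 0} with hR
  have hRr : range (𝓡∂ m) = R := range_modelWithCornersEuclideanHalfSpace m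
  have hRu : UniqueDiffOn ℝ R := hRr ▸ (𝓡∂ m).uniqueDiffOn
  have hu : UniqueDiffOn ℝ (S ∩ R) := by rw [inter_comm]; exact hRu.inter hS
  have hpR : p.1 ∈ R := p.2
  obtain ⟨A, hA⟩ := hinv
  rw [← hA] at hst
  set e₀ := hst.toOpenPartialHomeomorph (reflectExtend F) with he₀
  have hcont : ContinuousOn (fderivWithin ℝ F (S ∩ R)) (S ∩ R) :=
    hF.continuousOn_fderivWithin hu (by simp)
  have h1 : ∀ᶠ u in 𝓝[S ∩ R] p.1, (fderivWithin ℝ F (S ∩ R) u).IsInvertible := by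
    refine (hcont p.1 ⟨hp, hpR⟩).eventually (p := fun B => B.IsInvertible) ?_
    rw [← hA]
    exact ContinuousLinearEquiv.isOpen.mem_nhds ⟨A, rfl⟩
  rw [eventually_nhdsWithin_iff] at h1
  obtain ⟨r, hr, hball⟩ := Metric.mem_nhds_iff.1 (h1.and (hS.mem_nhds hp))
  set e := e₀.restrOpen (Metric.ball p.1 r) Metric.isOpen_ball with he
  have heF : ∀ x ∈ R, e x = F x := fun x hx => reflectExtend_of_nonneg F hx
  -- The extension respects the two sides: below the hyperplane its first coordinate is twice the
  -- value at a boundary point, which is `0`, minus the value at a point with `|x 0| > 0`, which is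
  -- positive.
  have hiff : ∀ x ∈ e.source, e x ∈ R ↔ x ∈ R := by
    intro x hx
    constructor
    · intro h
      by_contra hxR
      have hneg : x 0 < 0 := not_le.1 hxR
      have hb1 := (hball (setFirst_max_mem_ball hp0 hx.2)).2
      have hb2 := (hball (setFirst_abs_mem_ball hp0 hx.2)).2
      have z1 : F (setFirst (max (x 0) 0) x) 0 = 0 :=
        (hF1 _ hb1 (by simp)).2 (by simp [hneg.le])
      have z2 : 0 ≤ F (setFirst |x 0| x) 0 := hF0 _ hb2 (by simp)
      have z3 : F (setFirst |x 0| x) 0 ≠ 0 := fun h0 => by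
        have := (hF1 _ hb2 (by simp)).1 h0
        rw [setFirst_zero, abs_eq_zero] at this
        exact hneg.ne this
      have z4 : e x 0 = 2 * F (setFirst (max (x 0) 0) x) 0 - F (setFirst |x 0| x) 0 := rfl
      have z5 : 0 ≤ e x 0 := h
      rw [z4, z1] at z5
      exact z3 (le_antisymm (by linarith) z2)
    · intro hxR
      rw [heF x hxR]
      exact hF0 _ (hball hx.2).2 hxR
  have hes : ContDiffOn ℝ ∞ e (e.source ∩ R) :=
    (hF.mono fun x hx => ⟨(hball hx.1.2).2, hx.2⟩).congr fun x hx => heF x hx.2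
  have hm : MapsTo e.symm (e.target ∩ R) (e.source ∩ R) := fun y hy =>
    ⟨e.map_target hy.1, (hiff _ (e.map_target hy.1)).1 (by rw [e.right_inv hy.1]; exact hy.2)⟩
  -- The reflected map need not be smooth across the hyperplane, so the smoothness of the inverse is
  -- obtained within the half-space only, where the map is `F`.
  have hsymm : ContDiffOn ℝ ∞ e.symm (e.target ∩ R) := by
    refine contDiffOn_symm_of_isInvertible hRu (fun y hy => (hm hy).2) hes fun x hx => ?_
    have h2 : fderivWithin ℝ e (e.source ∩ R) x = fderivWithin ℝ F (e.source ∩ R) x :=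
      fderivWithin_congr (fun z hz => heF z hz.2) (heF x hx.2)
    have h3 : fderivWithin ℝ F (e.source ∩ R) x = fderivWithin ℝ F (S ∩ R) x := by
      rw [inter_comm, inter_comm S, fderivWithin_inter (e.open_source.mem_nhds hx.1),
        fderivWithin_inter (hS.mem_nhds (hball hx.1.2).2)]
    rw [h2, h3]
    exact (hball hx.1.2).1 ⟨(hball hx.1.2).2, hx.2⟩
  obtain ⟨e', he's, -, he'1, -, he'g⟩ := exists_openPartialHomeomorph_model (I := 𝓡∂ m)
    (S := e.source) (T := e.target) (F := e) (G := e.symm) e.open_source e.open_target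
    (by rw [hRr]; exact fun x hx => ⟨e.map_source hx.1, (hiff x hx.1).2 hx.2⟩)
    (by rw [hRr]; exact hm) (fun x hx => e.left_inv hx.1) (fun y hy => e.right_inv hy.1)
    (by rw [hRr]; exact hes) (by rw [hRr]; exact hsymm)
  refine ⟨e', ?_, fun x hx => ?_, he'g⟩
  · rw [he's]
    exact ⟨hst.mem_toOpenPartialHomeomorph_source, Metric.mem_ball_self hr⟩
  · rw [he's] at hx
    exact ⟨(hball hx.2).2, (he'1 x hx).trans (heF _ x.2)⟩

end HalfSpaceInverse

/-! ### Kernels of derivatives -/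

section Kernels

variable {E H M E' H' N E'' H'' P : Type*} [NormedAddCommGroup E] [NormedSpace ℝ E]
  [TopologicalSpace H] {I : ModelWithCorners ℝ E H} [TopologicalSpace M] [ChartedSpace H M]
  [NormedAddCommGroup E'] [NormedSpace ℝ E'] [TopologicalSpace H']
  {I' : ModelWithCorners ℝ E' H'} [TopologicalSpace N] [ChartedSpace H' N]
  [NormedAddCommGroup E''] [NormedSpace ℝ E''] [TopologicalSpace H'']
  {I'' : ModelWithCorners ℝ E'' H''} [TopologicalSpace P] [ChartedSpace H'' P]

/-- If `g = h ∘ f` near `x`, then the kernel of the derivative of `f` is contained in that of `g`. -/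
theorem mfderiv_apply_eq_zero_of_comp {f : M → N} {g : M → P} {h : N → P} {x : M}
    (hf : MDifferentiableAt I I' f x) (hh : MDifferentiableAt I' I'' h (f x))
    (hg : ∀ᶠ y in 𝓝 x, g y = h (f y)) {v : TangentSpace I x} (hv : mfderiv I I' f x v = 0) :
    mfderiv I I'' g x v = 0 := by
  have h1 : mfderiv I I'' g x = mfderiv I I'' (h ∘ f) x := Filter.EventuallyEq.mfderiv_eq hg
  rw [h1, mfderiv_comp x hh hf]
  change mfderiv I' I'' h (f x) (mfderiv I I' f x v) = 0
  rw [hv]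
  exact map_zero _

/-- A map with a smooth left inverse has injective derivative. -/
theorem eq_zero_of_mfderiv_of_leftInverse {f : M → N} {h : N → M} {x : M}
    (hf : MDifferentiableAt I I' f x) (hh : MDifferentiableAt I' I h (f x))
    (hg : ∀ᶠ y in 𝓝 x, h (f y) = y) {v : TangentSpace I x} (hv : mfderiv I I' f x v = 0) :
    v = 0 := by
  have h1 := mfderiv_apply_eq_zero_of_comp (g := (id : M → M)) hf hh
    (hg.mono fun y hy => hy.symm) hv
  rw [mfderiv_id] at h1
  exact h1

theorem eq_zero_of_mfderiv_chart [IsManifold I ∞ M] {φ : OpenPartialHomeomorph M H}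
    (hφ : φ ∈ IsManifold.maximalAtlas I ∞ M) {x : M} (hx : x ∈ φ.source) {v : TangentSpace I x}
    (hv : mfderiv I 𝓘(ℝ, E) (φ.extend I) x v = 0) : v = 0 := by
  have hd : MDifferentiableAt I I φ x :=
    (contMDiffAt_of_mem_maximalAtlas hφ hx).mdifferentiableAt (by simp)
  have hd' : MDifferentiableAt I I φ.symm (φ x) :=
    (contMDiffAt_symm_of_mem_maximalAtlas hφ (φ.map_source hx)).mdifferentiableAt (by simp)
  refine eq_zero_of_mfderiv_of_leftInverse hd hd' (φ.eventually_left_inverse hx) ?_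
  have h1 : mfderiv I 𝓘(ℝ, E) (I ∘ φ) x v = 0 := hv
  rw [mfderiv_comp x I.hasMFDerivAt.mdifferentiableAt hd, I.hasMFDerivAt.mfderiv] at h1
  exact h1

/-- The derivative of an immersion is injective. -/
theorem eq_zero_of_mfderiv_of_isImmersionAt [IsManifold I ∞ M] {f : M → N} {x : M}
    (hf : IsImmersionAt I I' ∞ f x) {v : TangentSpace I x} (hv : mfderiv I I' f x v = 0) :
    v = 0 := by
  refine eq_zero_of_mfderiv_chart hf.domChart_mem_maximalAtlas hf.mem_domChart_source ?_
  have hc : MDifferentiableAt I' 𝓘(ℝ, E') (hf.codChart.extend I') (f x) :=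
    (hf.codChart.contMDiffAt_extend hf.codChart_mem_maximalAtlas
      hf.mem_codChart_source).mdifferentiableAt (by simp)
  have hl : MDifferentiableAt 𝓘(ℝ, E') 𝓘(ℝ, E) (fun y => (hf.equiv.symm y).1)
      (hf.codChart.extend I' (f x)) := by
    refine DifferentiableAt.mdifferentiableAt ?_
    exact (hf.equiv.symm.differentiable.fst) _
  -- In the normal form of the immersion, the first component of the codomain coordinates of `f y`
  -- is the domain coordinate of `y`.
  refine mfderiv_apply_eq_zero_of_comp (hf.contMDiffAt.mdifferentiableAt (by simp))
    (h := (fun y => (hf.equiv.symm y).1) ∘ (hf.codChart.extend I')) (hl.comp _ hc) ?_ hv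
  filter_upwards [hf.domChart.open_source.mem_nhds hf.mem_domChart_source] with y hy
  have h1 : hf.domChart.extend I y ∈ (hf.domChart.extend I).target :=
    (hf.domChart.extend I).map_source (by rwa [OpenPartialHomeomorph.extend_source])
  have h2 := hf.writtenInCharts h1
  simp only [Function.comp_apply] at h2 ⊢
  rw [hf.domChart.extend_left_inv hy] at h2
  rw [h2, hf.equiv.symm_apply_apply]

/-- If `c • γ` has vanishing derivative in some direction, where `γ` is a unit vector and `c` a
positive scalar, then so have `c` and `γ`. -/
theorem mfderiv_eq_zero_of_smul_unit {F : Type*} [NormedAddCommGroup F] [InnerProductSpace ℝ F]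
    {c : M → ℝ} {γ : M → F} {x : M} (hc : MDifferentiableAt I 𝓘(ℝ, ℝ) c x)
    (hγ : MDifferentiableAt I 𝓘(ℝ, F) γ x) (hc0 : 0 < c x) (hγ1 : ∀ᶠ y in 𝓝 x, ‖γ y‖ = 1)
    {v : TangentSpace I x} (hv : mfderiv I 𝓘(ℝ, F) (fun y => c y • γ y) x v = 0) :
    mfderiv I 𝓘(ℝ, ℝ) c x v = 0 ∧ mfderiv I 𝓘(ℝ, F) γ x v = 0 := by
  have hcγ : MDifferentiableAt I 𝓘(ℝ, F) (fun y => c y • γ y) x := hc.smul hγ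
  have hpos : ∀ᶠ y in 𝓝 x, 0 < c y := hc.continuousAt.eventually_const_lt hc0
  have hnorm : ∀ᶠ y in 𝓝 x, ‖c y • γ y‖ = c y := by
    filter_upwards [hpos, hγ1] with y h1 h2
    rw [norm_smul, h2, mul_one, Real.norm_of_nonneg h1.le]
  have hne : c x • γ x ≠ 0 := by
    rw [← norm_ne_zero_iff, hnorm.self_of_nhds]
    exact hc0.ne'
  have hdn : DifferentiableAt ℝ (fun y : F => ‖y‖) (c x • γ x) :=
    (contDiffAt_norm ℝ hne (n := 1)).differentiableAt (by simp)
  -- Near `x` the factor `c` is the norm of `c • γ` and `γ` is its normalization; both are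
  -- differentiable functions of a nonzero vector.
  constructor
  · refine mfderiv_apply_eq_zero_of_comp hcγ (h := fun y : F => ‖y‖) hdn.mdifferentiableAt ?_ hv
    exact hnorm.mono fun y hy => hy.symm
  · refine mfderiv_apply_eq_zero_of_comp hcγ (h := fun y : F => ‖y‖⁻¹ • y) ?_ ?_ hv
    · exact ((hdn.inv (norm_ne_zero_iff.2 hne)).smul differentiableAt_id).mdifferentiableAt
    · filter_upwards [hnorm, hpos] with y h1 h2
      rw [h1, smul_smul, inv_mul_cancel₀ h2.ne', one_smul]

end Kernels

/-! ### Injective maps between spaces of equal dimension -/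

section LinearAlgebra

theorem exists_equiv_of_injective {E₁ E₂ : Type*} [NormedAddCommGroup E₁] [NormedSpace ℝ E₁]
    [NormedAddCommGroup E₂] [NormedSpace ℝ E₂] [FiniteDimensional ℝ E₁] [FiniteDimensional ℝ E₂]
    (h : Module.finrank ℝ E₁ = Module.finrank ℝ E₂) {L : E₁ →L[ℝ] E₂}
    (hL : ∀ v, L v = 0 → v = 0) : ∃ A : E₁ ≃L[ℝ] E₂, (A : E₁ →L[ℝ] E₂) = L := by
  have hinj : Function.Injective (L : E₁ →ₗ[ℝ] E₂) :=
    (injective_iff_map_eq_zero _).2 hL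
  refine ⟨(LinearEquiv.ofInjectiveOfFinrankEq _ hinj h).toContinuousLinearEquiv, ?_⟩
  ext v
  rfl

end LinearAlgebra

/-! ### Smoothness into the unit sphere -/

section Sphere

variable {E H M : Type*} [NormedAddCommGroup E] [NormedSpace ℝ E] [TopologicalSpace H]
  {I : ModelWithCorners ℝ E H} [TopologicalSpace M] [ChartedSpace H M]

theorem contMDiff_coe_unitSphere {n : ℕ} : ContMDiff (𝓡 n) 𝓘(ℝ, EuclideanSpace ℝ (Fin (n + 1))) ∞
    (Subtype.val : UnitSphere n → _) :=
  have := Fact.mk (@finrank_euclideanSpace_fin ℝ _ (n + 1))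
  contMDiff_coe_sphere

theorem eq_zero_of_mfderiv_coe_unitSphere {n : ℕ} (y : UnitSphere n) {v : TangentSpace (𝓡 n) y}
    (hv : mfderiv (𝓡 n) 𝓘(ℝ, EuclideanSpace ℝ (Fin (n + 1))) (Subtype.val : UnitSphere n → _) y v
      = 0) : v = 0 :=
  have := Fact.mk (@finrank_euclideanSpace_fin ℝ _ (n + 1))
  injective_mvfderiv_subtypeVal_sphere y (hv.trans (map_zero _).symm)

/-- The chart at `f x` is stereographic projection from `-f x`, whose formula is smooth on an open
subset of the ambient space that contains `f x`. -/
theorem contMDiffAt_unitSphere {n : ℕ} {f : M → UnitSphere n} {x : M}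
    (hf : ContMDiffAt I 𝓘(ℝ, EuclideanSpace ℝ (Fin (n + 1))) ∞ (fun y => (f y).1) x) :
    ContMDiffAt I (𝓡 n) ∞ f x := by
  have := Fact.mk (@finrank_euclideanSpace_fin ℝ _ (n + 1))
  rw [contMDiffAt_iff_target]
  refine ⟨(Topology.IsInducing.subtypeVal.continuousAt_iff).2 hf.continuousAt, ?_⟩
  let U := (OrthonormalBasis.fromOrthogonalSpanSingleton (𝕜 := ℝ)
        n (ne_zero_of_mem_unit_sphere (-(f x)))).repr
  have H₁ : ContDiffOn ℝ ∞ (U ∘ stereoToFun (-(f x)).1) {y | innerSL ℝ (-(f x)).1 y ≠ 1} :=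
    U.contDiff.comp_contDiffOn contDiffOn_stereoToFun
  have hmem : (f x).1 ∈ {y | innerSL ℝ (-(f x)).1 y ≠ 1} := by
    simp only [mem_ofPred_eq, innerSL_apply_apply]
    rw [coe_neg_sphere, inner_neg_left, real_inner_self_eq_norm_sq, norm_eq_of_mem_sphere]
    norm_num
  have hop : IsOpen ({y | innerSL ℝ (-(f x)).1 y ≠ 1}) :=
    isOpen_ne_fun (innerSL ℝ (-(f x)).1).continuous continuous_const
  have H₂ := (H₁.contDiffAt (hop.mem_nhds hmem)).contMDiffAt
  exact H₂.comp x (f := fun y => (f y).1) hf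

end Sphere

/-! ### Immersions from injective derivatives of extensions -/

section ImmersionKernel

variable {E H M E' H' N F : Type*} [NormedAddCommGroup E] [NormedSpace ℝ E] [TopologicalSpace H]
  {I : ModelWithCorners ℝ E H} [TopologicalSpace M] [ChartedSpace H M]
  [NormedAddCommGroup E'] [NormedSpace ℝ E'] [TopologicalSpace H']
  {I' : ModelWithCorners ℝ E' H'} [TopologicalSpace N] [ChartedSpace H' N]
  [NormedAddCommGroup F] [NormedSpace ℝ F]
  [FiniteDimensional ℝ E] [FiniteDimensional ℝ E'] [FiniteDimensional ℝ F]

/-- A map which in charts is the restriction to `E × 0` of a map of `E × F` with injective derivative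
is an immersion, if the dimensions agree. -/
theorem isImmersionAtOfComplement_of_injective [IsManifold I ∞ M] [IsManifold I' ∞ N]
    {f : M → N} {x : M} (hf : ContinuousAt f x) {φ : OpenPartialHomeomorph M H}
    (hφ : φ ∈ IsManifold.maximalAtlas I ∞ M) (hx : x ∈ φ.source) {ψ : OpenPartialHomeomorph N H'}
    (hψ : ψ ∈ IsManifold.maximalAtlas I' ∞ N) (hfx : f x ∈ ψ.source)
    {Φ : E × F → E'} {W : Set (E × F)} (hW : IsOpen W) (hΦ : ContDiffOn ℝ ∞ Φ W)
    (hxW : (φ.extend I x, 0) ∈ W)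
    (hker : ∀ v, fderiv ℝ Φ (φ.extend I x, 0) v = 0 → v = 0) (K : (E × F) ≃L[ℝ] E')
    (hK : ∀ q ∈ W, Φ q ∈ range I' ↔ K q ∈ range I')
    (hΦf : ∀ᶠ y in 𝓝 x, ψ.extend I' (f y) = Φ (φ.extend I y, 0)) :
    IsImmersionAtOfComplement F I I' ∞ f x := by
  have := FiniteDimensional.complete ℝ E
  have := FiniteDimensional.complete ℝ F
  obtain ⟨A, hA⟩ := exists_equiv_of_injective K.toLinearEquiv.finrank_eq hker
  refine isImmersionAtOfComplement_of_charts hf hφ hx hψ hfx hW hΦ hxW (A := A) ?_ K hK hΦf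
  rw [hA]
  exact ((hΦ.contDiffAt (hW.mem_nhds hxW)).differentiableAt (by simp)).hasFDerivAt

/-- An equidimensional map to a manifold without boundary that extends over a chart with injective
derivative is an immersion. -/
theorem isImmersionAtOfComplement_of_extension [IsManifold I ∞ M] [IsManifold I' ∞ N]
    [I'.Boundaryless] (hdim : Module.finrank ℝ E = Module.finrank ℝ E')
    {f : M → N} {x : M} {φ : OpenPartialHomeomorph M H}
    (hφ : φ ∈ IsManifold.maximalAtlas I ∞ M) (hx : x ∈ φ.source)
    {Θ : E → N} {W : Set E} (hW : IsOpen W) (hΘ : ContMDiffOn 𝓘(ℝ, E) I' ∞ Θ W)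
    (hxW : φ.extend I x ∈ W)
    (hker : ∀ v, mfderiv 𝓘(ℝ, E) I' Θ (φ.extend I x) v = 0 → v = 0)
    (hΦf : ∀ᶠ y in 𝓝 x, f y = Θ (φ.extend I y)) :
    IsImmersionAtOfComplement PUnit.{1} I I' ∞ f x := by
  obtain ⟨B⟩ : Nonempty (E ≃L[ℝ] E') := ⟨ContinuousLinearEquiv.ofFinrankEq hdim⟩
  have hc : ContinuousAt f x := by
    refine ContinuousAt.congr ?_ (hΦf.mono fun y hy => hy.symm)
    exact ((hΘ.continuousOn.continuousAt (hW.mem_nhds hxW))).comp (φ.continuousAt_extend hx)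
  have hfx : f x = Θ (φ.extend I x) := hΦf.self_of_nhds
  set ψ := chartAt H' (f x) with hψ
  have hψm : ψ ∈ IsManifold.maximalAtlas I' ∞ N := IsManifold.chart_mem_maximalAtlas _
  have hfxψ : f x ∈ ψ.source := mem_chart_source H' (f x)
  have hW' : IsOpen (W ∩ Θ ⁻¹' ψ.source) :=
    hΘ.continuousOn.isOpen_inter_preimage hW ψ.open_source
  have hxW' : φ.extend I x ∈ W ∩ Θ ⁻¹' ψ.source := ⟨hxW, by rw [mem_preimage, ← hfx]; exact hfxψ⟩
  have hs : ContDiffOn ℝ ∞ (ψ.extend I' ∘ Θ) (W ∩ Θ ⁻¹' ψ.source) :=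
    ((ψ.contMDiffOn_extend hψm).comp (hΘ.mono inter_subset_left) fun x hx => hx.2).contDiffOn
  refine isImmersionAtOfComplement_of_injective (F := PUnit.{1}) hc hφ hx hψm hfxψ
    (Φ := fun q => ψ.extend I' (Θ q.1)) (hW'.preimage continuous_fst)
    (hs.comp contDiff_fst.contDiffOn fun x hx => hx) hxW' ?_
    ((ContinuousLinearEquiv.prodUnique ℝ E PUnit.{1}).trans B) (by simp [I'.range_eq_univ]) ?_
  · intro v hv
    have hd : DifferentiableAt ℝ (ψ.extend I' ∘ Θ) (φ.extend I x) :=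
      (hs.contDiffAt (hW'.mem_nhds hxW')).differentiableAt (by simp)
    have h1 : fderiv ℝ ((ψ.extend I' ∘ Θ) ∘ Prod.fst) (φ.extend I x, (0 : PUnit.{1})) v = 0 := hv
    rw [fderiv_comp (φ.extend I x, (0 : PUnit.{1})) (g := ψ.extend I' ∘ Θ) hd differentiableAt_fst,
      fderiv_fst] at h1
    have h2 : mfderiv 𝓘(ℝ, E) 𝓘(ℝ, E') (ψ.extend I' ∘ Θ) (φ.extend I x) v.1 = 0 := by
      rw [mfderiv_eq_fderiv]; exact h1
    have hdΘ : MDifferentiableAt 𝓘(ℝ, E) I' Θ (φ.extend I x) :=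
      (hΘ.contMDiffAt (hW.mem_nhds hxW)).mdifferentiableAt (by simp)
    have hdψ : MDifferentiableAt I' 𝓘(ℝ, E') (ψ.extend I') (Θ (φ.extend I x)) :=
      (ψ.contMDiffAt_extend hψm hxW'.2).mdifferentiableAt (by simp)
    rw [mfderiv_comp _ hdψ hdΘ] at h2
    have h3 := eq_zero_of_mfderiv_chart hψm hxW'.2 h2
    exact Prod.ext (hker _ h3) rfl
  · exact hΦf.mono fun y hy => by rw [hy]

end ImmersionKernel

/-! ### The closed disk in its Euclidean space -/

section DiskInclusion

theorem contDiff_units_smul {m : ℕ} (s : ℤˣ) :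
    ContDiff ℝ ∞ (fun x : EuclideanSpace ℝ (Fin m) => s • x) := by
  rcases Int.units_eq_one_or s with rfl | rfl
  · simpa using contDiff_fun_id
  · simpa [Units.smul_def] using contDiff_id.neg

variable {m : ℕ} [NeZero m]

theorem diskChart_mem_maximalAtlas (s : ℤˣ) :
    diskChart (m := m) s ∈ IsManifold.maximalAtlas (𝓡∂ m) ∞ (Disk m) :=
  IsManifold.subset_maximalAtlas ⟨s, rfl⟩

theorem diskChart_extend_apply {s : ℤˣ} {x : Disk m} (hx : s • x.1 ≠ -e₀ m) :
    (diskChart s).extend (𝓡∂ m) x = inv (s • x.1) :=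
  toHalf_val hx (norm_smul_disk_le s x)

theorem isOpen_ne_neg_e₀ : IsOpen {x : EuclideanSpace ℝ (Fin m) | x ≠ -e₀ m} := isOpen_ne

theorem contDiffOn_units_smul_inv (s : ℤˣ) :
    ContDiffOn ℝ ∞ (fun x : EuclideanSpace ℝ (Fin m) => s • inv x) {x | x ≠ -e₀ m} :=
  (contDiff_units_smul s).comp_contDiffOn contDiffOn_inv

theorem contDiffAt_inv_units_smul {s : ℤˣ} {x : EuclideanSpace ℝ (Fin m)} (hx : s • x ≠ -e₀ m) :
    ContDiffAt ℝ ∞ (fun x : EuclideanSpace ℝ (Fin m) => inv (s • x)) x :=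
  ((contDiffOn_inv.contDiffAt (isOpen_ne_neg_e₀.mem_nhds hx)) :
    ContDiffAt ℝ ∞ inv (s • x)).comp x (contDiff_units_smul s).contDiffAt

theorem inv_units_smul_units_smul_inv (s : ℤˣ) {x : EuclideanSpace ℝ (Fin m)} (hx : x ≠ -e₀ m) :
    inv (s • s • inv x) = x := by
  rw [units_smul_smul, inv_inv hx]

/-- The chart change `x ↦ s • inv x` of the disk has injective derivative. -/
theorem eq_zero_of_mfderiv_units_smul_inv {s : ℤˣ} {x : EuclideanSpace ℝ (Fin m)}
    (hx : x ≠ -e₀ m) {v : EuclideanSpace ℝ (Fin m)}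
    (hv : mfderiv 𝓘(ℝ, EuclideanSpace ℝ (Fin m)) 𝓘(ℝ, EuclideanSpace ℝ (Fin m))
      (fun x => s • inv x) x v = 0) : v = 0 := by
  refine eq_zero_of_mfderiv_of_leftInverse (h := fun y => inv (s • y)) ?_ ?_ ?_ hv
  · exact (((contDiffOn_units_smul_inv s).contDiffAt
      (isOpen_ne_neg_e₀.mem_nhds hx)).differentiableAt (by simp)).mdifferentiableAt
  · refine ((contDiffAt_inv_units_smul ?_).differentiableAt (by simp)).mdifferentiableAt
    rw [units_smul_smul]
    exact inv_ne hx
  · filter_upwards [isOpen_ne_neg_e₀.mem_nhds hx] with y hy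
    exact inv_units_smul_units_smul_inv s hy

/-- In the chart of sign `s` the inclusion is `u ↦ s • inv u`, which continues smoothly across the
boundary hyperplane and has the inverse `y ↦ inv (s • y)`. Being an immersion is what reduces
smoothness of maps to the disk to smoothness in Euclidean space. -/
theorem isImmersionAt_coe_disk (x : Disk m) :
    IsImmersionAt (𝓡∂ m) 𝓘(ℝ, EuclideanSpace ℝ (Fin m)) ∞ (Subtype.val : Disk m → _) x := by
  obtain ⟨s, hs⟩ := exists_mem_diskChart_source x
  refine (isImmersionAtOfComplement_of_extension rfl (diskChart_mem_maximalAtlas s) hs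
    (Θ := fun u => s • inv u) isOpen_ne_neg_e₀ (contDiffOn_units_smul_inv s).contMDiffOn ?_ ?_
    ?_).isImmersionAt
  · rw [diskChart_extend_apply hs]
    exact inv_ne hs
  · rw [diskChart_extend_apply hs]
    exact fun v hv => eq_zero_of_mfderiv_units_smul_inv (inv_ne hs) hv
  · filter_upwards [(diskChart s).open_source.mem_nhds hs] with y hy
    rw [diskChart_extend_apply hy, inv_inv hy, units_smul_smul]

theorem contMDiff_coe_disk : ContMDiff (𝓡∂ m) 𝓘(ℝ, EuclideanSpace ℝ (Fin m)) ∞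
    (Subtype.val : Disk m → _) :=
  fun x => (isImmersionAt_coe_disk x).contMDiffAt

variable {E H M : Type*} [NormedAddCommGroup E] [NormedSpace ℝ E] [TopologicalSpace H]
  {I : ModelWithCorners ℝ E H} [TopologicalSpace M] [ChartedSpace H M]

theorem contMDiffAt_disk [IsManifold I ∞ M] {f : M → Disk m} {x : M}
    (hf : ContMDiffAt I 𝓘(ℝ, EuclideanSpace ℝ (Fin m)) ∞ (fun y => (f y).1) x) :
    ContMDiffAt I (𝓡∂ m) ∞ f x :=
  (ContMDiffAt.iff_comp_isImmersionAt (isImmersionAt_coe_disk (f x))).2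
    ⟨(Topology.IsInducing.subtypeVal.continuousAt_iff).2 hf.continuousAt, hf⟩

theorem range_halfSpace : range (𝓡∂ m) = {u | 0 ≤ u 0} :=
  range_modelWithCornersEuclideanHalfSpace m

/-- The first coordinate of the chart is `(1 - ‖x‖²) / ‖s • x + e₀‖²`, which vanishes exactly on the
unit sphere. -/
theorem mem_bdry_disk {k : ℕ} {x : Disk (k + 1)} : x ∈ Bdry k (Disk (k + 1)) ↔ ‖x.1‖ = 1 := by
  obtain ⟨s, hs⟩ := exists_mem_diskChart_source x
  have h1 : x ∈ Bdry k (Disk (k + 1)) ↔ _ :=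
    (𝓡∂ (k + 1)).isBoundaryPoint_iff_of_mem_atlas (n := ∞) (by simp) (e := diskChart s) ⟨s, rfl⟩ hs
  have h2 : ((diskChart (m := k + 1) s).extend (𝓡∂ (k + 1))).target = range (𝓡∂ (k + 1)) := by
    rw [OpenPartialHomeomorph.extend_target]
    change (𝓡∂ (k + 1)).symm ⁻¹' univ ∩ _ = _
    simp
  rw [h1, h2, frontier_range_modelWithCornersEuclideanHalfSpace, diskChart_extend_apply hs]
  change 0 = inv (s • x.1) 0 ↔ _
  rw [inv_apply_zero hs, norm_units_smul, eq_comm, div_eq_zero_iff,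
    or_iff_left (norm_add_e₀_sq_pos hs).ne', sub_eq_zero]
  constructor
  · intro h
    exact (pow_eq_one_iff_of_nonneg (norm_nonneg _) two_ne_zero).1 h.symm
  · intro h
    rw [h]; norm_num

end DiskInclusion

/-! ### Splittings of Euclidean spaces and radial projection to the sphere -/

section Coordinates

/-- The splitting of the first coordinate of a Euclidean space. -/
def consEquiv (k : ℕ) : (ℝ × EuclideanSpace ℝ (Fin k)) ≃L[ℝ] EuclideanSpace ℝ (Fin (k + 1)) :=
  LinearEquiv.toContinuousLinearEquiv
    { toFun := fun p => WithLp.toLp 2 (Fin.cons p.1 p.2.ofLp)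
      invFun := fun x => (x 0, WithLp.toLp 2 fun i => x i.succ)
      map_add' := fun p q => by
        ext i
        refine Fin.cases ?_ (fun i => ?_) i <;> simp
      map_smul' := fun c p => by
        ext i
        refine Fin.cases ?_ (fun i => ?_) i <;> simp
      left_inv := fun p => by simp
      right_inv := fun x => by
        ext i
        refine Fin.cases ?_ (fun i => ?_) i <;> simp }

@[simp] theorem consEquiv_apply_zero {k : ℕ} (p : ℝ × EuclideanSpace ℝ (Fin k)) :
    consEquiv k p 0 = p.1 := rfl

@[simp] theorem consEquiv_symm_fst {k : ℕ} (x : EuclideanSpace ℝ (Fin (k + 1))) :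
    ((consEquiv k).symm x).1 = x 0 := rfl

theorem consEquiv_zero_symm_snd {k : ℕ} {x : EuclideanSpace ℝ (Fin (k + 1))} (hx : x 0 = 0) :
    consEquiv k (0, ((consEquiv k).symm x).2) = x := by
  conv_rhs => rw [← (consEquiv k).apply_symm_apply x]
  rw [← hx]; rfl

/-- An isometric identification of a product of Euclidean spaces with a Euclidean space. -/
def joinEquiv (k : ℕ) : (EuclideanSpace ℝ (Fin (k + 1)) × EuclideanSpace ℝ (Fin 2)) ≃L[ℝ]
    EuclideanSpace ℝ (Fin (k + 2 + 1)) :=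
  (WithLp.prodContinuousLinearEquiv 2 ℝ (EuclideanSpace ℝ (Fin (k + 1)))
    (EuclideanSpace ℝ (Fin 2))).symm.trans
    (((stdOrthonormalBasis ℝ (WithLp 2 (EuclideanSpace ℝ (Fin (k + 1)) ×
      EuclideanSpace ℝ (Fin 2)))).reindex (finCongr (by
        rw [(WithLp.prodContinuousLinearEquiv 2 ℝ (EuclideanSpace ℝ (Fin (k + 1)))
          (EuclideanSpace ℝ (Fin 2))).toLinearEquiv.finrank_eq]
        simp
        ))).repr.toContinuousLinearEquiv)

/-- The normalization map to the unit sphere (with a junk value at `0`). -/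
def toSphere {n : ℕ} (y : EuclideanSpace ℝ (Fin (n + 1))) : UnitSphere n :=
  if h : y = 0 then ⟨EuclideanSpace.single 0 1, by simp⟩
  else ⟨‖y‖⁻¹ • y, by
    rw [mem_sphere_zero_iff_norm, norm_smul, norm_inv, norm_norm,
      inv_mul_cancel₀ (norm_ne_zero_iff.2 h)]⟩

variable {n : ℕ}

theorem coe_toSphere {y : EuclideanSpace ℝ (Fin (n + 1))} (hy : y ≠ 0) :
    (toSphere y).1 = ‖y‖⁻¹ • y := by
  rw [toSphere, dif_neg hy]

theorem toSphere_smul {y : EuclideanSpace ℝ (Fin (n + 1))} {c : ℝ} (hc : 0 < c) (hy : y ≠ 0) :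
    toSphere (c • y) = toSphere y := by
  apply Subtype.ext
  rw [coe_toSphere hy, coe_toSphere (smul_ne_zero hc.ne' hy), norm_smul, Real.norm_of_nonneg hc.le,
    smul_smul, mul_inv, mul_right_comm, inv_mul_cancel₀ hc.ne', one_mul]

theorem toSphere_coe (y : UnitSphere n) : toSphere y.1 = y := by
  have h1 : ‖y.1‖ = 1 := norm_eq_of_mem_sphere y
  have h2 : y.1 ≠ 0 := by rw [← norm_ne_zero_iff, h1]; exact one_ne_zero
  apply Subtype.ext
  rw [coe_toSphere h2, h1, inv_one, one_smul]

theorem exists_pos_smul_of_toSphere_eq {y z : EuclideanSpace ℝ (Fin (n + 1))} (hy : y ≠ 0)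
    (hz : z ≠ 0) (h : toSphere y = toSphere z) : ∃ c : ℝ, 0 < c ∧ y = c • z := by
  have h1 := congrArg Subtype.val h
  rw [coe_toSphere hy, coe_toSphere hz] at h1
  refine ⟨‖y‖ * ‖z‖⁻¹, mul_pos (norm_pos_iff.2 hy) (inv_pos.2 (norm_pos_iff.2 hz)), ?_⟩
  rw [mul_smul, ← h1, smul_smul, mul_inv_cancel₀ (norm_ne_zero_iff.2 hy), one_smul]

theorem contMDiffAt_toSphere {y : EuclideanSpace ℝ (Fin (n + 1))} (hy : y ≠ 0) :
    ContMDiffAt 𝓘(ℝ, EuclideanSpace ℝ (Fin (n + 1))) (𝓡 n) ∞ toSphere y := by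
  apply contMDiffAt_unitSphere
  have h : ContDiffAt ℝ ∞ (fun y : EuclideanSpace ℝ (Fin (n + 1)) => ‖y‖⁻¹ • y) y :=
    ((contDiffAt_norm ℝ hy).inv (norm_ne_zero_iff.2 hy)).smul contDiffAt_id
  refine h.contMDiffAt.congr_of_eventuallyEq ?_
  filter_upwards [isOpen_ne.mem_nhds hy] with z hz
  exact coe_toSphere hz

end Coordinates

/-! ### The boundary sphere of the disk as a manifold -/

section DiskBoundary

variable {k : ℕ}

theorem norm_inv_eq_one {m : ℕ} [NeZero m] {x : EuclideanSpace ℝ (Fin m)} (hx : x 0 = 0) :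
    ‖inv x‖ = 1 := by
  have h0 := ne_of_nonneg hx.ge
  have h1 := inv_apply_zero (inv_ne h0)
  rw [inv_inv h0, hx, eq_comm, div_eq_zero_iff,
    or_iff_left (norm_add_e₀_sq_pos (inv_ne h0)).ne', sub_eq_zero] at h1
  exact (pow_eq_one_iff_of_nonneg (norm_nonneg _) two_ne_zero).1 h1.symm

theorem inv_apply_zero_of_norm_eq_one {m : ℕ} [NeZero m] {x : EuclideanSpace ℝ (Fin m)}
    (hx : x ≠ -e₀ m) (h : ‖x‖ = 1) : inv x 0 = 0 := by
  rw [inv_apply_zero hx, h]; simp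

/-- The inverse stereographic projection `u ↦ s • inv (0, u)`. -/
def stereoInv (s : ℤˣ) (u : EuclideanSpace ℝ (Fin k)) : EuclideanSpace ℝ (Fin (k + 1)) :=
  s • inv (consEquiv k (0, u))

/-- The stereographic projection, the last coordinates of `inv (s • x)`. -/
def stereo (s : ℤˣ) (x : EuclideanSpace ℝ (Fin (k + 1))) : EuclideanSpace ℝ (Fin k) :=
  ((consEquiv k).symm (inv (s • x))).2

theorem consEquiv_zero_ne (u : EuclideanSpace ℝ (Fin k)) : consEquiv k (0, u) ≠ -e₀ (k + 1) :=
  ne_of_nonneg (by simp)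

theorem norm_stereoInv (s : ℤˣ) (u : EuclideanSpace ℝ (Fin k)) : ‖stereoInv s u‖ = 1 := by
  rw [stereoInv, norm_units_smul, norm_inv_eq_one (by simp)]

theorem smul_stereoInv_ne (s : ℤˣ) (u : EuclideanSpace ℝ (Fin k)) :
    s • stereoInv s u ≠ -e₀ (k + 1) := by
  rw [stereoInv, units_smul_smul]
  exact inv_ne (consEquiv_zero_ne u)

theorem stereo_stereoInv (s : ℤˣ) (u : EuclideanSpace ℝ (Fin k)) :
    stereo s (stereoInv s u) = u := by
  rw [stereo, stereoInv, units_smul_smul, inv_inv (consEquiv_zero_ne u)]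
  simp

theorem stereoInv_stereo {s : ℤˣ} {x : EuclideanSpace ℝ (Fin (k + 1))} (hx : s • x ≠ -e₀ (k + 1))
    (h : ‖x‖ = 1) : stereoInv s (stereo s x) = x := by
  rw [stereo, stereoInv, consEquiv_zero_symm_snd, inv_inv hx, units_smul_smul]
  exact inv_apply_zero_of_norm_eq_one hx (by rw [norm_units_smul, h])

theorem contDiff_stereoInv (s : ℤˣ) : ContDiff ℝ ∞ (stereoInv (k := k) s) := by
  have h1 : ContDiff ℝ ∞ fun u : EuclideanSpace ℝ (Fin k) => consEquiv k (0, u) :=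
    (consEquiv k).contDiff.comp (contDiff_const.prodMk contDiff_id)
  have h2 := (contDiffOn_units_smul_inv (m := k + 1) s).comp h1.contDiffOn (s := univ)
    fun u _ => consEquiv_zero_ne u
  exact contDiffOn_univ.1 h2

theorem contDiffAt_stereo {s : ℤˣ} {x : EuclideanSpace ℝ (Fin (k + 1))}
    (hx : s • x ≠ -e₀ (k + 1)) : ContDiffAt ℝ ∞ (stereo s) x :=
  contDiff_snd.contDiffAt.comp x
    ((consEquiv k).symm.contDiff.contDiffAt.comp x (contDiffAt_inv_units_smul hx))

/-- The stereographic charts of the boundary of the disk. -/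
def bdryChart (s : ℤˣ) :
    OpenPartialHomeomorph (Bdry k (Disk (k + 1))) (EuclideanSpace ℝ (Fin k)) where
  toFun b := stereo s b.1.1
  invFun u := ⟨⟨stereoInv s u, by rw [mem_closedBall_zero_iff, norm_stereoInv]⟩,
    mem_bdry_disk.2 (norm_stereoInv s u)⟩
  source := {b | s • b.1.1 ≠ -e₀ (k + 1)}
  target := univ
  map_source' _ _ := trivial
  map_target' u _ := smul_stereoInv_ne s u
  left_inv' b hb := Subtype.ext (Subtype.ext (stereoInv_stereo hb (mem_bdry_disk.1 b.2)))
  right_inv' u _ := stereo_stereoInv s u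
  open_source := isOpen_ne_fun
    ((continuous_subtype_val.comp continuous_subtype_val).const_smul s) continuous_const
  open_target := isOpen_univ
  continuousOn_toFun b hb := (ContinuousAt.comp (f := fun b : Bdry k (Disk (k + 1)) => b.1.1)
    (contDiffAt_stereo hb).continuousAt
    (continuous_subtype_val.comp continuous_subtype_val).continuousAt).continuousWithinAt
  continuousOn_invFun := by
    refine Continuous.continuousOn ?_
    exact ((contDiff_stereoInv s).continuous.subtype_mk _).subtype_mk _

theorem exists_mem_bdryChart_source (b : Bdry k (Disk (k + 1))) :
    ∃ s : ℤˣ, b ∈ (bdryChart (k := k) s).source :=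
  exists_mem_diskChart_source b.1

instance instChartedSpaceBdryDisk :
    ChartedSpace (EuclideanSpace ℝ (Fin k)) (Bdry k (Disk (k + 1))) where
  atlas := range bdryChart
  chartAt b := bdryChart (Classical.choose (exists_mem_bdryChart_source b))
  mem_chart_source b := Classical.choose_spec (exists_mem_bdryChart_source b)
  chart_mem_atlas _ := mem_range_self _

instance instIsManifoldBdryDisk : IsManifold (𝓡 k) ∞ (Bdry k (Disk (k + 1))) := by
  apply isManifold_of_contDiffOn
  rintro _ _ ⟨s, rfl⟩ ⟨s', rfl⟩
  rintro u ⟨hu, -⟩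
  have hu' : s' • stereoInv s u ≠ -e₀ (k + 1) := hu.2
  exact ((contDiffAt_stereo hu').comp u (contDiff_stereoInv s).contDiffAt).contDiffWithinAt

theorem bdryChart_mem_maximalAtlas (s : ℤˣ) :
    bdryChart (k := k) s ∈ IsManifold.maximalAtlas (𝓡 k) ∞ (Bdry k (Disk (k + 1))) :=
  IsManifold.subset_maximalAtlas ⟨s, rfl⟩

/-- In the charts of the same sign the inclusion is `u ↦ (0, u)`, which is already the normal form
of an immersion with complement `ℝ`. -/
theorem isSmoothEmbedding_coe_bdry_disk :
    IsSmoothEmbedding (𝓡 k) (𝓡∂ (k + 1)) ∞ (Subtype.val : Bdry k (Disk (k + 1)) → _) := by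
  refine ⟨IsImmersionOfComplement.isImmersion (F := ℝ) fun b => ?_, Topology.IsEmbedding.subtypeVal⟩
  obtain ⟨s, hs⟩ := exists_mem_bdryChart_source b
  refine IsImmersionAtOfComplement.mk_of_continuousAt continuous_subtype_val.continuousAt
    ((ContinuousLinearEquiv.prodComm ℝ _ _).trans (consEquiv k)) (bdryChart s) (diskChart s) hs hs
    (bdryChart_mem_maximalAtlas s) (diskChart_mem_maximalAtlas s) fun u _ => ?_
  have h1 : s • ((bdryChart (k := k) s).symm u).1.1 ≠ -e₀ (k + 1) := smul_stereoInv_ne s u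
  change (diskChart s).extend (𝓡∂ (k + 1)) ((bdryChart (k := k) s).symm u).1 = consEquiv k (0, u)
  rw [diskChart_extend_apply h1]
  change inv (s • s • inv (consEquiv k (0, u))) = _
  exact inv_units_smul_units_smul_inv s (consEquiv_zero_ne u)

end DiskBoundary

/-! ### The boundary circle and its angle function -/

section CirclePoints

theorem circlePoint_zero' (t : ℝ) : (circlePoint t).1 0 = Real.cos (2 * Real.pi * t) := rfl
theorem circlePoint_one' (t : ℝ) : (circlePoint t).1 1 = Real.sin (2 * Real.pi * t) := rfl

theorem norm_circlePoint (t : ℝ) : ‖(circlePoint t).1‖ = 1 := by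
  rw [EuclideanSpace.norm_eq]
  simp [circlePoint_zero', circlePoint_one']

theorem contDiff_circlePoint : ContDiff ℝ ∞ fun t => (circlePoint t).1 := by
  rw [contDiff_euclidean]
  intro i
  fin_cases i
  · exact Real.contDiff_cos.comp (contDiff_const.mul contDiff_id)
  · exact Real.contDiff_sin.comp (contDiff_const.mul contDiff_id)

theorem circlePoint_eq_iff {s t : ℝ} : circlePoint s = circlePoint t ↔ ∃ j : ℤ, s = t + j := by
  constructor
  · intro h
    have h0 := congrArg (fun z : Disk 2 => z.1 0) h
    have h1 := congrArg (fun z : Disk 2 => z.1 1) h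
    simp only [circlePoint_zero', circlePoint_one'] at h0 h1
    obtain ⟨j, hj⟩ := Real.Angle.angle_eq_iff_two_pi_dvd_sub.1 (Real.Angle.cos_sin_inj h0 h1)
    refine ⟨j, ?_⟩
    have : 2 * Real.pi * (s - t - j) = 0 := by linarith
    rcases mul_eq_zero.1 this with h | h
    · exact absurd h Real.two_pi_pos.ne'
    · linarith
  · rintro ⟨j, rfl⟩
    apply Subtype.ext
    ext i
    have h : 2 * Real.pi * (t + j) = 2 * Real.pi * t + j * (2 * Real.pi) := by ring
    fin_cases i
    · change Real.cos _ = Real.cos _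
      rw [h, Real.cos_add_int_mul_two_pi]
    · change Real.sin _ = Real.sin _
      rw [h, Real.sin_add_int_mul_two_pi]

theorem exists_circlePoint_eq {z : EuclideanSpace ℝ (Fin 2)} (hz : ‖z‖ = 1) :
    ∃ t, (circlePoint t).1 = z := by
  have hn : ‖(⟨z 0, z 1⟩ : ℂ)‖ = 1 := by
    rw [EuclideanSpace.norm_eq] at hz
    rw [Complex.norm_def, Complex.normSq_mk, ← hz]
    simp [sq]
  have hne : (⟨z 0, z 1⟩ : ℂ) ≠ 0 := by rw [← norm_ne_zero_iff, hn]; exact one_ne_zero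
  refine ⟨Complex.arg ⟨z 0, z 1⟩ / (2 * Real.pi), ?_⟩
  have h : 2 * Real.pi * (Complex.arg ⟨z 0, z 1⟩ / (2 * Real.pi)) = Complex.arg ⟨z 0, z 1⟩ :=
    mul_div_cancel₀ _ Real.two_pi_pos.ne'
  ext i
  fin_cases i
  · change Real.cos _ = z 0
    rw [h, Complex.cos_arg hne, hn, div_one]
  · change Real.sin _ = z 1
    rw [h, Complex.sin_arg, hn, div_one]

/-- A local inverse of `circlePoint` near `t₀`. -/
def circleAngle (t₀ : ℝ) (z : EuclideanSpace ℝ (Fin 2)) : ℝ :=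
  t₀ + Real.arcsin (z 1 * Real.cos (2 * Real.pi * t₀) - z 0 * Real.sin (2 * Real.pi * t₀)) /
    (2 * Real.pi)

theorem circleAngle_circlePoint (t₀ : ℝ) :
    ∀ᶠ t in 𝓝 t₀, circleAngle t₀ (circlePoint t).1 = t := by
  -- The argument of `arcsin` is `sin (2π(t - t₀))`; radius `1/4` keeps the angle between `-π/2` and
  -- `π/2`.
  filter_upwards [Metric.ball_mem_nhds t₀ (by norm_num : (0 : ℝ) < 1 / 4)] with t ht
  rw [Real.ball_eq_Ioo] at ht
  rw [circleAngle, circlePoint_zero', circlePoint_one', ← Real.sin_sub, ← mul_sub,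
    Real.arcsin_sin, mul_div_cancel_left₀ _ Real.two_pi_pos.ne']
  · ring
  · nlinarith [Real.pi_pos, ht.1]
  · nlinarith [Real.pi_pos, ht.2]

theorem differentiableAt_circleAngle (t₀ : ℝ) :
    DifferentiableAt ℝ (circleAngle t₀) (circlePoint t₀).1 := by
  have h : (circlePoint t₀).1 1 * Real.cos (2 * Real.pi * t₀) -
      (circlePoint t₀).1 0 * Real.sin (2 * Real.pi * t₀) = 0 := by
    rw [circlePoint_zero', circlePoint_one']; ring
  have h2 : DifferentiableAt ℝ Real.arcsin ((circlePoint t₀).1 1 * Real.cos (2 * Real.pi * t₀) -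
      (circlePoint t₀).1 0 * Real.sin (2 * Real.pi * t₀)) := by
    rw [h, Real.differentiableAt_arcsin]; norm_num
  have h3 : DifferentiableAt ℝ (fun z : EuclideanSpace ℝ (Fin 2) =>
      z 1 * Real.cos (2 * Real.pi * t₀) - z 0 * Real.sin (2 * Real.pi * t₀)) (circlePoint t₀).1 := by
    fun_prop
  have h4 := DifferentiableAt.comp (g := Real.arcsin) (circlePoint t₀).1 h2 h3
  have h5 := h4.mul_const (2 * Real.pi)⁻¹
  have h6 : circleAngle t₀ = fun z => t₀ + (Real.arcsin ∘ fun z : EuclideanSpace ℝ (Fin 2) =>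
      z 1 * Real.cos (2 * Real.pi * t₀) - z 0 * Real.sin (2 * Real.pi * t₀)) z *
      (2 * Real.pi)⁻¹ := by
    funext z
    rw [circleAngle, div_eq_mul_inv]
    rfl
  rw [h6]
  exact h5.const_add t₀

end CirclePoints

/-! ### The open book of the sphere with page the disk -/

section DiskOpenBook

variable {k : ℕ}

theorem joinEquiv_ne_zero {p : EuclideanSpace ℝ (Fin (k + 1)) × EuclideanSpace ℝ (Fin 2)}
    (hp : p ≠ 0) : joinEquiv k p ≠ 0 := (joinEquiv k).map_ne_zero_iff.2 hp

theorem toSphere_join_eq_iff {p q : EuclideanSpace ℝ (Fin (k + 1)) × EuclideanSpace ℝ (Fin 2)}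
    (hp : p ≠ 0) (hq : q ≠ 0) :
    toSphere (joinEquiv k p) = toSphere (joinEquiv k q) ↔ ∃ c : ℝ, 0 < c ∧ p = c • q := by
  constructor
  · intro h
    obtain ⟨c, hc, h1⟩ := exists_pos_smul_of_toSphere_eq (joinEquiv_ne_zero hp)
      (joinEquiv_ne_zero hq) h
    refine ⟨c, hc, (joinEquiv k).injective ?_⟩
    rw [h1, map_smul]
  · rintro ⟨c, hc, rfl⟩
    rw [map_smul, toSphere_smul hc (joinEquiv_ne_zero hq)]

theorem differentiableAt_inv_norm {E F : Type*} [NormedAddCommGroup E] [NormedSpace ℝ E]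
    [NormedAddCommGroup F] [InnerProductSpace ℝ F] {f : E → F} {x : E}
    (hf : DifferentiableAt ℝ f x) (hx : f x ≠ 0) : DifferentiableAt ℝ (fun y => ‖f y‖⁻¹) x :=
  (hf.norm ℝ hx).fun_inv (norm_ne_zero_iff.2 hx)

/-- The embedding of the mapping torus of the identity of the disk. -/
def diskPage (k : ℕ) (p : Disk (k + 1) × ℝ) : UnitSphere (k + 2) :=
  toSphere (joinEquiv k (p.1.1, (circlePoint p.2).1))

/-- The embedding of the neighbourhood of the binding of the disk open book. -/
def diskBinding (k : ℕ) (p : Bdry k (Disk (k + 1)) × Disk 2) : UnitSphere (k + 2) :=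
  toSphere (joinEquiv k (p.1.1.1, p.2.1))

theorem circlePoint_ne_zero (t : ℝ) : (circlePoint t).1 ≠ 0 := by
  rw [← norm_ne_zero_iff, norm_circlePoint]; exact one_ne_zero

theorem coe_bdry_disk_ne_zero (b : Bdry k (Disk (k + 1))) : b.1.1 ≠ 0 := by
  rw [← norm_ne_zero_iff, mem_bdry_disk.1 b.2]; exact one_ne_zero

theorem mk_ne_zero_right {E F : Type*} [Zero E] [Zero F] {x : E} {y : F} (hy : y ≠ 0) :
    (x, y) ≠ 0 := fun h => hy (congrArg Prod.snd h)

theorem mk_ne_zero_left {E F : Type*} [Zero E] [Zero F] {x : E} {y : F} (hx : x ≠ 0) :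
    (x, y) ≠ 0 := fun h => hx (congrArg Prod.fst h)

/-- The radial projections of the sphere recover a point from its image. -/
theorem joinEquiv_symm_toSphere {p : EuclideanSpace ℝ (Fin (k + 1)) × EuclideanSpace ℝ (Fin 2)}
    (hp : p ≠ 0) : ∃ c : ℝ, 0 < c ∧ (joinEquiv k).symm (toSphere (joinEquiv k p)).1 = c • p := by
  refine ⟨‖joinEquiv k p‖⁻¹, inv_pos.2 (norm_pos_iff.2 (joinEquiv_ne_zero hp)), ?_⟩
  rw [coe_toSphere (joinEquiv_ne_zero hp), map_smul, (joinEquiv k).symm_apply_apply]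

theorem norm_inv_smul_smul {E F : Type*} [NormedAddCommGroup E] [NormedSpace ℝ E]
    [NormedAddCommGroup F] [NormedSpace ℝ F] {c : ℝ} (hc : 0 < c) {x : E} {y : F} (hy : ‖y‖ = 1) :
    ‖c • y‖⁻¹ • c • x = x := by
  rw [norm_smul, hy, mul_one, Real.norm_of_nonneg hc.le, smul_smul, inv_mul_cancel₀ hc.ne',
    one_smul]

/-- Before normalization the `ℝ²`-component has norm `1`. Dividing a point of the sphere by the norm
of that component thus undoes the normalization, and the disk chart and a local angle complete a
smooth left inverse. Equality of dimensions does the rest. -/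
theorem isImmersion_diskPage :
    IsImmersion ((𝓡∂ (k + 1)).prod 𝓘(ℝ, ℝ)) (𝓡 (k + 2)) ∞ (diskPage k) := by
  refine IsImmersionOfComplement.isImmersion (F := PUnit.{1}) fun p => ?_
  obtain ⟨x, t⟩ := p
  obtain ⟨s, hs⟩ := exists_mem_diskChart_source x
  have hφ : (diskChart s).prod (OpenPartialHomeomorph.refl ℝ) ∈
      IsManifold.maximalAtlas ((𝓡∂ (k + 1)).prod 𝓘(ℝ, ℝ)) ∞ (Disk (k + 1) × ℝ) :=
    IsManifold.mem_maximalAtlas_prod (diskChart_mem_maximalAtlas s)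
      (IsManifold.subset_maximalAtlas rfl)
  have hext : ∀ y : Disk (k + 1) × ℝ, s • y.1.1 ≠ -e₀ (k + 1) →
      ((diskChart s).prod (OpenPartialHomeomorph.refl ℝ)).extend
        ((𝓡∂ (k + 1)).prod 𝓘(ℝ, ℝ)) y = (inv (s • y.1.1), y.2) := fun y hy => by
    rw [← diskChart_extend_apply hy]; rfl
  have hopen : IsOpen {w : EuclideanSpace ℝ (Fin (k + 1)) × ℝ | w.1 ≠ -e₀ (k + 1)} :=
    isOpen_ne_neg_e₀.preimage continuous_fst
  have hQ : ContDiffOn ℝ ∞ (fun w : EuclideanSpace ℝ (Fin (k + 1)) × ℝ =>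
      joinEquiv k (s • inv w.1, (circlePoint w.2).1)) {w | w.1 ≠ -e₀ (k + 1)} :=
    (joinEquiv k).contDiff.comp_contDiffOn
      (((contDiffOn_units_smul_inv s).comp contDiff_fst.contDiffOn fun w hw => hw).prodMk
        (contDiff_circlePoint.comp contDiff_snd).contDiffOn)
  have hΘ : ContMDiffOn 𝓘(ℝ, EuclideanSpace ℝ (Fin (k + 1)) × ℝ) (𝓡 (k + 2)) ∞
      (fun w : EuclideanSpace ℝ (Fin (k + 1)) × ℝ =>
        toSphere (joinEquiv k (s • inv w.1, (circlePoint w.2).1))) {w | w.1 ≠ -e₀ (k + 1)} :=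
    fun w hw => ((contMDiffAt_toSphere (joinEquiv_ne_zero
      (mk_ne_zero_right (circlePoint_ne_zero w.2)))).comp w
      (hQ.contDiffAt (hopen.mem_nhds hw)).contMDiffAt).contMDiffWithinAt
  have hxW : (inv (s • x.1), t) ∈
      {w : EuclideanSpace ℝ (Fin (k + 1)) × ℝ | w.1 ≠ -e₀ (k + 1)} := inv_ne hs
  refine isImmersionAtOfComplement_of_extension (by simp [Module.finrank_prod]) hφ ⟨hs, trivial⟩
    hopen hΘ ?_ ?_ ?_
  · rw [hext (x, t) hs]; exact hxW
  · rw [hext (x, t) hs]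
    intro v hv
    refine eq_zero_of_mfderiv_of_leftInverse (h := fun y : UnitSphere (k + 2) =>
      ((fun q : EuclideanSpace ℝ (Fin (k + 1)) × EuclideanSpace ℝ (Fin 2) =>
        (inv (s • (‖q.2‖⁻¹ • q.1)), circleAngle t (‖q.2‖⁻¹ • q.2))) ∘ (joinEquiv k).symm) y.1)
      ((hΘ.contMDiffAt (hopen.mem_nhds hxW)).mdifferentiableAt (by simp)) ?_ ?_ hv
    · refine MDifferentiableAt.comp (I' := 𝓘(ℝ, EuclideanSpace ℝ (Fin (k + 2 + 1))))
        (f := (Subtype.val : UnitSphere (k + 2) → _)) (g := (fun q : EuclideanSpace ℝ (Fin (k + 1)) ×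
          EuclideanSpace ℝ (Fin 2) => (inv (s • (‖q.2‖⁻¹ • q.1)), circleAngle t (‖q.2‖⁻¹ • q.2))) ∘
            (joinEquiv k).symm) _ ?_
        (contMDiff_coe_unitSphere.contMDiffAt.mdifferentiableAt (by simp))
      refine DifferentiableAt.mdifferentiableAt ?_
      obtain ⟨c, hc, h1⟩ := joinEquiv_symm_toSphere (k := k)
        (p := (s • inv (inv (s • x.1)), (circlePoint t).1))
        (mk_ne_zero_right (circlePoint_ne_zero t))
      refine DifferentiableAt.comp _ ?_ (joinEquiv k).symm.differentiableAt
      rw [h1]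
      have hne : c • (circlePoint t).1 ≠ 0 := smul_ne_zero hc.ne' (circlePoint_ne_zero t)
      have hd : DifferentiableAt ℝ (fun q : EuclideanSpace ℝ (Fin (k + 1)) ×
          EuclideanSpace ℝ (Fin 2) => ‖q.2‖⁻¹)
          (c • (s • inv (inv (s • x.1)), (circlePoint t).1)) :=
        differentiableAt_inv_norm (f := Prod.snd) differentiableAt_snd hne
      refine DifferentiableAt.prodMk ?_ ?_
      · refine DifferentiableAt.comp (g := fun x => inv (s • x)) _ ?_ (hd.smul differentiableAt_fst)
        refine (contDiffAt_inv_units_smul ?_).differentiableAt (by simp)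
        change s • (‖c • (circlePoint t).1‖⁻¹ • c • s • inv (inv (s • x.1))) ≠ _
        rw [norm_inv_smul_smul hc (norm_circlePoint t), inv_inv hs, units_smul_smul]
        exact hs
      · refine DifferentiableAt.comp (g := circleAngle t) _ ?_ (hd.smul differentiableAt_snd)
        change DifferentiableAt ℝ (circleAngle t)
          (‖c • (circlePoint t).1‖⁻¹ • c • (circlePoint t).1)
        rw [norm_inv_smul_smul hc (norm_circlePoint t)]
        exact differentiableAt_circleAngle t
    · have h2 : ∀ᶠ w : EuclideanSpace ℝ (Fin (k + 1)) × ℝ in 𝓝 (inv (s • x.1), t),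
          circleAngle t (circlePoint w.2).1 = w.2 :=
        (continuous_snd.tendsto (inv (s • x.1), t)).eventually
          (p := fun r => circleAngle t (circlePoint r).1 = r) (circleAngle_circlePoint t)
      filter_upwards [hopen.mem_nhds hxW, h2] with w hw hw2
      obtain ⟨c, hc, h1⟩ := joinEquiv_symm_toSphere (k := k)
        (p := (s • inv w.1, (circlePoint w.2).1)) (mk_ne_zero_right (circlePoint_ne_zero w.2))
      simp only [Function.comp_apply]
      rw [h1]
      simp only [Prod.smul_mk]
      rw [norm_inv_smul_smul hc (norm_circlePoint w.2), norm_inv_smul_smul hc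
        (norm_circlePoint w.2), inv_units_smul_units_smul_inv s hw, hw2]
  · filter_upwards [((diskChart s).prod (OpenPartialHomeomorph.refl ℝ)).open_source.mem_nhds
      (⟨hs, trivial⟩ : (x, t) ∈ ((diskChart s).prod (OpenPartialHomeomorph.refl ℝ)).source)] with y hy
    rw [hext y hy.1]
    simp only [diskPage]
    rw [inv_inv hy.1, units_smul_smul]

/-- As for `isImmersion_diskPage`, with the roles of the factors exchanged: here the
`ℝ^(k+1)`-component has norm `1` before normalization. -/
theorem isImmersion_diskBinding :
    IsImmersion ((𝓡 k).prod (𝓡∂ 2)) (𝓡 (k + 2)) ∞ (diskBinding k) := by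
  refine IsImmersionOfComplement.isImmersion (F := PUnit.{1}) fun p => ?_
  obtain ⟨b, z⟩ := p
  obtain ⟨s, hs⟩ := exists_mem_bdryChart_source b
  obtain ⟨s', hs'⟩ := exists_mem_diskChart_source z
  have hφ : (bdryChart s).prod (diskChart s') ∈
      IsManifold.maximalAtlas ((𝓡 k).prod (𝓡∂ 2)) ∞ (Bdry k (Disk (k + 1)) × Disk 2) :=
    IsManifold.mem_maximalAtlas_prod (bdryChart_mem_maximalAtlas s) (diskChart_mem_maximalAtlas s')
  have hext : ∀ y : Bdry k (Disk (k + 1)) × Disk 2, s' • y.2.1 ≠ -e₀ 2 →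
      ((bdryChart s).prod (diskChart s')).extend ((𝓡 k).prod (𝓡∂ 2)) y =
        (stereo s y.1.1.1, inv (s' • y.2.1)) := fun y hy => by
    rw [← diskChart_extend_apply hy]; rfl
  have hopen : IsOpen {w : EuclideanSpace ℝ (Fin k) × EuclideanSpace ℝ (Fin 2) |
      w.2 ≠ -e₀ 2} := isOpen_ne_neg_e₀.preimage continuous_snd
  have hQ : ContDiffOn ℝ ∞ (fun w : EuclideanSpace ℝ (Fin k) × EuclideanSpace ℝ (Fin 2) =>
      joinEquiv k (stereoInv s w.1, s' • inv w.2)) {w | w.2 ≠ -e₀ 2} :=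
    (joinEquiv k).contDiff.comp_contDiffOn
      (((contDiff_stereoInv s).comp contDiff_fst).contDiffOn.prodMk
        ((contDiffOn_units_smul_inv s').comp contDiff_snd.contDiffOn fun w hw => hw))
  have hne0 : ∀ u : EuclideanSpace ℝ (Fin k), stereoInv s u ≠ 0 := fun u => by
    rw [← norm_ne_zero_iff, norm_stereoInv]; exact one_ne_zero
  have hΘ : ContMDiffOn 𝓘(ℝ, EuclideanSpace ℝ (Fin k) × EuclideanSpace ℝ (Fin 2)) (𝓡 (k + 2)) ∞
      (fun w : EuclideanSpace ℝ (Fin k) × EuclideanSpace ℝ (Fin 2) =>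
        toSphere (joinEquiv k (stereoInv s w.1, s' • inv w.2))) {w | w.2 ≠ -e₀ 2} :=
    fun w hw => ((contMDiffAt_toSphere (joinEquiv_ne_zero
      (mk_ne_zero_left (hne0 w.1)))).comp w
      (hQ.contDiffAt (hopen.mem_nhds hw)).contMDiffAt).contMDiffWithinAt
  have hxW : (stereo s b.1.1, inv (s' • z.1)) ∈
      {w : EuclideanSpace ℝ (Fin k) × EuclideanSpace ℝ (Fin 2) | w.2 ≠ -e₀ 2} := inv_ne hs'
  refine isImmersionAtOfComplement_of_extension (by simp [Module.finrank_prod]) hφ ⟨hs, hs'⟩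
    hopen hΘ ?_ ?_ ?_
  · rw [hext (b, z) hs']; exact hxW
  · rw [hext (b, z) hs']
    intro v hv
    refine eq_zero_of_mfderiv_of_leftInverse (h := fun y : UnitSphere (k + 2) =>
      ((fun q : EuclideanSpace ℝ (Fin (k + 1)) × EuclideanSpace ℝ (Fin 2) =>
        (stereo s (‖q.1‖⁻¹ • q.1), inv (s' • (‖q.1‖⁻¹ • q.2)))) ∘ (joinEquiv k).symm) y.1)
      ((hΘ.contMDiffAt (hopen.mem_nhds hxW)).mdifferentiableAt (by simp)) ?_ ?_ hv
    · refine MDifferentiableAt.comp (I' := 𝓘(ℝ, EuclideanSpace ℝ (Fin (k + 2 + 1))))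
        (f := (Subtype.val : UnitSphere (k + 2) → _)) (g := (fun q : EuclideanSpace ℝ (Fin (k + 1)) ×
          EuclideanSpace ℝ (Fin 2) => (stereo s (‖q.1‖⁻¹ • q.1), inv (s' • (‖q.1‖⁻¹ • q.2)))) ∘
            (joinEquiv k).symm) _ ?_
        (contMDiff_coe_unitSphere.contMDiffAt.mdifferentiableAt (by simp))
      refine DifferentiableAt.mdifferentiableAt ?_
      obtain ⟨c, hc, h1⟩ := joinEquiv_symm_toSphere (k := k)
        (p := (stereoInv s (stereo s b.1.1), s' • inv (inv (s' • z.1))))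
        (mk_ne_zero_left (hne0 _))
      refine DifferentiableAt.comp _ ?_ (joinEquiv k).symm.differentiableAt
      rw [h1]
      have hne : c • stereoInv s (stereo s b.1.1) ≠ 0 := smul_ne_zero hc.ne' (hne0 _)
      have hd : DifferentiableAt ℝ (fun q : EuclideanSpace ℝ (Fin (k + 1)) ×
          EuclideanSpace ℝ (Fin 2) => ‖q.1‖⁻¹)
          (c • (stereoInv s (stereo s b.1.1), s' • inv (inv (s' • z.1)))) :=
        differentiableAt_inv_norm (f := Prod.fst) differentiableAt_fst hne
      refine DifferentiableAt.prodMk ?_ ?_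
      · refine DifferentiableAt.comp (g := stereo s) _ ?_ (hd.smul differentiableAt_fst)
        refine (contDiffAt_stereo ?_).differentiableAt (by simp)
        change s • (‖c • stereoInv s (stereo s b.1.1)‖⁻¹ • c • stereoInv s (stereo s b.1.1)) ≠ _
        rw [norm_inv_smul_smul hc (norm_stereoInv _ _)]
        exact smul_stereoInv_ne _ _
      · refine DifferentiableAt.comp (g := fun x => inv (s' • x)) _ ?_ (hd.smul differentiableAt_snd)
        refine (contDiffAt_inv_units_smul ?_).differentiableAt (by simp)
        change s' • (‖c • stereoInv s (stereo s b.1.1)‖⁻¹ • c • s' • inv (inv (s' • z.1))) ≠ _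
        rw [norm_inv_smul_smul hc (norm_stereoInv _ _), inv_inv hs', units_smul_smul]
        exact hs'
    · filter_upwards [hopen.mem_nhds hxW] with w hw
      obtain ⟨c, hc, h1⟩ := joinEquiv_symm_toSphere (k := k)
        (p := (stereoInv s w.1, s' • inv w.2)) (mk_ne_zero_left (hne0 _))
      simp only [Function.comp_apply]
      rw [h1]
      simp only [Prod.smul_mk]
      rw [norm_inv_smul_smul hc (norm_stereoInv _ _), norm_inv_smul_smul hc
        (norm_stereoInv _ _), stereo_stereoInv, inv_units_smul_units_smul_inv s' hw]
  · filter_upwards [((bdryChart s).prod (diskChart s')).open_source.mem_nhds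
      (⟨hs, hs'⟩ : (b, z) ∈ ((bdryChart s).prod (diskChart s')).source)] with y hy
    rw [hext y hy.2]
    simp only [diskBinding]
    rw [inv_inv hy.2, units_smul_smul, stereoInv_stereo hy.1 (mem_bdry_disk.1 y.1.2)]

theorem diskPage_eq_iff {x y : Disk (k + 1)} {s t : ℝ} :
    diskPage k (x, s) = diskPage k (y, t) ↔ ∃ j : ℤ, s = t + j ∧ y = x := by
  rw [diskPage, diskPage, toSphere_join_eq_iff (mk_ne_zero_right (circlePoint_ne_zero _))
    (mk_ne_zero_right (circlePoint_ne_zero _))]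
  constructor
  · rintro ⟨c, hc, h⟩
    have h1 : x.1 = c • y.1 := congrArg Prod.fst h
    have h2 : (circlePoint s).1 = c • (circlePoint t).1 := congrArg Prod.snd h
    have h3 := congrArg norm h2
    rw [norm_smul, norm_circlePoint, norm_circlePoint, mul_one, Real.norm_of_nonneg hc.le] at h3
    rw [← h3, one_smul] at h1 h2
    obtain ⟨j, hj⟩ := circlePoint_eq_iff.1 (Subtype.ext h2)
    exact ⟨j, hj, Subtype.ext h1.symm⟩
  · rintro ⟨j, hj, rfl⟩
    refine ⟨1, one_pos, ?_⟩
    rw [one_smul, circlePoint_eq_iff.2 ⟨j, hj⟩]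

theorem diskBinding_injective : Function.Injective (diskBinding k) := by
  rintro ⟨b, z⟩ ⟨b', z'⟩ h
  rw [diskBinding, diskBinding, toSphere_join_eq_iff (mk_ne_zero_left (coe_bdry_disk_ne_zero _))
    (mk_ne_zero_left (coe_bdry_disk_ne_zero _))] at h
  obtain ⟨c, hc, h⟩ := h
  have h1 : b.1.1 = c • b'.1.1 := congrArg Prod.fst h
  have h2 : z.1 = c • z'.1 := congrArg Prod.snd h
  have h3 := congrArg norm h1
  rw [norm_smul, mem_bdry_disk.1 b.2, mem_bdry_disk.1 b'.2, mul_one,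
    Real.norm_of_nonneg hc.le] at h3
  rw [← h3, one_smul] at h1 h2
  exact Prod.ext (Subtype.ext (Subtype.ext h1)) (Subtype.ext h2)

theorem diskPage_eq_diskBinding_iff {x : Disk (k + 1)} {t : ℝ} {b : Bdry k (Disk (k + 1))}
    {z : Disk 2} : diskPage k (x, t) = diskBinding k (b, z) ↔ x = b ∧ z = circlePoint t := by
  rw [diskPage, diskBinding, toSphere_join_eq_iff (mk_ne_zero_right (circlePoint_ne_zero _))
    (mk_ne_zero_left (coe_bdry_disk_ne_zero _))]
  constructor
  · rintro ⟨c, hc, h⟩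
    have h1 : x.1 = c • b.1.1 := congrArg Prod.fst h
    have h2 : (circlePoint t).1 = c • z.1 := congrArg Prod.snd h
    have h3 := congrArg norm h1
    have h4 := congrArg norm h2
    rw [norm_smul, mem_bdry_disk.1 b.2, mul_one, Real.norm_of_nonneg hc.le] at h3
    rw [norm_smul, norm_circlePoint, Real.norm_of_nonneg hc.le] at h4
    have h5 : ‖x.1‖ ≤ 1 := mem_closedBall_zero_iff.1 x.2
    have h6 : ‖z.1‖ ≤ 1 := mem_closedBall_zero_iff.1 z.2
    -- The first components give `c = ‖x‖ ≤ 1`, the second ones `1 = c ‖z‖ ≤ c`.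
    have h7 : c = 1 := by nlinarith
    rw [h7, one_smul] at h1 h2
    exact ⟨Subtype.ext h1, Subtype.ext h2.symm⟩
  · rintro ⟨rfl, rfl⟩
    exact ⟨1, one_pos, (one_smul _ _).symm⟩

/-- The ray through a point of the sphere leaves `D^(k+1) × D²` through the face that belongs to the
component of larger norm. -/
theorem range_diskPage_union : range (diskPage k) ∪ range (diskBinding k) = univ := by
  rw [eq_univ_iff_forall]
  intro y
  have hy : y.1 ≠ 0 := by
    rw [← norm_ne_zero_iff, norm_eq_of_mem_sphere y]; exact one_ne_zero
  obtain ⟨p, hp⟩ := (joinEquiv k).surjective y.1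
  have hp0 : p ≠ 0 := by rintro rfl; exact hy (by rw [← hp, map_zero])
  have key : ∀ c : ℝ, 0 < c → toSphere (joinEquiv k (c • p)) = y := fun c hc => by
    rw [map_smul, toSphere_smul hc (joinEquiv_ne_zero hp0), hp, toSphere_coe]
  rcases le_total ‖p.1‖ ‖p.2‖ with h | h
  · left
    have h0 : 0 < ‖p.2‖ := by
      by_contra h2
      have h3 : ‖p.2‖ = 0 := le_antisymm (not_lt.1 h2) (norm_nonneg _)
      have h4 : ‖p.1‖ = 0 := le_antisymm (h.trans h3.le) (norm_nonneg _)
      exact hp0 (Prod.ext (norm_eq_zero.1 h4) (norm_eq_zero.1 h3))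
    obtain ⟨t, ht⟩ := exists_circlePoint_eq (z := ‖p.2‖⁻¹ • p.2)
      (by rw [norm_smul, norm_inv, norm_norm, inv_mul_cancel₀ h0.ne'])
    refine ⟨(⟨‖p.2‖⁻¹ • p.1, ?_⟩, t), ?_⟩
    · rw [mem_closedBall_zero_iff, norm_smul, norm_inv, norm_norm, inv_mul_le_one₀ h0]
      exact h
    · rw [diskPage]
      simp only
      rw [ht]
      exact key _ (inv_pos.2 h0)
  · right
    have h0 : 0 < ‖p.1‖ := by
      by_contra h2
      have h3 : ‖p.1‖ = 0 := le_antisymm (not_lt.1 h2) (norm_nonneg _)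
      have h4 : ‖p.2‖ = 0 := le_antisymm (h.trans h3.le) (norm_nonneg _)
      exact hp0 (Prod.ext (norm_eq_zero.1 h3) (norm_eq_zero.1 h4))
    have h1 : ‖‖p.1‖⁻¹ • p.1‖ = 1 := by
      rw [norm_smul, norm_inv, norm_norm, inv_mul_cancel₀ h0.ne']
    refine ⟨(⟨⟨‖p.1‖⁻¹ • p.1, mem_closedBall_zero_iff.2 h1.le⟩, mem_bdry_disk.2 h1⟩,
      ⟨‖p.1‖⁻¹ • p.2, ?_⟩), ?_⟩
    · rw [mem_closedBall_zero_iff, norm_smul, norm_inv, norm_norm, inv_mul_le_one₀ h0]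
      exact h
    · exact key _ (inv_pos.2 h0)

theorem isSmoothEmbedding_diskBinding :
    IsSmoothEmbedding ((𝓡 k).prod (𝓡∂ 2)) (𝓡 (k + 2)) ∞ (diskBinding k) := by
  have hc : IsClosed (Bdry k (Disk (k + 1))) := (𝓡∂ (k + 1)).isClosed_boundary (n := ∞) (by simp)
  have := isCompact_iff_compactSpace.1 hc.isCompact
  have := isImmersion_diskBinding (k := k)
  exact ⟨this, (this.contMDiff.continuous.isClosedEmbedding diskBinding_injective).isEmbedding⟩

/-- The disk with the identity is an open book decomposition of the sphere. -/
theorem isOpenBookDecomposition_disk (k : ℕ) :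
    IsOpenBookDecomposition (k := k) (Disk (k + 1))
      (Diffeomorph.refl (𝓡∂ (k + 1)) (Disk (k + 1)) ∞) (UnitSphere (k + 2)) where
  compact_page := inferInstance
  eq_self_near_boundary := Eventually.of_forall fun _ => rfl
  exists_diffeomorph := by
    refine ⟨inferInstance, inferInstance, isSmoothEmbedding_coe_bdry_disk, diskPage k,
      diskBinding k, isImmersion_diskPage, fun x y s t => ?_, isSmoothEmbedding_diskBinding,
      range_diskPage_union, fun x t b z => diskPage_eq_diskBinding_iff⟩
    rw [diskPage_eq_iff]
    have h : ((Diffeomorph.refl (𝓡∂ (k + 1)) (Disk (k + 1)) ∞).toEquiv : Equiv.Perm _) = 1 := rfl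
    simp only [h, one_zpow, Equiv.Perm.coe_one, id_eq]

end DiskOpenBook

/-! ### Boundary defining functions -/

section BoundaryFunction

variable {k : ℕ} {V : Type*} [TopologicalSpace V] [ChartedSpace (EuclideanHalfSpace (k + 1)) V]
  [IsManifold (𝓡∂ (k + 1)) ∞ V]

omit [IsManifold (𝓡∂ (k + 1)) ∞ V] in
theorem extChartAt_apply_zero_nonneg (p x : V) : 0 ≤ extChartAt (𝓡∂ (k + 1)) p x 0 :=
  (chartAt (EuclideanHalfSpace (k + 1)) p x).2

/-- Any chart of the atlas around a point, not only the preferred one, decides whether the point is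
interior. -/
theorem extChartAt_apply_zero_eq_zero_iff {p x : V}
    (hx : x ∈ (chartAt (EuclideanHalfSpace (k + 1)) p).source) :
    extChartAt (𝓡∂ (k + 1)) p x 0 = 0 ↔ x ∈ Bdry k V := by
  have hp := chart_mem_atlas (EuclideanHalfSpace (k + 1)) p
  rw [show Bdry k V = ((𝓡∂ (k + 1)).interior V)ᶜ from ((𝓡∂ (k + 1)).compl_interior).symm,
    mem_compl_iff]
  have h1 : x ∈ (𝓡∂ (k + 1)).interior V ↔ _ :=
    (𝓡∂ (k + 1)).isInteriorPoint_iff_of_mem_atlas (n := ∞) (by simp) hp hx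
  rw [h1]
  have h2 : (chartAt (EuclideanHalfSpace (k + 1)) p).extend (𝓡∂ (k + 1)) x ∈ interior
      ((chartAt (EuclideanHalfSpace (k + 1)) p).extend (𝓡∂ (k + 1))).target ↔
      0 < extChartAt (𝓡∂ (k + 1)) p x 0 := by
    have h3 : 0 < extChartAt (𝓡∂ (k + 1)) p x 0 ↔
        extChartAt (𝓡∂ (k + 1)) p x ∈ interior (range (𝓡∂ (k + 1))) := by
      rw [interior_range_modelWithCornersEuclideanHalfSpace]; rfl
    rw [h3]
    exact ⟨fun h => OpenPartialHomeomorph.interior_extend_target_subset_interior_range _ h,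
      fun h => (chartAt (EuclideanHalfSpace (k + 1)) p).mem_interior_extend_target
        ((chartAt (EuclideanHalfSpace (k + 1)) p).map_source hx) h⟩
  rw [h2]
  exact ⟨fun h => by rw [h]; exact lt_irrefl _,
    fun h => le_antisymm (not_lt.1 h) (extChartAt_apply_zero_nonneg p x)⟩

/-- A function which vanishes at a boundary point `x` and is bounded below by a chart coordinate
transverse to the boundary has nonzero derivative at `x`. -/
theorem exists_mfderiv_ne_zero_of_extChartAt_le {f : V → ℝ} {p x : V}
    (hf : MDifferentiableAt (𝓡∂ (k + 1)) 𝓘(ℝ, ℝ) f x) (hx : x ∈ Bdry k V) (hfx : f x = 0)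
    (hpx : x ∈ (chartAt (EuclideanHalfSpace (k + 1)) p).source)
    (hle : ∀ᶠ y in 𝓝 x, extChartAt (𝓡∂ (k + 1)) p y 0 ≤ f y) :
    ∃ v, mfderiv (𝓡∂ (k + 1)) 𝓘(ℝ, ℝ) f x v ≠ 0 := by
  set φ := extChartAt (𝓡∂ (k + 1)) p with hφ
  have hxs : x ∈ φ.source := by rwa [hφ, extChartAt_source]
  have hxt : φ x ∈ φ.target := φ.map_source hxs
  have hx0 : φ x 0 = 0 := (extChartAt_apply_zero_eq_zero_iff hpx).2 hx
  have hsymm : MDifferentiableWithinAt 𝓘(ℝ, EuclideanSpace ℝ (Fin (k + 1))) (𝓡∂ (k + 1)) φ.symm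
      (range (𝓡∂ (k + 1))) (φ x) := mdifferentiableWithinAt_extChartAt_symm hxt
  have hinv : φ.symm (φ x) = x := φ.left_inv hxs
  have hf' : HasMFDerivAt (𝓡∂ (k + 1)) 𝓘(ℝ, ℝ) f (φ.symm (φ x))
      (mfderiv (𝓡∂ (k + 1)) 𝓘(ℝ, ℝ) f (φ.symm (φ x))) := by
    rw [hinv]; exact hf.hasMFDerivAt
  have hcomp := (hf'.comp_hasMFDerivWithinAt (φ x) hsymm.hasMFDerivWithinAt)
  have h1 := hcomp.hasFDerivWithinAt
  set L : EuclideanSpace ℝ (Fin (k + 1)) →L[ℝ] ℝ := (mfderiv (𝓡∂ (k + 1)) 𝓘(ℝ, ℝ) f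
    (φ.symm (φ x))).comp (mfderivWithin 𝓘(ℝ, EuclideanSpace ℝ (Fin (k + 1))) (𝓡∂ (k + 1)) φ.symm
      (range (𝓡∂ (k + 1))) (φ x)) with hL
  -- Along the inward path `s ↦ φ x + s e₀` the function is at least `s` and starts at `0`, so its
  -- one-sided derivative is at least `1`.
  have hpath : HasDerivWithinAt (fun s : ℝ => φ x + s • e₀ (k + 1)) (e₀ (k + 1)) (Ici 0) 0 := by
    simpa using ((hasDerivAt_id (0 : ℝ)).smul_const (e₀ (k + 1))).const_add (φ x) |>.hasDerivWithinAt
  have hp0 : φ x + (0 : ℝ) • e₀ (k + 1) = φ x := by simp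
  have hmaps : MapsTo (fun s : ℝ => φ x + s • e₀ (k + 1)) (Ici 0) (range (𝓡∂ (k + 1))) := by
    intro s hs
    rw [range_halfSpace]
    change 0 ≤ φ x 0 + s * (e₀ (k + 1)) 0
    rw [hx0]
    simpa [e₀] using hs
  have hder : HasDerivWithinAt (f ∘ φ.symm ∘ fun s : ℝ => φ x + s • e₀ (k + 1)) (L (e₀ (k + 1)))
      (Ici 0) 0 := by
    have h1' : HasFDerivWithinAt (f ∘ φ.symm) L (range (𝓡∂ (k + 1)))
      ((fun s : ℝ => φ x + s • e₀ (k + 1)) 0) := by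
      simp only [hp0]; exact h1
    exact h1'.comp_hasDerivWithinAt (0 : ℝ) hpath hmaps
  have htend : Tendsto (φ.symm ∘ fun s : ℝ => φ x + s • e₀ (k + 1)) (𝓝[Ici 0] 0) (𝓝 x) := by
    have h2 : ContinuousWithinAt φ.symm (range (𝓡∂ (k + 1))) (φ x) :=
      hsymm.continuousWithinAt
    rw [ContinuousWithinAt, hinv] at h2
    refine h2.comp (tendsto_nhdsWithin_iff.2 ⟨?_, ?_⟩)
    · have := hpath.continuousWithinAt.tendsto
      simpa only [hp0] using this
    · exact eventually_nhdsWithin_of_forall hmaps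
  have hin : ∀ᶠ s in 𝓝[Ici (0 : ℝ)] 0, φ x + s • e₀ (k + 1) ∈ φ.target := by
    have h3 : φ.target ∈ 𝓝[range (𝓡∂ (k + 1))] (φ x) := by
      have := extChartAt_target_mem_nhdsWithin' (I := 𝓡∂ (k + 1)) hxs
      exact this
    have h4 : Tendsto (fun s : ℝ => φ x + s • e₀ (k + 1)) (𝓝[Ici 0] 0)
        (𝓝[range (𝓡∂ (k + 1))] (φ x)) := by
      refine tendsto_nhdsWithin_iff.2 ⟨?_, eventually_nhdsWithin_of_forall hmaps⟩
      have := hpath.continuousWithinAt.tendsto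
      simpa only [hp0] using this
    exact h4 h3
  have hge : ∀ᶠ s in 𝓝[Ici (0 : ℝ)] 0, s ≤ (f ∘ φ.symm ∘ fun s : ℝ => φ x + s • e₀ (k + 1)) s := by
    filter_upwards [htend.eventually hle, hin] with s hs1 hs2
    refine le_trans (le_of_eq ?_) hs1
    simp only [Function.comp_apply]
    rw [φ.right_inv hs2]
    change s = φ x 0 + s * (e₀ (k + 1)) 0
    rw [hx0]
    simp [e₀]
  have hslope : Tendsto (slope (f ∘ φ.symm ∘ fun s : ℝ => φ x + s • e₀ (k + 1)) 0) (𝓝[>] 0)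
      (𝓝 (L (e₀ (k + 1)))) := by
    have := hasDerivWithinAt_iff_tendsto_slope.1 hder
    simpa using this
  have h1L : 1 ≤ L (e₀ (k + 1)) := by
    refine ge_of_tendsto hslope ?_
    have hge' : ∀ᶠ s in 𝓝[>] (0 : ℝ), s ≤ (f ∘ φ.symm ∘ fun s : ℝ => φ x + s • e₀ (k + 1)) s :=
      hge.filter_mono (nhdsWithin_mono _ Ioi_subset_Ici_self)
    filter_upwards [hge', self_mem_nhdsWithin] with s hs1 hs2
    rw [slope_def_field]
    have h0 : (f ∘ φ.symm ∘ fun s : ℝ => φ x + s • e₀ (k + 1)) 0 = 0 := by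
      simp only [Function.comp_apply, hp0, hinv, hfx]
    rw [h0, sub_zero, sub_zero, one_le_div hs2]
    exact hs1
  have h2L : L (e₀ (k + 1)) ≠ 0 := by linarith
  have key : ∃ v, mfderiv (𝓡∂ (k + 1)) 𝓘(ℝ, ℝ) f (φ.symm (φ x)) v ≠ 0 := ⟨_, h2L⟩
  rwa [hinv] at key

variable (k V) in
/-- A compact manifold has a boundary defining function. -/
theorem exists_boundaryDefiningFunction [CompactSpace V] [T2Space V] :
    ∃ f : V → ℝ, ContMDiff (𝓡∂ (k + 1)) 𝓘(ℝ, ℝ) ∞ f ∧ (∀ x, 0 ≤ f x) ∧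
      (∀ x, f x = 0 ↔ x ∈ Bdry k V) ∧
      ∀ x ∈ Bdry k V, ∃ v, mfderiv (𝓡∂ (k + 1)) 𝓘(ℝ, ℝ) f x v ≠ 0 := by
  have b : ∀ p : V, SmoothBumpFunction (𝓡∂ (k + 1)) p := fun p => Classical.arbitrary _
  -- The cover consists of the sets where a bump function is locally equal to `1`. Near each point
  -- one summand below is then an undamped chart coordinate, and as the others are nonnegative, the
  -- sum dominates it.
  obtain ⟨s, hs⟩ := CompactSpace.elim_nhds_subcover (fun p => {x | b p =ᶠ[𝓝 x] 1})
    fun p => eventually_eventually_nhds.2 (b p).eventuallyEq_one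
  have hterm : ∀ p x, 0 ≤ b p x • extChartAt (𝓡∂ (k + 1)) p x 0 := fun p x =>
    mul_nonneg (b p).nonneg (extChartAt_apply_zero_nonneg p x)
  have hsrc : ∀ p x, b p x ≠ 0 → x ∈ (chartAt (EuclideanHalfSpace (k + 1)) p).source := fun p x h =>
    (b p).support_subset_source h
  have hzero : ∀ x ∈ Bdry k V, ∀ p, b p x • extChartAt (𝓡∂ (k + 1)) p x 0 = 0 := by
    intro x hx p
    by_cases h : b p x = 0
    · rw [h, zero_smul]
    · rw [(extChartAt_apply_zero_eq_zero_iff (hsrc p x h)).2 hx, smul_zero]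
  have hsm : ContMDiff (𝓡∂ (k + 1)) 𝓘(ℝ, ℝ) ∞
      (fun x => ∑ p ∈ s, b p x • extChartAt (𝓡∂ (k + 1)) p x 0) := by
    refine contMDiff_finsetSum fun p _ => (b p).contMDiff_smul ?_
    have h1 := contMDiffOn_extChartAt (I := 𝓡∂ (k + 1)) (n := ∞) (x := p)
    exact ((EuclideanSpace.proj (0 : Fin (k + 1))).contDiff (𝕜 := ℝ)).contMDiff.comp_contMDiffOn h1
  have hz : ∀ x ∈ Bdry k V, ∑ p ∈ s, b p x • extChartAt (𝓡∂ (k + 1)) p x 0 = 0 := fun x hx =>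
    Finset.sum_eq_zero fun p _ => hzero x hx p
  refine ⟨_, hsm, fun x => Finset.sum_nonneg fun p _ => hterm p x, fun x => ⟨fun h => ?_, hz x⟩,
    fun x hx => ?_⟩
  · have hx : x ∈ ⋃ p ∈ s, {x | b p =ᶠ[𝓝 x] 1} := by rw [hs]; trivial
    simp only [mem_iUnion] at hx
    obtain ⟨p, hps, hp⟩ := hx
    have hp1 : b p x = 1 := Filter.EventuallyEq.eq_of_nhds hp
    have := (Finset.sum_eq_zero_iff_of_nonneg fun p _ => hterm p x).1 h p hps
    rw [hp1, one_smul] at this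
    exact (extChartAt_apply_zero_eq_zero_iff (hsrc p x (by rw [hp1]; exact one_ne_zero))).1 this
  · have hx' : x ∈ ⋃ p ∈ s, {x | b p =ᶠ[𝓝 x] 1} := by rw [hs]; trivial
    simp only [mem_iUnion] at hx'
    obtain ⟨p, hps, hp⟩ := hx'
    have hp1 : b p x = 1 := Filter.EventuallyEq.eq_of_nhds hp
    refine exists_mfderiv_ne_zero_of_extChartAt_le (p := p) (hsm.mdifferentiable (by simp) x) hx
      (hz x hx) (hsrc p x (by rw [hp1]; exact one_ne_zero)) ?_
    filter_upwards [(hp : ∀ᶠ y in 𝓝 x, b p y = (1 : V → ℝ) y)] with y hy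
    refine le_trans (le_of_eq ?_) (Finset.single_le_sum (fun q _ => hterm q y) hps)
    rw [hy, Pi.one_apply, one_smul]

end BoundaryFunction

/-! ### Local left inverses of immersions and extension of functions -/

section LocalInverse

variable {E H M E' H' N : Type*} [NormedAddCommGroup E] [NormedSpace ℝ E] [TopologicalSpace H]
  {I : ModelWithCorners ℝ E H} [TopologicalSpace M] [ChartedSpace H M]
  [NormedAddCommGroup E'] [NormedSpace ℝ E'] [TopologicalSpace H']
  {I' : ModelWithCorners ℝ E' H'} [TopologicalSpace N] [ChartedSpace H' N]

/-- Charts in the maximal atlas map interior points to interior points. -/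
theorem extend_mem_interior_range [FiniteDimensional ℝ E] [IsManifold I ∞ M]
    {φ : OpenPartialHomeomorph M H} (hφ : φ ∈ IsManifold.maximalAtlas I ∞ M) {x : M}
    (hx : x ∈ φ.source) (hxi : x ∈ I.interior M) : φ.extend I x ∈ interior (range I) := by
  have h1 : IsLocalDiffeomorphAt I I ∞ φ x :=
    ⟨⟨φ.toPartialEquiv, φ.open_source, φ.open_target, contMDiffOn_of_mem_maximalAtlas hφ,
      contMDiffOn_symm_of_mem_maximalAtlas hφ⟩, hx, fun _ _ => rfl⟩
  have h2 := (h1.isInteriorPoint_iff (by simp)).1 hxi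
  rw [ModelWithCorners.isInteriorPoint_iff] at h2
  have h3 := OpenPartialHomeomorph.interior_extend_target_subset_interior_range _ h2
  simpa only [mfld_simps, chartAt_self_eq] using h3

/-- The map which in the charts of the normal form of an immersion is the projection to the first
factor. -/
def immersionProj {f : M → N} {x : M} (hf : IsImmersionAt I I' ∞ f x) (y : N) : M :=
  (hf.domChart.extend I).symm (hf.equiv.symm (hf.codChart.extend I' y)).1

theorem immersionProj_apply {f : M → N} {x : M} (hf : IsImmersionAt I I' ∞ f x) {z : M}
    (hz : z ∈ hf.domChart.source) : immersionProj hf (f z) = z := by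
  have h1 : hf.domChart.extend I z ∈ (hf.domChart.extend I).target :=
    (hf.domChart.extend I).map_source (by rwa [OpenPartialHomeomorph.extend_source])
  have h2 := hf.writtenInCharts h1
  simp only [Function.comp_apply] at h2
  rw [hf.domChart.extend_left_inv hz] at h2
  rw [immersionProj, h2, hf.equiv.symm_apply_apply, hf.domChart.extend_left_inv hz]

/-- At an interior point the domain chart has a target that is a neighbourhood in the full model
vector space, so dropping the complementary coordinates of a point near `f x` still gives a
coordinate of a point of `M`. -/
theorem exists_contMDiffOn_immersionProj [FiniteDimensional ℝ E] [IsManifold I ∞ M]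
    [IsManifold I' ∞ N] {f : M → N} {x : M} (hf : IsImmersionAt I I' ∞ f x)
    (hx : x ∈ I.interior M) : ∃ U : Set N, IsOpen U ∧ f x ∈ U ∧ U ⊆ hf.codChart.source ∧
      ContMDiffOn I' I ∞ (immersionProj hf) U ∧
      ∀ y ∈ U, (hf.equiv.symm (hf.codChart.extend I' y)).1 ∈ (hf.domChart.extend I).target := by
  have hd := hf.domChart_mem_maximalAtlas
  have hc := hf.codChart_mem_maximalAtlas
  have hA : ContMDiffOn I' 𝓘(ℝ, E) ∞
      (fun y => (hf.equiv.symm (hf.codChart.extend I' y)).1) hf.codChart.source :=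
    (contDiff_fst.comp hf.equiv.symm.contDiff).contMDiff.comp_contMDiffOn
      (hf.codChart.contMDiffOn_extend hc)
  have hU := hA.continuousOn.isOpen_inter_preimage hf.codChart.open_source
    (isOpen_interior (s := (hf.domChart.extend I).target))
  refine ⟨_, hU, ⟨hf.mem_codChart_source, ?_⟩, inter_subset_left, ?_, fun y hy =>
    interior_subset hy.2⟩
  · have h1 : hf.domChart.extend I x ∈ (hf.domChart.extend I).target :=
      (hf.domChart.extend I).map_source
        (by rw [OpenPartialHomeomorph.extend_source]; exact hf.mem_domChart_source)
    have h2 := hf.writtenInCharts h1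
    simp only [Function.comp_apply] at h2
    rw [hf.domChart.extend_left_inv hf.mem_domChart_source] at h2
    rw [mem_preimage, h2, hf.equiv.symm_apply_apply]
    exact hf.domChart.mem_interior_extend_target (hf.domChart.map_source hf.mem_domChart_source)
      (extend_mem_interior_range hd hf.mem_domChart_source hx)
  · refine (contMDiffOn_extend_symm hd).comp (hA.mono inter_subset_left) ?_
    intro y hy
    have h3 := interior_subset hy.2
    rw [OpenPartialHomeomorph.extend_target'] at h3
    exact h3

/-- An injective equidimensional immersion has a smooth inverse near the image of an interior
point. -/
theorem exists_contMDiffOn_invFun [FiniteDimensional ℝ E] [FiniteDimensional ℝ E']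
    [IsManifold I ∞ M] [IsManifold I' ∞ N] [Nonempty M]
    (hdim : Module.finrank ℝ E = Module.finrank ℝ E') {f : M → N} (hinj : Function.Injective f)
    {x : M} (hf : IsImmersionAt I I' ∞ f x) (hx : x ∈ I.interior M) :
    ∃ U : Set N, IsOpen U ∧ f x ∈ U ∧ ContMDiffOn I' I ∞ (Function.invFun f) U ∧
      ∀ y ∈ U, f (Function.invFun f y) = y := by
  obtain ⟨U, hU, hxU, hUs, hs, hUt⟩ := exists_contMDiffOn_immersionProj hf hx
  have hfin : FiniteDimensional ℝ hf.complement :=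
    FiniteDimensional.of_injective
      (hf.equiv.toLinearEquiv.toLinearMap ∘ₗ LinearMap.inr ℝ E hf.complement)
      (hf.equiv.injective.comp LinearMap.inr_injective)
  -- Equal dimensions leave no complement, so the local projection is also a right inverse of `f`;
  -- injectivity then identifies it with `Function.invFun f`.
  have h0 : Module.finrank ℝ hf.complement = 0 := by
    have := hf.equiv.toLinearEquiv.finrank_eq
    rw [Module.finrank_prod] at this
    omega
  have hsub : Subsingleton hf.complement := Module.finrank_zero_iff.1 h0
  have key : ∀ y ∈ U, f (immersionProj hf y) = y := by
    intro y hy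
    have h1 := hUt y hy
    have h2 := hf.writtenInCharts h1
    simp only [Function.comp_apply] at h2
    have h3 : ((hf.equiv.symm (hf.codChart.extend I' y)).1, (0 : hf.complement)) =
      hf.equiv.symm (hf.codChart.extend I' y) := Prod.ext rfl (Subsingleton.elim _ _)
    rw [h3, hf.equiv.apply_symm_apply] at h2
    have h4 : immersionProj hf y ∈ hf.domChart.source := by
      have := (hf.domChart.extend I).map_target h1
      rwa [OpenPartialHomeomorph.extend_source] at this
    refine (hf.codChart.extend I').injOn ?_ ?_ h2
    · rw [OpenPartialHomeomorph.extend_source]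
      exact hf.source_subset_preimage_source h4
    · rw [OpenPartialHomeomorph.extend_source]
      exact hUs hy
  have heq : ∀ y ∈ U, Function.invFun f y = immersionProj hf y := by
    intro y hy
    have := Function.leftInverse_invFun hinj (immersionProj hf y)
    rwa [key y hy] at this
  exact ⟨U, hU, hxU, hs.congr heq, fun y hy => by rw [heq y hy, key y hy]⟩

/-- Smooth functions extend from closed submanifolds. -/
theorem exists_contMDiff_extension [FiniteDimensional ℝ E] [FiniteDimensional ℝ E']
    [IsManifold I ∞ M] [BoundarylessManifold I M] [CompactSpace M]
    [IsManifold I' ∞ N] [T2Space N] [SigmaCompactSpace N]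
    {F : Type*} [NormedAddCommGroup F] [NormedSpace ℝ F] {ι : M → N}
    (hι : IsSmoothEmbedding I I' ∞ ι) {g : M → F} (hg : ContMDiff I 𝓘(ℝ, F) ∞ g) :
    ∃ G : N → F, ContMDiff I' 𝓘(ℝ, F) ∞ G ∧ ∀ b, G (ι b) = g b := by
  have ht : ∀ x : N, Convex ℝ {z : F | ∀ b, ι b = x → z = g b} := by
    intro x z hz w hw a c ha hc hac b hb
    rw [hz b hb, hw b hb, ← add_smul, hac, one_smul]
  -- Over a point of the submanifold the prescribed set is a single value, elsewhere it is all of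
  -- `F`. Both are convex, so a partition of unity glues the local extensions.
  suffices Hloc : ∀ x : N, ∃ U ∈ 𝓝 x, ∃ G : N → F, ContMDiffOn I' 𝓘(ℝ, F) ∞ G U ∧
      ∀ y ∈ U, G y ∈ {z : F | ∀ b, ι b = y → z = g b} by
    obtain ⟨G, hG⟩ := exists_contMDiffMap_forall_mem_convex_of_local (n := (⊤ : ℕ∞)) I' ht Hloc
    exact ⟨G, G.contMDiff, fun b => hG (ι b) b rfl⟩
  intro x
  by_cases hx : x ∈ range ι
  · obtain ⟨b, rfl⟩ := hx
    have him := hι.isImmersion.isImmersionAt b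
    obtain ⟨U, hU, hbU, -, hs, -⟩ := exists_contMDiffOn_immersionProj him
      BoundarylessManifold.isInteriorPoint
    -- Here the embedding is used: on `U'` no other sheet of the submanifold comes near, so every
    -- point of its image there is parametrized by the domain chart.
    obtain ⟨U', hU', hU'e⟩ := hι.isEmbedding.isOpen_iff.1 him.domChart.open_source
    refine ⟨U ∩ U', (hU.inter hU').mem_nhds ⟨hbU, ?_⟩, g ∘ immersionProj him,
      hg.comp_contMDiffOn (hs.mono inter_subset_left), ?_⟩
    · change b ∈ ι ⁻¹' U'
      rw [hU'e]; exact him.mem_domChart_source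
    · rintro y ⟨-, hy⟩ c rfl
      have : c ∈ ι ⁻¹' U' := hy
      rw [hU'e] at this
      rw [Function.comp_apply, immersionProj_apply him this]
  · refine ⟨(range ι)ᶜ, (isCompact_range hι.isEmbedding.continuous).isClosed.isOpen_compl.mem_nhds
      hx, fun _ => 0, contMDiffOn_const, ?_⟩
    rintro y hy b rfl
    exact absurd ⟨b, rfl⟩ hy

end LocalInverse

/-- Given a linear map `A` of corank one with left inverse `R`, and a nonzero functional `ℓ` which
vanishes on the range of `A`, the kernels of `R` and `ℓ` are complementary. -/
theorem eq_zero_of_leftInverse_of_functional {E E' : Type*} [AddCommGroup E] [Module ℝ E]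
    [AddCommGroup E'] [Module ℝ E'] [FiniteDimensional ℝ E] [FiniteDimensional ℝ E']
    (hdim : Module.finrank ℝ E' = Module.finrank ℝ E + 1) {A : E →ₗ[ℝ] E'} {R : E' →ₗ[ℝ] E}
    {ℓ : E' →ₗ[ℝ] ℝ} (hRA : ∀ u, R (A u) = u) (hℓA : ∀ u, ℓ (A u) = 0) {w : E'} (hw : ℓ w ≠ 0)
    {v : E'} (hRv : R v = 0) (hℓv : ℓ v = 0) : v = 0 := by
  have hsurj : LinearMap.range R = ⊤ := LinearMap.range_eq_top.2 fun u => ⟨A u, hRA u⟩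
  have h1 := R.finrank_range_add_finrank_ker
  rw [hsurj, finrank_top, hdim] at h1
  -- The kernel of `R` is a line. It is spanned by `w - A (R w)`, on which `ℓ` takes the value `ℓ w
  -- ≠ 0`.
  have hker : Module.finrank ℝ (LinearMap.ker R) = 1 := by omega
  have hw' : R (w - A (R w)) = 0 := by rw [map_sub, hRA, sub_self]
  have hℓ : ℓ (w - A (R w)) = ℓ w := by rw [map_sub, hℓA, sub_zero]
  have hne : (⟨w - A (R w), hw'⟩ : LinearMap.ker R) ≠ 0 := by
    intro h
    have h2 : w - A (R w) = 0 := congrArg Subtype.val h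
    rw [h2, map_zero] at hℓ
    exact hw hℓ.symm
  obtain ⟨c, hc⟩ := (finrank_eq_one_iff_of_nonzero' _ hne).1 hker ⟨v, hRv⟩
  have hc' : c • (w - A (R w)) = v := congrArg Subtype.val hc
  rw [← hc', map_smul, hℓ, smul_eq_mul, mul_eq_zero, or_iff_left hw] at hℓv
  rw [← hc', hℓv, zero_smul]

/-! ### Charts adapted to the height and the retraction -/

section Collar

variable {k : ℕ} {V : Type*} [TopologicalSpace V] [ChartedSpace (EuclideanHalfSpace (k + 1)) V]
  [IsManifold (𝓡∂ (k + 1)) ∞ V]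
  {N : Type*} [TopologicalSpace N] [ChartedSpace (EuclideanSpace ℝ (Fin k)) N]
  [IsManifold (𝓡 k) ∞ N] {ι : N → V} {f : V → ℝ} {r : V → N} {U : Set V}

-- Differentiating `r ∘ ι = id` and `f ∘ ι = 0` puts `dι`, `dr` and `df` in the situation of
-- `eq_zero_of_leftInverse_of_functional`.
omit [IsManifold (𝓡∂ (k + 1)) ∞ V] [IsManifold (𝓡 k) ∞ N] in
theorem eq_zero_of_mfderiv_retraction {b : N} (hf : MDifferentiableAt (𝓡∂ (k + 1)) 𝓘(ℝ, ℝ) f (ι b))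
    (hr : MDifferentiableAt (𝓡∂ (k + 1)) (𝓡 k) r (ι b))
    (hι : MDifferentiableAt (𝓡 k) (𝓡∂ (k + 1)) ι b) (hfι : ∀ b, f (ι b) = 0)
    (hrι : ∀ b, r (ι b) = b) (hfd : ∃ v, mfderiv (𝓡∂ (k + 1)) 𝓘(ℝ, ℝ) f (ι b) v ≠ 0)
    {v : TangentSpace (𝓡∂ (k + 1)) (ι b)} (h1 : mfderiv (𝓡∂ (k + 1)) 𝓘(ℝ, ℝ) f (ι b) v = 0)
    (h2 : mfderiv (𝓡∂ (k + 1)) (𝓡 k) r (ι b) v = 0) : v = 0 := by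
  obtain ⟨w, hw⟩ := hfd
  set A : EuclideanSpace ℝ (Fin k) →L[ℝ] EuclideanSpace ℝ (Fin (k + 1)) :=
    mfderiv (𝓡 k) (𝓡∂ (k + 1)) ι b with hA
  set R : EuclideanSpace ℝ (Fin (k + 1)) →L[ℝ] EuclideanSpace ℝ (Fin k) :=
    mfderiv (𝓡∂ (k + 1)) (𝓡 k) r (ι b) with hR
  set ℓ : EuclideanSpace ℝ (Fin (k + 1)) →L[ℝ] ℝ := mfderiv (𝓡∂ (k + 1)) 𝓘(ℝ, ℝ) f (ι b) with hℓ
  have hRA : R.comp A = ContinuousLinearMap.id ℝ _ := by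
    have e1 := mfderiv_comp b hr hι
    have e2 : r ∘ ι = id := funext hrι
    rw [e2, mfderiv_id] at e1
    exact e1.symm
  have hℓA : ℓ.comp A = 0 := by
    have e1 := mfderiv_comp b hf hι
    have e2 : f ∘ ι = fun _ => 0 := funext hfι
    rw [e2, mfderiv_const] at e1
    exact e1.symm
  exact eq_zero_of_leftInverse_of_functional (by simp) (A := A.toLinearMap) (R := R.toLinearMap)
    (ℓ := ℓ.toLinearMap) (fun u => congrArg (fun L => L u) hRA) (fun u => congrArg (fun L => L u) hℓA)
    hw h2 h1

/-- Charts of a manifold near the boundary whose first coordinate is a given boundary defining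
function, and whose other coordinates are those of a given retraction to the boundary. -/
theorem exists_collarChart (hf : ContMDiff (𝓡∂ (k + 1)) 𝓘(ℝ, ℝ) ∞ f) (hf0 : ∀ x, 0 ≤ f x)
    (hfb : ∀ x, f x = 0 ↔ x ∈ Bdry k V)
    (hfd : ∀ x ∈ Bdry k V, ∃ v, mfderiv (𝓡∂ (k + 1)) 𝓘(ℝ, ℝ) f x v ≠ 0)
    (hU : IsOpen U) (hr : ContMDiffOn (𝓡∂ (k + 1)) (𝓡 k) ∞ r U)
    (hι : ContMDiff (𝓡 k) (𝓡∂ (k + 1)) ∞ ι) (hιb : ∀ b, ι b ∈ Bdry k V) (hιU : ∀ b, ι b ∈ U)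
    (hrι : ∀ b, r (ι b) = b) (b : N) :
    ∃ κ ∈ IsManifold.maximalAtlas (𝓡∂ (k + 1)) ∞ V, ι b ∈ κ.source ∧ κ.source ⊆ U ∧
      ∀ x ∈ κ.source, r x ∈ (chartAt (EuclideanSpace ℝ (Fin k)) b).source ∧
        κ.extend (𝓡∂ (k + 1)) x = consEquiv k (f x, extChartAt (𝓡 k) b (r x)) := by
  set I := 𝓡∂ (k + 1) with hI
  set φ := chartAt (EuclideanHalfSpace (k + 1)) (ι b) with hφ
  have hφm : φ ∈ IsManifold.maximalAtlas I ∞ V := IsManifold.chart_mem_maximalAtlas _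
  have hp : ι b ∈ φ.source := mem_chart_source _ _
  set χ := chartAt (EuclideanSpace ℝ (Fin k)) b with hχ
  have hχm : χ ∈ IsManifold.maximalAtlas (𝓡 k) ∞ N := IsManifold.chart_mem_maximalAtlas _
  set ψ : V → EuclideanSpace ℝ (Fin (k + 1)) := fun x =>
    consEquiv k (f x, extChartAt (𝓡 k) b (r x)) with hψ
  set O : Set V := U ∩ r ⁻¹' χ.source with hO
  have hOo : IsOpen O := hr.continuousOn.isOpen_inter_preimage hU χ.open_source
  have hbO : ι b ∈ O := ⟨hιU b, by rw [mem_preimage, hrι]; exact mem_chart_source _ _⟩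
  have hψO : ContMDiffOn I 𝓘(ℝ, EuclideanSpace ℝ (Fin (k + 1))) ∞ ψ O := by
    have h1 : ContMDiffOn I 𝓘(ℝ, EuclideanSpace ℝ (Fin k)) ∞
        (fun x => extChartAt (𝓡 k) b (r x)) O :=
      (χ.contMDiffOn_extend hχm).comp (hr.mono inter_subset_left) fun x hx => hx.2
    exact (consEquiv k).contDiff.contMDiff.comp_contMDiffOn
      (hf.contMDiffOn.prodMk_space h1)
  have hψd : MDifferentiableAt I 𝓘(ℝ, EuclideanSpace ℝ (Fin (k + 1))) ψ (ι b) :=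
    (hψO.contMDiffAt (hOo.mem_nhds hbO)).mdifferentiableAt (by simp)
  have hrd : MDifferentiableAt I (𝓡 k) r (ι b) :=
    (hr.contMDiffAt (hU.mem_nhds (hιU b))).mdifferentiableAt (by simp)
  have hker : ∀ v, mfderiv I 𝓘(ℝ, EuclideanSpace ℝ (Fin (k + 1))) ψ (ι b) v = 0 → v = 0 := by
    intro v hv
    have hfι : ∀ b, f (ι b) = 0 := fun b => (hfb _).2 (hιb b)
    refine eq_zero_of_mfderiv_retraction (hf.mdifferentiable (by simp) _) hrd
      (hι.mdifferentiable (by simp) _) hfι hrι (hfd _ (hιb b)) ?_ ?_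
    · refine mfderiv_apply_eq_zero_of_comp hψd (h := fun u => ((consEquiv k).symm u).1) ?_ ?_ hv
      · exact ((consEquiv k).symm.differentiable.fst _).mdifferentiableAt
      · exact Eventually.of_forall fun y => by simp [hψ]
    · have h1 : mfderiv I 𝓘(ℝ, EuclideanSpace ℝ (Fin k)) (χ.extend (𝓡 k) ∘ r) (ι b) v = 0 := by
        refine mfderiv_apply_eq_zero_of_comp hψd (h := fun u => ((consEquiv k).symm u).2) ?_ ?_ hv
        · exact ((consEquiv k).symm.differentiable.snd _).mdifferentiableAt
        · exact Eventually.of_forall fun y => by simp [hψ, extChartAt, hχ]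
      have hrb : r (ι b) ∈ χ.source := hbO.2
      rw [mfderiv_comp _ ((χ.contMDiffAt_extend hχm hrb).mdifferentiableAt (by simp)) hrd] at h1
      exact eq_zero_of_mfderiv_chart hχm hrb h1
  have hT : IsOpen (φ.target ∩ φ.symm ⁻¹' O) := φ.isOpen_inter_preimage_symm hOo
  obtain ⟨S, hS, hST⟩ := isOpen_induced_iff.1 hT
  have hsymm : ∀ u (hu : 0 ≤ u 0), (φ.extend I).symm u = φ.symm ⟨u, hu⟩ := fun u hu => by
    change φ.symm (I.symm (I ⟨u, hu⟩)) = _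
    rw [I.left_inv]
  have hSmem : ∀ u (hu : 0 ≤ u 0), u ∈ S → (⟨u, hu⟩ : EuclideanHalfSpace (k + 1)) ∈ φ.target ∧
      (φ.extend I).symm u ∈ O := fun u hu huS => by
    have : (⟨u, hu⟩ : EuclideanHalfSpace (k + 1)) ∈ Subtype.val ⁻¹' S := huS
    rw [hST] at this
    rw [hsymm u hu]
    exact this
  have hF : ContDiffOn ℝ ∞ (ψ ∘ (φ.extend I).symm) (S ∩ {u | 0 ≤ u 0}) := by
    refine (hψO.comp ((contMDiffOn_extend_symm hφm).mono ?_) ?_).contDiffOn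
    · rintro u ⟨huS, hu⟩
      exact ⟨_, (hSmem u hu huS).1, rfl⟩
    · rintro u ⟨huS, hu⟩
      exact (hSmem u hu huS).2
  -- Both `f` and the first chart coordinate vanish exactly on the boundary. The inverse function
  -- theorem for half-spaces needs this to keep the two sides apart.
  have hcoord : ∀ u (hu : 0 ≤ u 0), u ∈ S →
      ((ψ ∘ (φ.extend I).symm) u 0 = 0 ↔ u 0 = 0) := by
    intro u hu huS
    have h1 := (hSmem u hu huS).1
    have h2 : φ.symm ⟨u, hu⟩ ∈ φ.source := φ.map_target h1
    have h3 : extChartAt I (ι b) (φ.symm ⟨u, hu⟩) = u := by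
      change (φ (φ.symm ⟨u, hu⟩)).1 = u
      rw [φ.right_inv h1]
    rw [Function.comp_apply, hsymm u hu, hψ]
    simp only [consEquiv_apply_zero]
    rw [hfb, ← extChartAt_apply_zero_eq_zero_iff h2, h3]
  have hpφ : (φ.extend I).symm (φ (ι b)).1 = ι b := (φ.extend_left_inv hp)
  have hpS : (φ (ι b)).1 ∈ S := by
    have : φ (ι b) ∈ φ.target ∩ φ.symm ⁻¹' O :=
      ⟨φ.map_source hp, by rw [mem_preimage, φ.left_inv hp]; exact hbO⟩
    rw [← hST] at this
    exact this
  have hinv : (fderivWithin ℝ (ψ ∘ (φ.extend I).symm) (S ∩ {u | 0 ≤ u 0})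
      (φ (ι b)).1).IsInvertible := by
    have ht : (φ (ι b)).1 ∈ (extChartAt I (ι b)).target := mem_extChartAt_target _
    have hs := (mdifferentiableWithinAt_extChartAt_symm ht).hasMFDerivWithinAt
    have hψ' : HasMFDerivAt I 𝓘(ℝ, EuclideanSpace ℝ (Fin (k + 1))) ψ
        ((extChartAt I (ι b)).symm (φ (ι b)).1)
        (mfderiv I 𝓘(ℝ, EuclideanSpace ℝ (Fin (k + 1))) ψ (ι b)) := by
      have h : (extChartAt I (ι b)).symm (φ (ι b)).1 = ι b := hpφ
      rw [h]
      exact hψd.hasMFDerivAt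
    set L : EuclideanSpace ℝ (Fin (k + 1)) →L[ℝ] EuclideanSpace ℝ (Fin (k + 1)) :=
      (mfderiv I 𝓘(ℝ, EuclideanSpace ℝ (Fin (k + 1))) ψ (ι b)).comp
        (mfderivWithin 𝓘(ℝ, EuclideanSpace ℝ (Fin (k + 1))) I (extChartAt I (ι b)).symm (range I)
          (φ (ι b)).1) with hL
    have h1 : HasFDerivWithinAt (ψ ∘ (φ.extend I).symm) L (range I) (φ (ι b)).1 :=
      (hψ'.comp_hasMFDerivWithinAt _ hs).hasFDerivWithinAt
    have hmono : S ∩ {u | 0 ≤ u 0} ⊆ range I := by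
      rw [hI, range_halfSpace]; exact inter_subset_right
    have hu : UniqueDiffWithinAt ℝ (S ∩ {u | 0 ≤ u 0}) (φ (ι b)).1 := by
      have := I.uniqueDiffOn.inter hS
      rw [hI, range_halfSpace, inter_comm] at this
      exact this _ ⟨hpS, (φ (ι b)).2⟩
    have h2 : fderivWithin ℝ (ψ ∘ (φ.extend I).symm) (S ∩ {u | 0 ≤ u 0}) (φ (ι b)).1 = L :=
      (h1.mono hmono).fderivWithin hu
    rw [h2]
    have hi := isInvertible_mfderivWithin_extChartAt_symm ht
    obtain ⟨A, hA⟩ := exists_equiv_of_injective (E₁ := EuclideanSpace ℝ (Fin (k + 1)))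
      (E₂ := EuclideanSpace ℝ (Fin (k + 1))) rfl
      (L := mfderiv I 𝓘(ℝ, EuclideanSpace ℝ (Fin (k + 1))) ψ (ι b)) hker
    have hA' : ContinuousLinearMap.IsInvertible
        (mfderiv I 𝓘(ℝ, EuclideanSpace ℝ (Fin (k + 1))) ψ (ι b)) := ⟨A, hA⟩
    exact hA'.comp hi
  have hp0 : (φ (ι b)).1 0 = 0 := (extChartAt_apply_zero_eq_zero_iff hp).2 (hιb b)
  obtain ⟨e, hpe, he, hem⟩ := exists_openPartialHomeomorph_halfSpace hS hF
    (fun u _ _ => by simp only [Function.comp_apply, hψ, consEquiv_apply_zero]; exact hf0 _)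
    (fun u huS hu => hcoord u hu huS) hpS hp0 hinv
  have hsrc : ∀ x ∈ (φ ≫ₕ e).source, x ∈ O := by
    intro x hx
    rw [OpenPartialHomeomorph.trans_source] at hx
    have h1 := (hSmem _ (φ x).2 (he _ hx.2).1).2
    have h2 : (φ.extend I).symm (φ x).1 = x := φ.extend_left_inv hx.1
    rwa [h2] at h1
  refine ⟨φ ≫ₕ e, trans_mem_maximalAtlas hφm hem, ?_, fun x hx => (hsrc x hx).1, fun x hx =>
    ⟨(hsrc x hx).2, ?_⟩⟩
  · rw [OpenPartialHomeomorph.trans_source]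
    exact ⟨hp, hpe⟩
  · rw [OpenPartialHomeomorph.trans_source] at hx
    have h1 := (he _ hx.2).2
    have h2 : (φ.extend I).symm (φ x).1 = x := φ.extend_left_inv hx.1
    rw [Function.comp_apply, h2] at h1
    exact h1

end Collar

/-! ### Existence of collars -/

section CollarExistence

variable {k : ℕ} {V : Type*} [TopologicalSpace V] [ChartedSpace (EuclideanHalfSpace (k + 1)) V]
  {N : Type*} [TopologicalSpace N] [ChartedSpace (EuclideanSpace ℝ (Fin k)) N]
  {ι : N → V} {f : V → ℝ} {r : V → N} {U O : Set V}

/-- Boundary defining functions. -/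
structure IsBoundaryDefining (f : V → ℝ) : Prop where
  contMDiff : ContMDiff (𝓡∂ (k + 1)) 𝓘(ℝ, ℝ) ∞ f
  nonneg : ∀ x, 0 ≤ f x
  eq_zero_iff : ∀ x, f x = 0 ↔ x ∈ Bdry k V
  exists_mfderiv_ne_zero : ∀ x ∈ Bdry k V, ∃ v, mfderiv (𝓡∂ (k + 1)) 𝓘(ℝ, ℝ) f x v ≠ 0

theorem IsBoundaryDefining.const_mul (hf : IsBoundaryDefining (k := k) f) {a : ℝ} (ha : 0 < a) :
    IsBoundaryDefining (k := k) fun x => a * f x where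
  contMDiff := contMDiff_const.mul hf.contMDiff
  nonneg x := mul_nonneg ha.le (hf.nonneg x)
  eq_zero_iff x := by rw [mul_eq_zero, or_iff_right ha.ne', hf.eq_zero_iff]
  exists_mfderiv_ne_zero x hx := by
    obtain ⟨v, hv⟩ := hf.exists_mfderiv_ne_zero x hx
    refine ⟨v, fun h => hv ?_⟩
    refine mfderiv_apply_eq_zero_of_comp (f := fun x => a * f x) (h := fun t => a⁻¹ * t)
      ((contMDiff_const.mul hf.contMDiff).mdifferentiable (n := ∞) (by simp) x)
      ((differentiableAt_id.const_mul _).mdifferentiableAt)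
      (Eventually.of_forall fun y => ?_) h
    rw [← mul_assoc, inv_mul_cancel₀ ha.ne', one_mul]

/-- The boundary `ι : N → V` of `V` has a collar of width `4`, with coordinates `r` and `f` and
parametrization `c`. -/
structure IsCollar (ι : N → V) (f : V → ℝ) (r : V → N) (c : N × ℝ → V) : Prop
    extends IsBoundaryDefining (k := k) f where
  contMDiffOn_proj : ContMDiffOn (𝓡∂ (k + 1)) (𝓡 k) ∞ r {x | f x < 4}
  contMDiffOn_param : ContMDiffOn ((𝓡 k).prod 𝓘(ℝ, ℝ)) (𝓡∂ (k + 1)) ∞ c {q | 0 ≤ q.2 ∧ q.2 < 4}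
  height_param : ∀ b s, 0 ≤ s → s < 4 → f (c (b, s)) = s
  proj_param : ∀ b s, 0 ≤ s → s < 4 → r (c (b, s)) = b
  param_proj : ∀ x, f x < 4 → c (r x, f x) = x
  mem_boundary : ∀ b, ι b ∈ Bdry k V
  proj_incl : ∀ b, r (ι b) = b
  exists_chart : ∀ b, ∃ κ ∈ IsManifold.maximalAtlas (𝓡∂ (k + 1)) ∞ V, ι b ∈ κ.source ∧
    ∀ x ∈ κ.source, f x < 4 ∧ r x ∈ (chartAt (EuclideanSpace ℝ (Fin k)) b).source ∧
      κ.extend (𝓡∂ (k + 1)) x = consEquiv k (f x, extChartAt (𝓡 k) b (r x))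

variable [IsManifold (𝓡∂ (k + 1)) ∞ V] [IsManifold (𝓡 k) ∞ N]

-- This provides the local surjectivity of `(r, f)`, and the local formula for its inverse from
-- which smoothness is read off.
omit [ChartedSpace (EuclideanHalfSpace (k + 1)) V] [IsManifold (𝓡∂ (k + 1)) ∞ V]
  [IsManifold (𝓡 k) ∞ N] in
theorem eq_of_collarChart {κ : OpenPartialHomeomorph V (EuclideanHalfSpace (k + 1))} {b b' : N}
    (hκ : ∀ x ∈ κ.source, r x ∈ (chartAt (EuclideanSpace ℝ (Fin k)) b).source ∧
        κ.extend (𝓡∂ (k + 1)) x = consEquiv k (f x, extChartAt (𝓡 k) b (r x)))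
    (hb' : b' ∈ (chartAt (EuclideanSpace ℝ (Fin k)) b).source) {s : ℝ}
    (hs : consEquiv k (s, extChartAt (𝓡 k) b b') ∈ (κ.extend (𝓡∂ (k + 1))).target) :
    (κ.extend (𝓡∂ (k + 1))).symm (consEquiv k (s, extChartAt (𝓡 k) b b')) ∈ κ.source ∧
    f ((κ.extend (𝓡∂ (k + 1))).symm (consEquiv k (s, extChartAt (𝓡 k) b b'))) = s ∧
    r ((κ.extend (𝓡∂ (k + 1))).symm (consEquiv k (s, extChartAt (𝓡 k) b b'))) = b' := by
  set x := (κ.extend (𝓡∂ (k + 1))).symm (consEquiv k (s, extChartAt (𝓡 k) b b')) with hx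
  have hxs : x ∈ κ.source := by
    have := (κ.extend (𝓡∂ (k + 1))).map_target hs
    rwa [OpenPartialHomeomorph.extend_source] at this
  obtain ⟨h1, h2⟩ := hκ x hxs
  have h3 : κ.extend (𝓡∂ (k + 1)) x = consEquiv k (s, extChartAt (𝓡 k) b b') :=
    (κ.extend (𝓡∂ (k + 1))).right_inv hs
  rw [h3] at h2
  have h4 := (consEquiv k).injective h2
  simp only [Prod.mk.injEq] at h4
  refine ⟨hxs, h4.1.symm, (extChartAt (𝓡 k) b).injOn ?_ ?_ h4.2.symm⟩
  · rwa [extChartAt_source]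
  · rwa [extChartAt_source]

/-- The map `(r, f)` is injective on the compact boundary and locally injective there, hence
injective on a neighbourhood `W`. Off `W` the function `f` has a positive lower bound `ε₁`, so low
sublevel sets lie in `W`. Compactness of `N` gives a uniform height `ε₂` up to which every pair is
attained. The parametrization is the set-theoretic inverse, which the collar charts show to be
smooth. -/
theorem exists_collarParam [CompactSpace V] [T2Space V] [CompactSpace N] [T2Space N] [Nonempty N]
    (hf : IsBoundaryDefining (k := k) f)
    (hU : IsOpen U) (hr : ContMDiffOn (𝓡∂ (k + 1)) (𝓡 k) ∞ r U)
    (hι : ContMDiff (𝓡 k) (𝓡∂ (k + 1)) ∞ ι) (hιb : range ι = Bdry k V) (hUb : Bdry k V ⊆ U)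
    (hrι : ∀ b, r (ι b) = b) :
    ∃ ε > 0, ∃ c : N × ℝ → V, {x | f x < ε} ⊆ U ∧
      ContMDiffOn ((𝓡 k).prod 𝓘(ℝ, ℝ)) (𝓡∂ (k + 1)) ∞ c {q | 0 ≤ q.2 ∧ q.2 < ε} ∧
      (∀ b s, 0 ≤ s → s < ε → f (c (b, s)) = s) ∧
      (∀ b s, 0 ≤ s → s < ε → r (c (b, s)) = b) ∧ ∀ x, f x < ε → c (r x, f x) = x := by
  have : Nonempty V := ⟨ι (Classical.arbitrary N)⟩
  have hιb' : ∀ b, ι b ∈ Bdry k V := fun b => hιb ▸ mem_range_self b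
  choose κ hκm hκb hκU hκ using exists_collarChart hf.contMDiff hf.nonneg hf.eq_zero_iff
    hf.exists_mfderiv_ne_zero hU hr hι hιb' (fun b => hUb (hιb' b)) hrι
  set Λ : V → N × ℝ := fun x => (r x, f x) with hΛ
  have hfc : Continuous f := hf.contMDiff.continuous
  have hinj : InjOn Λ (Bdry k V) := by
    rw [← hιb]
    rintro _ ⟨b, rfl⟩ _ ⟨b', rfl⟩ h
    have := congrArg Prod.fst h
    simp only [hΛ, hrι] at this
    rw [this]
  have hcpt : IsCompact (Bdry k V) := by
    rw [← hιb]
    exact isCompact_range hι.continuous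
  obtain ⟨t, ht, hbt, htinj⟩ := hinj.exists_isOpen_superset hcpt (fun x hx =>
    (hr.continuousOn.continuousAt (hU.mem_nhds (hUb hx))).prodMk hfc.continuousAt) (by
      rw [← hιb]
      rintro _ ⟨b, rfl⟩
      refine ⟨(κ b).source, (κ b).open_source.mem_nhds (hκb b), fun x hx y hy h => ?_⟩
      simp only [hΛ, Prod.mk.injEq] at h
      have h1 := (hκ b x hx).2
      rw [h.1, h.2, ← (hκ b y hy).2] at h1
      refine ((κ b).extend (𝓡∂ (k + 1))).injOn ?_ ?_ h1 <;>
        rwa [OpenPartialHomeomorph.extend_source])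
  set W : Set V := t ∩ ⋃ b, (κ b).source with hW
  have hWo : IsOpen W := ht.inter (isOpen_iUnion fun b => (κ b).open_source)
  have hbW : Bdry k V ⊆ W := by
    refine subset_inter hbt ?_
    rw [← hιb]
    rintro _ ⟨b, rfl⟩
    exact mem_iUnion.2 ⟨b, hκb b⟩
  obtain ⟨ε₁, hε₁, hε₁W⟩ := hWo.isClosed_compl.isCompact.exists_forall_le' (a := (0 : ℝ))
    hfc.continuousOn fun x hx => lt_of_le_of_ne (hf.nonneg x) fun h =>
      hx (hbW ((hf.eq_zero_iff x).1 h.symm))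
  have hev : ∀ᶠ s in 𝓝 (0 : ℝ), ∀ b ∈ (univ : Set N), 0 ≤ s → ∃ x, f x = s ∧ r x = b := by
    refine isCompact_univ.eventually_forall_of_forall_eventually fun b _ => ?_
    have hE : ContinuousAt (fun q : ℝ × N => consEquiv k (q.1, extChartAt (𝓡 k) b q.2)) (0, b) :=
      (consEquiv k).continuous.continuousAt.comp
        (continuousAt_fst.prodMk ((continuousAt_extChartAt b).comp_of_eq continuousAt_snd rfl))
    have h0 : consEquiv k (0, extChartAt (𝓡 k) b b) = (κ b).extend (𝓡∂ (k + 1)) (ι b) := by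
      rw [(hκ b _ (hκb b)).2, hrι, (hf.eq_zero_iff _).2 (hιb' b)]
    have h1 := (κ b).extend_target_mem_nhdsWithin (I := 𝓡∂ (k + 1)) (hκb b)
    rw [← h0, mem_nhdsWithin_iff_eventually] at h1
    have h2 := hE.eventually h1
    have h3 : ∀ᶠ q : ℝ × N in 𝓝 (0, b), q.2 ∈ (chartAt (EuclideanSpace ℝ (Fin k)) b).source :=
      continuousAt_snd.eventually
        ((chartAt (EuclideanSpace ℝ (Fin k)) b).open_source.mem_nhds (mem_chart_source _ b))
    filter_upwards [h2, h3] with q hq1 hq2 hq3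
    have h4 : consEquiv k (q.1, extChartAt (𝓡 k) b q.2) ∈ ((κ b).extend (𝓡∂ (k + 1))).target := by
      refine hq1 ?_
      rw [range_halfSpace, mem_ofPred_eq, consEquiv_apply_zero]
      exact hq3
    exact ⟨_, (eq_of_collarChart (hκ b) hq2 h4).2⟩
  obtain ⟨ε₂, hε₂, hε₂s⟩ := Metric.eventually_nhds_iff.1 hev
  set ε := min ε₁ ε₂ with hε
  set X : Set V := {x | f x < ε} with hX
  have hXW : X ⊆ W := by
    intro x hx
    by_contra h
    exact absurd (hε₁W x h) (not_le.2 (lt_of_lt_of_le hx (min_le_left _ _)))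
  have hXinj : InjOn Λ X := htinj.mono fun x hx => (hXW hx).1
  set c : N × ℝ → V := Function.invFunOn Λ X with hc
  have hcs : ∀ b s, 0 ≤ s → s < ε → c (b, s) ∈ X ∧ Λ (c (b, s)) = (b, s) := by
    intro b s hs hsε
    obtain ⟨x, hx1, hx2⟩ := hε₂s (y := s) (by
      rw [Real.dist_0_eq_abs, abs_of_nonneg hs]
      exact lt_of_lt_of_le hsε (min_le_right _ _)) b (mem_univ b) hs
    have hex : ∃ x ∈ X, Λ x = (b, s) := ⟨x, by rw [hX, mem_ofPred_eq, hx1]; exact hsε,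
      by rw [hΛ, ← hx1, ← hx2]⟩
    exact ⟨Function.invFunOn_mem hex, Function.invFunOn_eq hex⟩
  refine ⟨ε, lt_min hε₁ hε₂, c, ?_, ?_, fun b s hs hsε => congrArg Prod.snd (hcs b s hs hsε).2,
    fun b s hs hsε => congrArg Prod.fst (hcs b s hs hsε).2, fun x hx => ?_⟩
  · intro x hx
    obtain ⟨b, hb⟩ := mem_iUnion.1 (hXW hx).2
    exact hκU b hb
  · rintro ⟨b, s⟩ ⟨hs, hsε⟩
    obtain ⟨hxX, hxΛ⟩ := hcs b s hs hsε
    obtain ⟨b', hb'⟩ := mem_iUnion.1 (hXW hxX).2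
    simp only [hΛ, Prod.mk.injEq] at hxΛ
    have hbs := hκ b' _ hb'
    rw [hxΛ.1, hxΛ.2] at hbs
    set q₀ : N × ℝ := (b, s) with hq₀
    set D : Set (N × ℝ) := {q | 0 ≤ q.2 ∧ q.2 < ε} with hD
    set E : N × ℝ → EuclideanSpace ℝ (Fin (k + 1)) :=
      fun q => consEquiv k (q.2, extChartAt (𝓡 k) b' q.1) with hE
    have hEs : ContMDiffAt ((𝓡 k).prod 𝓘(ℝ, ℝ)) 𝓘(ℝ, EuclideanSpace ℝ (Fin (k + 1))) ∞ E q₀ := by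
      have h1 : ContMDiffAt ((𝓡 k).prod 𝓘(ℝ, ℝ)) 𝓘(ℝ, EuclideanSpace ℝ (Fin k)) ∞
          (fun q : N × ℝ => extChartAt (𝓡 k) b' q.1) q₀ :=
        (contMDiffAt_extChartAt' hbs.1).comp q₀ contMDiffAt_fst
      exact (consEquiv k).contDiff.contMDiff.contMDiffAt.comp q₀ (contMDiffAt_snd.prodMk_space h1)
    have hmaps : ∀ q ∈ D, E q ∈ range (𝓡∂ (k + 1)) := by
      intro q hq
      rw [range_halfSpace, mem_ofPred_eq, hE, consEquiv_apply_zero]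
      exact hq.1
    have hEt : ∀ᶠ q in 𝓝[D] q₀, E q ∈ ((κ b').extend (𝓡∂ (k + 1))).target := by
      have h1 := (κ b').extend_target_mem_nhdsWithin (I := 𝓡∂ (k + 1)) hb'
      rw [hbs.2] at h1
      exact (tendsto_nhdsWithin_iff.2 ⟨hEs.continuousAt.continuousWithinAt,
        eventually_nhdsWithin_of_forall hmaps⟩).eventually h1
    have hEc : ∀ᶠ q in 𝓝[D] q₀, q.1 ∈ (chartAt (EuclideanSpace ℝ (Fin k)) b').source :=
      (continuousAt_fst.eventually ((chartAt (EuclideanSpace ℝ (Fin k)) b').open_source.mem_nhds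
        hbs.1)).filter_mono nhdsWithin_le_nhds
    have hcE : ∀ᶠ q in 𝓝[D] q₀, c q = ((κ b').extend (𝓡∂ (k + 1))).symm (E q) := by
      filter_upwards [hEt, hEc, self_mem_nhdsWithin] with q h1 h2 h3
      obtain ⟨-, h5, h6⟩ := eq_of_collarChart (hκ b') h2 h1
      refine hXinj (hcs q.1 q.2 h3.1 h3.2).1 ?_ ?_
      · rw [hX, mem_ofPred_eq, h5]
        exact h3.2
      · rw [(hcs q.1 q.2 h3.1 h3.2).2]
        exact Prod.ext h6.symm h5.symm
    have hEt₀ : E q₀ ∈ ((κ b').extend (𝓡∂ (k + 1))).target := hEt.self_of_nhdsWithin ⟨hs, hsε⟩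
    have hsymm : ContMDiffWithinAt 𝓘(ℝ, EuclideanSpace ℝ (Fin (k + 1))) (𝓡∂ (k + 1)) ∞
        ((κ b').extend (𝓡∂ (k + 1))).symm (range (𝓡∂ (k + 1))) (E q₀) := by
      have := contMDiffOn_extend_symm (hκm b')
      rw [← OpenPartialHomeomorph.extend_target'] at this
      refine (this _ hEt₀).mono_of_mem_nhdsWithin ?_
      have h1 := (κ b').extend_target_mem_nhdsWithin (I := 𝓡∂ (k + 1)) hb'
      rwa [hbs.2] at h1
    exact (hsymm.comp q₀ hEs.contMDiffWithinAt hmaps).congr_of_eventuallyEq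
      hcE (hcE.self_of_nhdsWithin ⟨hs, hsε⟩)
  · exact hXinj (hcs _ _ (hf.nonneg x) hx).1 hx (hcs _ _ (hf.nonneg x) hx).2

/-- The boundary of a compact manifold has a collar which is contained in any given neighbourhood. -/
theorem exists_isCollar [CompactSpace V] [T2Space V] [CompactSpace N] [T2Space N] [Nonempty N]
    (hU : IsOpen U) (hr : ContMDiffOn (𝓡∂ (k + 1)) (𝓡 k) ∞ r U)
    (hι : ContMDiff (𝓡 k) (𝓡∂ (k + 1)) ∞ ι) (hιb : range ι = Bdry k V) (hUb : Bdry k V ⊆ U)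
    (hrι : ∀ b, r (ι b) = b) :
    ∃ (f : V → ℝ) (c : N × ℝ → V), IsCollar (k := k) ι f r c ∧ {x | f x < 4} ⊆ U := by
  obtain ⟨f, h1, h2, h3, h4⟩ := exists_boundaryDefiningFunction k V
  have hf : IsBoundaryDefining (k := k) f := ⟨h1, h2, h3, h4⟩
  obtain ⟨ε, hε, c, hεU, hc, hfc, hrc, hcrf⟩ := exists_collarParam hf hU hr hι hιb hUb hrι
  -- Rescaling the height normalizes the width to `4`, which leaves room for the breakpoints of
  -- `spin`, `collapse` and `profile`.
  have hf' : IsBoundaryDefining (k := k) fun x => 4 / ε * f x := hf.const_mul (by positivity)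
  have hlt : ∀ x, 4 / ε * f x < 4 ↔ f x < ε := fun x => by
    rw [div_mul_eq_mul_div, div_lt_iff₀ hε]
    constructor <;> intro h <;> linarith
  have hsε : ∀ s : ℝ, 0 ≤ s → s < 4 → 0 ≤ ε / 4 * s ∧ ε / 4 * s < ε := fun s h1 h2 =>
    ⟨by positivity, by nlinarith⟩
  have hsub : {x | 4 / ε * f x < 4} ⊆ U := fun x hx => hεU ((hlt x).1 hx)
  have hιb' : ∀ b, ι b ∈ Bdry k V := fun b => hιb ▸ mem_range_self b
  refine ⟨_, fun q => c (q.1, ε / 4 * q.2), ⟨hf', hr.mono hsub, ?_, fun b s hs hs' => ?_,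
    fun b s hs hs' => ?_, fun x hx => ?_, hιb', hrι, fun b => ?_⟩, hsub⟩
  · refine hc.comp (ContMDiff.contMDiffOn ?_) fun q hq => hsε q.2 hq.1 hq.2
    exact contMDiff_fst.prodMk (contMDiff_const.mul contMDiff_snd)
  · rw [hfc _ _ (hsε s hs hs').1 (hsε s hs hs').2]
    field_simp
  · exact hrc _ _ (hsε s hs hs').1 (hsε s hs hs').2
  · have h5 : ε / 4 * (4 / ε * f x) = f x := by field_simp
    simp only [h5]
    exact hcrf x ((hlt x).1 hx)
  · have hopen : IsOpen {x | 4 / ε * f x < 4} :=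
      isOpen_lt hf'.contMDiff.continuous continuous_const
    have hmem : ∀ b, ι b ∈ {x | 4 / ε * f x < 4} := fun b => by
      rw [mem_ofPred_eq, (hf'.eq_zero_iff _).2 (hιb' b)]
      norm_num
    obtain ⟨κ, hκm, hκb, hκU, hκ⟩ := exists_collarChart hf'.contMDiff hf'.nonneg hf'.eq_zero_iff
      hf'.exists_mfderiv_ne_zero hopen (hr.mono hsub) hι hιb' hmem hrι b
    exact ⟨κ, hκm, hκb, fun x hx => ⟨hκU hx, hκ x hx⟩⟩

end CollarExistence

/-- Extension of the inclusion of the open unit ball to a map to the closed unit disk. -/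
def toDisk {m : ℕ} (v : EuclideanSpace ℝ (Fin m)) : Disk m :=
  if h : ‖v‖ ≤ 1 then ⟨v, mem_closedBall_zero_iff.2 h⟩ else ⟨0, by simp⟩

theorem coe_toDisk {m : ℕ} {v : EuclideanSpace ℝ (Fin m)} (h : ‖v‖ ≤ 1) : (toDisk v).1 = v := by
  rw [toDisk, dif_pos h]

theorem coe_mem_interior_disk {z : Disk 2} (hz : ‖z.1‖ < 1) : z ∈ (𝓡∂ 2).interior (Disk 2) := by
  rw [← (𝓡∂ 2).compl_boundary, mem_compl_iff]
  intro h
  exact hz.ne (mem_bdry_disk.1 h)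

/-! ### A retraction onto the boundary from the trivialized binding -/

section Retraction

variable {k : ℕ} {V : Type*} [TopologicalSpace V] [ChartedSpace (EuclideanHalfSpace (k + 1)) V]
  [IsManifold (𝓡∂ (k + 1)) ∞ V] [CompactSpace V] [T2Space V]
  {N : Type*} [TopologicalSpace N] [ChartedSpace (EuclideanSpace ℝ (Fin k)) N]
  [IsManifold (𝓡 k) ∞ N] [CompactSpace N] {ι : N → V}

/-- A closed submanifold with a trivial normal bundle in some sphere is a neighbourhood retract in
any manifold in which it is embedded. -/
theorem exists_retraction (hι : IsSmoothEmbedding (𝓡 k) (𝓡∂ (k + 1)) ∞ ι)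
    {β : N × Disk 2 → UnitSphere (k + 2)}
    (hβ : IsSmoothEmbedding ((𝓡 k).prod (𝓡∂ 2)) (𝓡 (k + 2)) ∞ β) [Nonempty N] :
    ∃ (r : V → N) (U : Set V), IsOpen U ∧ range ι ⊆ U ∧ ContMDiffOn (𝓡∂ (k + 1)) (𝓡 k) ∞ r U ∧
      ∀ b, r (ι b) = b := by
  have hβs : ContMDiff ((𝓡 k).prod (𝓡∂ 2)) (𝓡 (k + 2)) ∞ β := hβ.isImmersion.contMDiff
  set z : Disk 2 := ⟨0, by simp⟩ with hz
  -- The core of the binding is viewed as a map to Euclidean space because vector-valued maps can be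
  -- extended to all of `V`; normalizing returns to the sphere near the boundary.
  have hg : ContMDiff (𝓡 k) 𝓘(ℝ, EuclideanSpace ℝ (Fin (k + 2 + 1))) ∞ fun b => (β (b, z)).1 :=
    contMDiff_coe_unitSphere.comp (hβs.comp (contMDiff_id.prodMk contMDiff_const))
  obtain ⟨G, hG, hGι⟩ := exists_contMDiff_extension hι hg
  set r : V → N := fun x => (Function.invFun β (toSphere (G x))).1 with hr
  have hsph : ContMDiffOn (𝓡∂ (k + 1)) (𝓡 (k + 2)) ∞ (fun x => toSphere (G x)) {x | G x ≠ 0} :=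
    fun x hx => ((contMDiffAt_toSphere hx).comp x hG.contMDiffAt).contMDiffWithinAt
  have hopen : IsOpen {x | G x ≠ 0} := isOpen_ne_fun hG.continuous continuous_const
  have hloc : ∀ b : N, ∃ U : Set V, IsOpen U ∧ ι b ∈ U ∧
      ContMDiffOn (𝓡∂ (k + 1)) (𝓡 k) ∞ r U := by
    intro b
    -- The centre `z` is an interior point of `D²` and `N` has no boundary, so `β` has a smooth
    -- inverse near `β (b, z)`.
    obtain ⟨W, hW, hbW, hs, -⟩ := exists_contMDiffOn_invFun (x := (b, z)) (by simp)
      hβ.isEmbedding.injective (hβ.isImmersion.isImmersionAt _) (by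
        rw [ModelWithCorners.interior_prod]
        exact ⟨BoundarylessManifold.isInteriorPoint, coe_mem_interior_disk (by simp [hz])⟩)
    refine ⟨_, hsph.continuousOn.isOpen_inter_preimage hopen hW, ⟨?_, ?_⟩, ?_⟩
    · change G (ι b) ≠ 0
      rw [hGι, ← norm_ne_zero_iff, norm_eq_of_mem_sphere]
      exact one_ne_zero
    · rw [mem_preimage, hGι, toSphere_coe]
      exact hbW
    · exact contMDiff_fst.comp_contMDiffOn (hs.comp (hsph.mono inter_subset_left) fun x hx => hx.2)
  choose U hU hbU hrU using hloc
  refine ⟨r, ⋃ b, U b, isOpen_iUnion hU, ?_, ?_, fun b => ?_⟩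
  · rintro _ ⟨b, rfl⟩
    exact mem_iUnion.2 ⟨b, hbU b⟩
  · intro x hx
    obtain ⟨b, hb⟩ := mem_iUnion.1 hx
    exact ((hrU b).contMDiffAt ((hU b).mem_nhds hb)).contMDiffWithinAt
  · rw [hr]
    simp only
    rw [hGι, toSphere_coe, Function.leftInverse_invFun hβ.isEmbedding.injective]

end Retraction

/-! ### Immersions into the disk -/

section DiskImmersion

variable {k : ℕ}

/-- A linear isomorphism `ℝ^(k+1) × ℝ² ≃ ℝ^(k+3)` which preserves the first coordinate. -/
theorem exists_equiv_apply_zero (k : ℕ) :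
    ∃ K : (EuclideanSpace ℝ (Fin (k + 1)) × EuclideanSpace ℝ (Fin 2)) ≃L[ℝ]
      EuclideanSpace ℝ (Fin (k + 2 + 1)), ∀ q, K q 0 = q.1 0 := by
  have hdim : Module.finrank ℝ (EuclideanSpace ℝ (Fin k) × EuclideanSpace ℝ (Fin 2)) =
      Module.finrank ℝ (EuclideanSpace ℝ (Fin (k + 2))) := by simp
  have A := ContinuousLinearEquiv.ofFinrankEq hdim
  refine ⟨(((consEquiv k).symm.prodCongr (.refl ℝ _)).trans
    (ContinuousLinearEquiv.prodAssoc ℝ _ _ _)).trans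
    ((ContinuousLinearEquiv.prodCongr (.refl ℝ ℝ) A).trans (consEquiv (k + 2))), fun q => ?_⟩
  simp

/-- `B` maps `F` isomorphically onto a linear complement of the range of `L`. -/
theorem exists_complement {E F E' : Type*} [NormedAddCommGroup E] [NormedSpace ℝ E]
    [NormedAddCommGroup F] [NormedSpace ℝ F] [NormedAddCommGroup E'] [NormedSpace ℝ E']
    [FiniteDimensional ℝ E] [FiniteDimensional ℝ F] [FiniteDimensional ℝ E']
    (hdim : Module.finrank ℝ E + Module.finrank ℝ F = Module.finrank ℝ E') (L : E →L[ℝ] E')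
    (hL : ∀ v, L v = 0 → v = 0) :
    ∃ B : F →L[ℝ] E', ∀ u v, L u + B v = 0 → u = 0 ∧ v = 0 := by
  have hinj : Function.Injective (L : E →ₗ[ℝ] E') := (injective_iff_map_eq_zero _).2 hL
  obtain ⟨C, hC⟩ := Submodule.exists_isCompl (LinearMap.range (L : E →ₗ[ℝ] E'))
  have h1 := Submodule.finrank_add_eq_of_isCompl hC
  rw [LinearMap.finrank_range_of_inj hinj] at h1
  have A : F ≃L[ℝ] C := ContinuousLinearEquiv.ofFinrankEq (by omega)
  refine ⟨C.subtypeL.comp (A : F →L[ℝ] C), fun u v h => ?_⟩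
  have h2 : L u = -(A v : E') := eq_neg_of_add_eq_zero_left h
  have h3 : L u ∈ LinearMap.range (L : E →ₗ[ℝ] E') ⊓ C :=
    ⟨⟨u, rfl⟩, by rw [h2]; exact C.neg_mem (A v).2⟩
  rw [hC.inf_eq_bot, Submodule.mem_bot] at h3
  refine ⟨hL u h3, ?_⟩
  rw [h3, eq_comm, neg_eq_zero] at h2
  have h4 : A v = 0 := Subtype.ext h2
  exact A.map_eq_zero_iff.1 h4

theorem zero_le_inv_units_smul {m : ℕ} [NeZero m] {s : ℤˣ} {y : EuclideanSpace ℝ (Fin m)}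
    (hy : s • y ≠ -e₀ m) : 0 ≤ inv (s • y) 0 ↔ ‖y‖ ≤ 1 := by
  rw [inv_apply_zero hy, norm_units_smul, le_div_iff₀ (norm_add_e₀_sq_pos hy), zero_mul,
    sub_nonneg, sq_le_one_iff₀ (norm_nonneg _)]

/-- The chart `y ↦ inv (s • y)` of the disk has injective derivative. -/
theorem eq_zero_of_mfderiv_inv_units_smul {m : ℕ} [NeZero m] {s : ℤˣ}
    {y : EuclideanSpace ℝ (Fin m)} (hy : s • y ≠ -e₀ m) {v : EuclideanSpace ℝ (Fin m)}
    (hv : mfderiv 𝓘(ℝ, EuclideanSpace ℝ (Fin m)) 𝓘(ℝ, EuclideanSpace ℝ (Fin m))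
      (fun y => inv (s • y)) y v = 0) : v = 0 := by
  refine eq_zero_of_mfderiv_of_leftInverse (h := fun y => s • inv y) ?_ ?_ ?_ hv
  · exact ((contDiffAt_inv_units_smul hy).differentiableAt (by simp)).mdifferentiableAt
  · exact (((contDiffOn_units_smul_inv s).contDiffAt
      (isOpen_ne_neg_e₀.mem_nhds (inv_ne hy))).differentiableAt (by simp)).mdifferentiableAt
  · have : IsOpen {y : EuclideanSpace ℝ (Fin m) | s • y ≠ -e₀ m} :=
      isOpen_ne_fun (contDiff_units_smul s).continuous continuous_const
    filter_upwards [this.mem_nhds hy] with y hy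
    rw [inv_inv hy, units_smul_smul]

variable {V : Type*} [TopologicalSpace V] [ChartedSpace (EuclideanHalfSpace (k + 1)) V]
  [IsManifold (𝓡∂ (k + 1)) ∞ V]

/-- A map to the disk which in a chart is the restriction of a map `Ψ` of `ℝ^(k+1) × ℝ²` to `ℝ^(k+3)`
with injective derivative is an immersion, if `Ψ` relates the half-space to the disk. -/
theorem isImmersionAtOfComplement_disk {g : V → Disk (k + 2 + 1)} {x : V} (hg : ContinuousAt g x)
    {φ : OpenPartialHomeomorph V (EuclideanHalfSpace (k + 1))}
    (hφ : φ ∈ IsManifold.maximalAtlas (𝓡∂ (k + 1)) ∞ V) (hx : x ∈ φ.source)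
    {Ψ : EuclideanSpace ℝ (Fin (k + 1)) × EuclideanSpace ℝ (Fin 2) →
      EuclideanSpace ℝ (Fin (k + 2 + 1))}
    {W : Set (EuclideanSpace ℝ (Fin (k + 1)) × EuclideanSpace ℝ (Fin 2))} (hW : IsOpen W)
    (hΨ : ContDiffOn ℝ ∞ Ψ W) (hxW : (φ.extend (𝓡∂ (k + 1)) x, 0) ∈ W)
    (hker : ∀ v, fderiv ℝ Ψ (φ.extend (𝓡∂ (k + 1)) x, 0) v = 0 → v = 0)
    (hnorm : ∀ q ∈ W, ‖Ψ q‖ ≤ 1 ↔ 0 ≤ q.1 0)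
    (hΨg : ∀ᶠ y in 𝓝 x, (g y).1 = Ψ (φ.extend (𝓡∂ (k + 1)) y, 0)) :
    IsImmersionAtOfComplement (EuclideanSpace ℝ (Fin 2)) (𝓡∂ (k + 1)) (𝓡∂ (k + 2 + 1)) ∞ g x := by
  obtain ⟨s, hs⟩ := exists_mem_diskChart_source (g x)
  obtain ⟨K, hK⟩ := exists_equiv_apply_zero k
  have hopen : IsOpen {y : EuclideanSpace ℝ (Fin (k + 2 + 1)) | s • y ≠ -e₀ _} :=
    isOpen_ne_fun (contDiff_units_smul s).continuous continuous_const
  have hW' := hΨ.continuousOn.isOpen_inter_preimage hW hopen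
  have hgx := hΨg.self_of_nhds
  have hxs : s • Ψ (φ.extend (𝓡∂ (k + 1)) x, 0) ≠ -e₀ _ := by
    rw [← hgx]
    exact hs
  refine isImmersionAtOfComplement_of_injective hg hφ hx (diskChart_mem_maximalAtlas s) hs
    (Φ := (fun y => inv (s • y)) ∘ Ψ) hW' ?_ ⟨hxW, hxs⟩ ?_ K ?_ ?_
  · intro q hq
    exact ((contDiffAt_inv_units_smul hq.2).comp q
      (hΨ.contDiffAt (hW.mem_nhds hq.1))).contDiffWithinAt
  · intro v hv
    have hd : DifferentiableAt ℝ Ψ (φ.extend (𝓡∂ (k + 1)) x, 0) :=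
      (hΨ.contDiffAt (hW.mem_nhds hxW)).differentiableAt (by simp)
    have hd' : DifferentiableAt ℝ (fun y => inv (s • y)) (Ψ (φ.extend (𝓡∂ (k + 1)) x, 0)) :=
      (contDiffAt_inv_units_smul hxs).differentiableAt (by simp)
    rw [fderiv_comp _ hd' hd] at hv
    refine hker v (eq_zero_of_mfderiv_inv_units_smul hxs ?_)
    rw [mfderiv_eq_fderiv]
    exact hv
  · intro q hq
    -- In the disk chart the half-space condition means norm at most `1`, and `K` keeps the first
    -- coordinate. So `hnorm` is the required compatibility.
    rw [range_halfSpace, mem_ofPred_eq, mem_ofPred_eq, hK, ← hnorm q hq.1]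
    exact zero_le_inv_units_smul hq.2
  · filter_upwards [hΨg, hg.eventually ((diskChart s).open_source.mem_nhds hs)] with y hy1 hy2
    rw [diskChart_extend_apply hy2, hy1, Function.comp_apply]

/-- A map to the interior of the disk with injective derivative is an immersion at interior points. -/
theorem isImmersionAtOfComplement_disk_of_mfderiv {g : V → Disk (k + 2 + 1)} {x : V}
    (hx : x ∉ Bdry k V) (hgx : ‖(g x).1‖ < 1)
    (hg : ContMDiff (𝓡∂ (k + 1)) 𝓘(ℝ, EuclideanSpace ℝ (Fin (k + 2 + 1))) ∞ fun y => (g y).1)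
    (hker : ∀ v, mfderiv (𝓡∂ (k + 1)) 𝓘(ℝ, EuclideanSpace ℝ (Fin (k + 2 + 1)))
      (fun y => (g y).1) x v = 0 → v = 0) :
    IsImmersionAtOfComplement (EuclideanSpace ℝ (Fin 2)) (𝓡∂ (k + 1)) (𝓡∂ (k + 2 + 1)) ∞ g x := by
  set φ := chartAt (EuclideanHalfSpace (k + 1)) x with hφ
  have hφm : φ ∈ IsManifold.maximalAtlas (𝓡∂ (k + 1)) ∞ V := IsManifold.chart_mem_maximalAtlas _
  have hxs : x ∈ φ.source := mem_chart_source _ _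
  have hxi : x ∈ (𝓡∂ (k + 1)).interior V := by
    rw [← (𝓡∂ (k + 1)).compl_boundary]; exact hx
  have hxt : φ.extend (𝓡∂ (k + 1)) x ∈ interior (φ.extend (𝓡∂ (k + 1))).target :=
    φ.mem_interior_extend_target (φ.map_source hxs) (extend_mem_interior_range hφm hxs hxi)
  set G : EuclideanSpace ℝ (Fin (k + 1)) → EuclideanSpace ℝ (Fin (k + 2 + 1)) :=
    (fun y => (g y).1) ∘ (φ.extend (𝓡∂ (k + 1))).symm with hG
  have hsymm : ContMDiffOn 𝓘(ℝ, EuclideanSpace ℝ (Fin (k + 1))) (𝓡∂ (k + 1)) ∞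
      (φ.extend (𝓡∂ (k + 1))).symm (interior (φ.extend (𝓡∂ (k + 1))).target) := by
    have := contMDiffOn_extend_symm hφm
    rw [← OpenPartialHomeomorph.extend_target'] at this
    exact this.mono interior_subset
  have hGs : ContDiffOn ℝ ∞ G (interior (φ.extend (𝓡∂ (k + 1))).target) :=
    (hg.comp_contMDiffOn hsymm).contDiffOn
  have hGd : DifferentiableAt ℝ G (φ.extend (𝓡∂ (k + 1)) x) :=
    (hGs.contDiffAt (isOpen_interior.mem_nhds hxt)).differentiableAt (by simp)
  have hleft : (φ.extend (𝓡∂ (k + 1))).symm (φ.extend (𝓡∂ (k + 1)) x) = x := φ.extend_left_inv hxs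
  have hGker : ∀ v, fderiv ℝ G (φ.extend (𝓡∂ (k + 1)) x) v = 0 → v = 0 := by
    intro v hv
    have hsd : MDifferentiableAt 𝓘(ℝ, EuclideanSpace ℝ (Fin (k + 1))) (𝓡∂ (k + 1))
        (φ.extend (𝓡∂ (k + 1))).symm (φ.extend (𝓡∂ (k + 1)) x) :=
      (hsymm.contMDiffAt (isOpen_interior.mem_nhds hxt)).mdifferentiableAt (by simp)
    have hgd := hg.mdifferentiable (by simp) ((φ.extend (𝓡∂ (k + 1))).symm
      (φ.extend (𝓡∂ (k + 1)) x))
    rw [← mfderiv_eq_fderiv, hG, mfderiv_comp _ hgd hsd] at hv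
    have hker' := hker
    rw [← hleft] at hker'
    have h1 := hker' _ hv
    refine eq_zero_of_mfderiv_of_leftInverse hsd (h := φ.extend (𝓡∂ (k + 1))) ?_ ?_ h1
    · rw [hleft]
      exact (φ.contMDiffAt_extend hφm hxs).mdifferentiableAt (by simp)
    · filter_upwards [isOpen_interior.mem_nhds hxt] with u hu
      exact (φ.extend (𝓡∂ (k + 1))).right_inv (interior_subset hu)
  -- A linear map in the normal directions completes `G` to a map with injective derivative.
  obtain ⟨B, hB⟩ := exists_complement (F := EuclideanSpace ℝ (Fin 2)) (by simp) _ hGker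
  set Ψ : EuclideanSpace ℝ (Fin (k + 1)) × EuclideanSpace ℝ (Fin 2) →
      EuclideanSpace ℝ (Fin (k + 2 + 1)) := fun q => G q.1 + B q.2 with hΨ
  have hW₀ : IsOpen (Prod.fst ⁻¹' interior (φ.extend (𝓡∂ (k + 1))).target :
      Set (EuclideanSpace ℝ (Fin (k + 1)) × EuclideanSpace ℝ (Fin 2))) :=
    isOpen_interior.preimage continuous_fst
  have hΨs : ContDiffOn ℝ ∞ Ψ (Prod.fst ⁻¹' interior (φ.extend (𝓡∂ (k + 1))).target) :=
    (hGs.comp contDiff_fst.contDiffOn fun q hq => hq).add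
      (B.contDiff.comp contDiff_snd).contDiffOn
  -- After shrinking to norm less than `1`, both half-space conditions hold at every point, so their
  -- equivalence is automatic.
  have hW := hΨs.continuousOn.isOpen_inter_preimage hW₀ (isOpen_lt continuous_norm
    (continuous_const (y := (1 : ℝ))))
  have hval : Ψ (φ.extend (𝓡∂ (k + 1)) x, 0) = (g x).1 := by
    simp only [hΨ, hG, map_zero, add_zero, Function.comp_apply, hleft]
  refine isImmersionAtOfComplement_disk ?_ hφm hxs hW (hΨs.mono inter_subset_left) ⟨hxt, ?_⟩ ?_ ?_ ?_
  · exact Topology.IsInducing.subtypeVal.continuousAt_iff.2 hg.continuous.continuousAt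
  · rw [mem_preimage, hval]
    exact hgx
  · rintro ⟨u, w⟩ h
    have h1 : HasFDerivAt Ψ ((fderiv ℝ G (φ.extend (𝓡∂ (k + 1)) x)).comp
        (ContinuousLinearMap.fst ℝ _ _) + B.comp (ContinuousLinearMap.snd ℝ _ _))
        (φ.extend (𝓡∂ (k + 1)) x, 0) :=
      (HasFDerivAt.comp (φ.extend (𝓡∂ (k + 1)) x, (0 : EuclideanSpace ℝ (Fin 2)))
        (f := Prod.fst) (g := G) hGd.hasFDerivAt hasFDerivAt_fst).add
        (B.hasFDerivAt.comp _ hasFDerivAt_snd)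
    rw [h1.fderiv] at h
    exact Prod.ext (hB u w h).1 (hB u w h).2
  · rintro q ⟨hq1, hq2⟩
    have h1 : q.1 ∈ range (𝓡∂ (k + 1)) :=
      interior_subset (OpenPartialHomeomorph.interior_extend_target_subset_interior_range _ hq1)
    rw [range_halfSpace] at h1
    exact ⟨fun _ => h1, fun _ => le_of_lt hq2⟩
  · filter_upwards [φ.open_source.mem_nhds hxs] with y hy
    simp only [hΨ, hG, map_zero, add_zero, Function.comp_apply]
    rw [φ.extend_left_inv hy]

end DiskImmersion

/-! ### From loops of embeddings to spun embeddings -/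

section SpunOfIsotopy

variable {k : ℕ} {V : Type*} [TopologicalSpace V] [ChartedSpace (EuclideanHalfSpace (k + 1)) V]
  [IsManifold (𝓡∂ (k + 1)) ∞ V] [CompactSpace V]

/-- A closed loop, up to the monodromy, of proper embeddings of the page in the disk gives a spun
embedding in the open book with page the disk. -/
theorem spunEmbeds_disk_of_isotopy (h : V ≃ₘ⟮𝓡∂ (k + 1), 𝓡∂ (k + 1)⟯ V)
    (g : V × ℝ → Disk (k + 2 + 1))
    (hg : ContMDiff ((𝓡∂ (k + 1)).prod 𝓘(ℝ, ℝ)) 𝓘(ℝ, EuclideanSpace ℝ (Fin (k + 2 + 1))) ∞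
      fun q => (g q).1)
    (hinj : ∀ t, Function.Injective fun x => g (x, t))
    (hbd : ∀ x t, ‖(g (x, t)).1‖ = 1 ↔ x ∈ Bdry k V)
    (himm : ∀ x t, x ∉ Bdry k V → ∀ v, mfderiv (𝓡∂ (k + 1))
      𝓘(ℝ, EuclideanSpace ℝ (Fin (k + 2 + 1))) (fun y => (g (y, t)).1) x v = 0 → v = 0)
    (himmb : ∀ x t, x ∈ Bdry k V → IsImmersionAtOfComplement (EuclideanSpace ℝ (Fin 2))
      (𝓡∂ (k + 1)) (𝓡∂ (k + 2 + 1)) ∞ (fun y => g (y, t)) x)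
    (hend : ∀ x, g (x, 1) = g (h x, 0)) (hfix : ∀ x ∈ Bdry k V, ∀ t, g (x, t) = g (x, 0)) :
    SpunEmbeds (k := k) (l := k + 2) V h (Disk (k + 2 + 1))
      (Diffeomorph.refl (𝓡∂ (k + 2 + 1)) (Disk (k + 2 + 1)) ∞) := by
  have hgt : ∀ t, ContMDiff (𝓡∂ (k + 1)) 𝓘(ℝ, EuclideanSpace ℝ (Fin (k + 2 + 1))) ∞
      fun x => (g (x, t)).1 := fun t => hg.comp (contMDiff_id.prodMk contMDiff_const)
  have hproper : ∀ t, IsProperEmbedding (k := k) (l := k + 2) fun x => g (x, t) := by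
    intro t
    have him : IsImmersionOfComplement (EuclideanSpace ℝ (Fin 2)) (𝓡∂ (k + 1)) (𝓡∂ (k + 2 + 1)) ∞
        fun x => g (x, t) := by
      intro x
      by_cases hx : x ∈ Bdry k V
      · exact himmb x t hx
      · refine isImmersionAtOfComplement_disk_of_mfderiv hx ?_ (hgt t) (himm x t hx)
        exact lt_of_le_of_ne (mem_closedBall_zero_iff.1 (g (x, t)).2) (mt (hbd x t).1 hx)
    refine ⟨⟨him.isImmersion, ?_⟩, ?_⟩
    · exact (him.contMDiff.continuous.isClosedEmbedding (hinj t)).isEmbedding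
    · ext x
      rw [mem_preimage, mem_bdry_disk, hbd]
  -- Time is reversed: the isotopy has to start at `g (h x, 0) = g (x, 1)` and to end at `g (x, 0)`.
  refine ⟨fun x => g (x, 0), hproper 0, fun q => g (q.1, 1 - q.2.1), ?_, fun s => hproper (1 - s.1),
    fun x => ?_, fun x => ?_, fun x hx s => ?_⟩
  · have hs : ContMDiff ((𝓡∂ (k + 1)).prod (𝓡∂ 1)) ((𝓡∂ (k + 1)).prod 𝓘(ℝ, ℝ)) ∞
        (fun q : V × Icc (0 : ℝ) 1 => (q.1, 1 - q.2.1)) :=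
      contMDiff_fst.prodMk (contMDiff_const.sub (contMDiff_subtypeVal_Icc.comp contMDiff_snd))
    exact fun q => contMDiffAt_disk ((hg.comp hs) q)
  · simp [hend]
  · simp
  · have h1 := hfix x hx 1
    rw [hend] at h1
    simp only [Function.comp_apply]
    rw [h1, hfix x hx]

end SpunOfIsotopy

/-! ### Auxiliary functions of the height -/

section Profiles

/-- The distance from the origin of the spun page, as a function of the height in the collar. -/
def profile (s : ℝ) : ℝ :=
  Real.smoothTransition (8 - 2 * s) * (1 - s / 8) + (1 - Real.smoothTransition (8 - 2 * s)) / 4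

theorem contDiff_profile : ContDiff ℝ ∞ profile := by
  have h1 : ContDiff ℝ ∞ fun s : ℝ => Real.smoothTransition (8 - 2 * s) :=
    Real.smoothTransition.contDiff.comp (contDiff_const.sub (contDiff_const.mul contDiff_id))
  exact (h1.mul (contDiff_const.sub (contDiff_id.div_const 8))).add
    ((contDiff_const.sub h1).div_const 4)

theorem profile_of_le {s : ℝ} (hs : s ≤ 7 / 2) : profile s = 1 - s / 8 := by
  rw [profile, Real.smoothTransition.one_of_one_le (by linarith)]
  ring

/-- Constancy beyond the collar is needed because the monodromy may change the height there, while
the radius must agree at `x` and `h x`. -/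
theorem profile_of_four_le {s : ℝ} (hs : 4 ≤ s) : profile s = 1 / 4 := by
  rw [profile, Real.smoothTransition.zero_of_nonpos (by linarith)]
  ring

/-- The bound `9/16` is the value of `1 - s/8` at `s = 7/2`: later radii never recur among the
earlier ones, even though monotonicity beyond `7/2` is not claimed. -/
theorem profile_lt {s : ℝ} (hs : 7 / 2 < s) : profile s < 9 / 16 := by
  have h0 := Real.smoothTransition.nonneg (8 - 2 * s)
  have h1 := Real.smoothTransition.lt_one_of_lt_one (x := 8 - 2 * s) (by linarith)
  have h2 := mul_nonneg h0 (sub_nonneg.2 hs.le)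
  rw [profile]
  linarith

theorem profile_pos (s : ℝ) : 0 < profile s := by
  rcases le_or_gt 4 s with hs | hs
  · rw [profile_of_four_le hs]
    norm_num
  · have h0 := Real.smoothTransition.nonneg (8 - 2 * s)
    have h1 := Real.smoothTransition.le_one (8 - 2 * s)
    rw [profile]
    nlinarith

/-- This is the dichotomy behind injectivity: either the radius determines the height, or both
heights lie where `pushIn` is the identity. -/
theorem profile_eq {s t : ℝ} (h : profile s = profile t) : s = t ∨ 7 / 2 < s ∧ 7 / 2 < t := by
  rcases le_or_gt s (7 / 2) with hs | hs <;> rcases le_or_gt t (7 / 2) with ht | ht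
  · rw [profile_of_le hs, profile_of_le ht] at h
    left; linarith
  · rw [profile_of_le hs] at h
    linarith [profile_lt ht]
  · rw [profile_of_le ht] at h
    linarith [profile_lt hs]
  · exact Or.inr ⟨hs, ht⟩

theorem profile_zero : profile 0 = 1 := by
  rw [profile_of_le (by norm_num)]
  norm_num

theorem profile_eq_one_iff {s : ℝ} : profile s = 1 ↔ s = 0 := by
  refine ⟨fun h => ?_, fun h => by rw [h, profile_zero]⟩
  rw [← profile_zero] at h
  rcases profile_eq h with h | h
  · exact h
  · linarith [h.2]

theorem profile_le_one {s : ℝ} (hs : 0 ≤ s) : profile s ≤ 1 := by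
  rcases le_or_gt s (7 / 2) with h | h
  · rw [profile_of_le h]
    linarith
  · linarith [profile_lt h]

/-- A smooth function which collapses `[0, 2]` to `0` and is the identity on `[3, ∞)`. -/
def collapse (s : ℝ) : ℝ := s * Real.smoothTransition (s - 2)

theorem contDiff_collapse : ContDiff ℝ ∞ collapse :=
  contDiff_id.mul (Real.smoothTransition.contDiff.comp (contDiff_id.sub contDiff_const))

theorem collapse_of_le_two {s : ℝ} (hs : s ≤ 2) : collapse s = 0 := by
  rw [collapse, Real.smoothTransition.zero_of_nonpos (by linarith), mul_zero]

theorem collapse_of_three_le {s : ℝ} (hs : 3 ≤ s) : collapse s = s := by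
  rw [collapse, Real.smoothTransition.one_of_one_le (by linarith), mul_one]

theorem collapse_nonneg {s : ℝ} (hs : 0 ≤ s) : 0 ≤ collapse s :=
  mul_nonneg hs (Real.smoothTransition.nonneg _)

theorem collapse_le {s : ℝ} (hs : 0 ≤ s) : collapse s ≤ s :=
  mul_le_of_le_one_right hs (Real.smoothTransition.le_one _)

/-- The point of the disk with angle `t` whose distance from the origin is `0` for `s ≤ 1/2` and `1`
for `1 ≤ s`. -/
def spin (s t : ℝ) : Disk 2 :=
  ⟨Real.smoothTransition (2 * s - 1) • (circlePoint t).1, by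
    rw [mem_closedBall_zero_iff, norm_smul, norm_circlePoint, mul_one,
      Real.norm_of_nonneg (Real.smoothTransition.nonneg _)]
    exact Real.smoothTransition.le_one _⟩

theorem coe_spin (s t : ℝ) :
    (spin s t).1 = Real.smoothTransition (2 * s - 1) • (circlePoint t).1 := rfl

/-- Independence of `t` near height `0` keeps the isotopy constant near the boundary, not only on
it, so that one extension across the boundary serves for all `t`. -/
theorem spin_of_le {s : ℝ} (hs : s ≤ 1 / 2) (t : ℝ) : spin s t = toDisk 0 := by
  apply Subtype.ext
  rw [coe_toDisk (by simp), coe_spin, Real.smoothTransition.zero_of_nonpos (by linarith), zero_smul]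

theorem spin_of_one_le {s : ℝ} (hs : 1 ≤ s) (t : ℝ) : spin s t = circlePoint t := by
  apply Subtype.ext
  rw [coe_spin, Real.smoothTransition.one_of_one_le (by linarith), one_smul]

theorem spin_one (s : ℝ) : spin s 1 = spin s 0 := by
  apply Subtype.ext
  rw [coe_spin, coe_spin, (circlePoint_eq_iff (s := 1) (t := 0)).2 ⟨1, by norm_num⟩]

theorem contMDiff_spin : ContMDiff (𝓘(ℝ, ℝ).prod 𝓘(ℝ, ℝ)) (𝓡∂ 2) ∞
    (fun q : ℝ × ℝ => spin q.1 q.2) := by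
  intro q
  refine contMDiffAt_disk (ContMDiff.contMDiffAt ?_)
  have h1 : ContMDiff (𝓘(ℝ, ℝ).prod 𝓘(ℝ, ℝ)) 𝓘(ℝ, ℝ) ∞
      (fun q : ℝ × ℝ => Real.smoothTransition (2 * q.1 - 1)) :=
    (Real.smoothTransition.contDiff.comp
      ((contDiff_const.mul contDiff_id).sub contDiff_const)).contMDiff.comp contMDiff_fst
  exact h1.smul (contDiff_circlePoint.contMDiff.comp contMDiff_snd)

end Profiles

/-! ### The spun page and its isotopy -/

section SpunPage

variable {k : ℕ} {V : Type*} [TopologicalSpace V] [ChartedSpace (EuclideanHalfSpace (k + 1)) V]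
  {N : Type*} [TopologicalSpace N] [ChartedSpace (EuclideanSpace ℝ (Fin k)) N]

/-- The maps `α` of the mapping torus and `β` of the binding which form an open book decomposition of
a sphere, where the monodromy is the identity on a collar of the boundary of the page. -/
structure IsCollaredOpenBook (ι : N → V) (f : V → ℝ) (r : V → N) (c : N × ℝ → V)
    (h : V ≃ₘ⟮𝓡∂ (k + 1), 𝓡∂ (k + 1)⟯ V) (α : V × ℝ → UnitSphere (k + 2))
    (β : N × Disk 2 → UnitSphere (k + 2)) : Prop extends IsCollar (k := k) ι f r c where
  eq_self : ∀ x, f x < 4 → h x = x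
  isImmersion_page : IsImmersion ((𝓡∂ (k + 1)).prod 𝓘(ℝ, ℝ)) (𝓡 (k + 2)) ∞ α
  page_eq_iff : ∀ x y : V, ∀ s t : ℝ, α (x, s) = α (y, t) ↔
    ∃ j : ℤ, s = t + j ∧ y = ((h.toEquiv : Equiv.Perm V) ^ j) x
  isSmoothEmbedding_binding : IsSmoothEmbedding ((𝓡 k).prod (𝓡∂ 2)) (𝓡 (k + 2)) ∞ β
  page_incl : ∀ b t, α (ι b, t) = β (b, circlePoint t)

/-- The map of the page to itself which collapses a part of the collar to the boundary. -/
def pushIn (f : V → ℝ) (r : V → N) (c : N × ℝ → V) (x : V) : V :=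
  if f x < 4 then c (r x, collapse (f x)) else x

/-- The isotopy of the page in the sphere, where the boundary of the page rests on the core of the
binding. -/
def spun (f : V → ℝ) (r : V → N) (c : N × ℝ → V) (α : V × ℝ → UnitSphere (k + 2))
    (β : N × Disk 2 → UnitSphere (k + 2)) (q : V × ℝ) : UnitSphere (k + 2) :=
  if f q.1 < 3 / 2 then β (r q.1, spin (f q.1) q.2) else α (pushIn f r c q.1, q.2)

/-- The isotopy of proper embeddings of the page in the disk. -/
def spunDisk (f : V → ℝ) (r : V → N) (c : N × ℝ → V) (α : V × ℝ → UnitSphere (k + 2))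
    (β : N × Disk 2 → UnitSphere (k + 2)) (q : V × ℝ) : Disk (k + 2 + 1) :=
  toDisk (profile (f q.1) • (spun f r c α β q).1)

variable {ι : N → V} {f : V → ℝ} {r : V → N} {c : N × ℝ → V}
  {h : V ≃ₘ⟮𝓡∂ (k + 1), 𝓡∂ (k + 1)⟯ V} {α : V × ℝ → UnitSphere (k + 2)}
  {β : N × Disk 2 → UnitSphere (k + 2)}

namespace IsCollar

theorem height_incl (C : IsCollar (k := k) ι f r c)
    (b : N) : f (ι b) = 0 := (C.eq_zero_iff _).2 (C.mem_boundary b)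

theorem param_zero (C : IsCollar (k := k) ι f r c) (b : N) : c (b, 0) = ι b := by
  have := C.param_proj (ι b) (by rw [C.height_incl]; norm_num)
  rwa [C.proj_incl, C.height_incl] at this

theorem incl_proj (C : IsCollar (k := k) ι f r c) {x : V} (hx : x ∈ Bdry k V) : ι (r x) = x := by
  have h0 := (C.eq_zero_iff x).2 hx
  have := C.param_proj x (by rw [h0]; norm_num)
  rwa [h0, C.param_zero] at this

theorem isOpen_lt (C : IsCollar (k := k) ι f r c) (a : ℝ) : IsOpen {x | f x < a} :=
  _root_.isOpen_lt C.contMDiff.continuous continuous_const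

theorem isOpen_gt (C : IsCollar (k := k) ι f r c) (a : ℝ) : IsOpen {x | a < f x} :=
  _root_.isOpen_lt continuous_const C.contMDiff.continuous

theorem pushIn_of_three_le (C : IsCollar (k := k) ι f r c)
    {x : V} (hx : 3 ≤ f x) : pushIn f r c x = x := by
  rw [pushIn]
  split_ifs with h4
  · rw [collapse_of_three_le hx, C.param_proj x h4]
  · rfl

theorem collapse_mem (C : IsCollar (k := k) ι f r c)
    {x : V} (hx : f x < 4) : 0 ≤ collapse (f x) ∧ collapse (f x) < 4 :=
  ⟨collapse_nonneg (C.nonneg x), (collapse_le (C.nonneg x)).trans_lt hx⟩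

theorem height_pushIn_lt (C : IsCollar (k := k) ι f r c)
    {x : V} (hx : f x < 4) : f (pushIn f r c x) < 4 := by
  rw [pushIn, if_pos hx, C.height_param _ _ (C.collapse_mem hx).1 (C.collapse_mem hx).2]
  exact (C.collapse_mem hx).2

theorem proj_pushIn (C : IsCollar (k := k) ι f r c)
    {x : V} (hx : f x < 4) : r (pushIn f r c x) = r x := by
  rw [pushIn, if_pos hx, C.proj_param _ _ (C.collapse_mem hx).1 (C.collapse_mem hx).2]

theorem pushIn_of_le_two (C : IsCollar (k := k) ι f r c)
    {x : V} (hx : f x ≤ 2) : pushIn f r c x = ι (r x) := by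
  rw [pushIn, if_pos (by linarith), collapse_of_le_two hx, C.param_zero]

/-- The two branches agree at heights from `3` to `4`, where `collapse` is the identity. -/
theorem contMDiff_pushIn (C : IsCollar (k := k) ι f r c) :
    ContMDiff (𝓡∂ (k + 1)) (𝓡∂ (k + 1)) ∞ (pushIn f r c) := by
  intro x
  rcases lt_or_ge (f x) 4 with hx | hx
  · have h1 : ContMDiffOn (𝓡∂ (k + 1)) ((𝓡 k).prod 𝓘(ℝ, ℝ)) ∞ (fun x => (r x, collapse (f x)))
        {x | f x < 4} :=
      C.contMDiffOn_proj.prodMk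
        (contDiff_collapse.contMDiff.comp_contMDiffOn C.contMDiff.contMDiffOn)
    have h2 := C.contMDiffOn_param.comp h1 fun y hy => C.collapse_mem hy
    refine (h2.contMDiffAt ((C.isOpen_lt 4).mem_nhds hx)).congr_of_eventuallyEq ?_
    filter_upwards [(C.isOpen_lt 4).mem_nhds hx] with y hy
    rw [pushIn, if_pos hy]
    rfl
  · refine contMDiffAt_id.congr_of_eventuallyEq ?_
    filter_upwards [(C.isOpen_gt 3).mem_nhds (show 3 < f x by linarith)] with y hy
    exact C.pushIn_of_three_le (le_of_lt hy)

theorem mdifferentiableAt_proj (C : IsCollar (k := k) ι f r c) {x : V} (hx : f x < 4) :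
    MDifferentiableAt (𝓡∂ (k + 1)) (𝓡 k) r x :=
  (C.contMDiffOn_proj.contMDiffAt ((C.isOpen_lt 4).mem_nhds hx)).mdifferentiableAt (by simp)

/-- The collar coordinates have injective derivative. -/
theorem eq_zero_of_mfderiv (C : IsCollar (k := k) ι f r c) {x : V} (hx0 : 0 < f x) (hx4 : f x < 4)
    {v : TangentSpace (𝓡∂ (k + 1)) x} (hf : mfderiv (𝓡∂ (k + 1)) 𝓘(ℝ, ℝ) f x v = 0)
    (hr : mfderiv (𝓡∂ (k + 1)) (𝓡 k) r x v = 0) : v = 0 := by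
  have hfd : MDifferentiableAt (𝓡∂ (k + 1)) 𝓘(ℝ, ℝ) f x := C.contMDiff.mdifferentiable (by simp) x
  have hrd := C.mdifferentiableAt_proj hx4
  refine eq_zero_of_mfderiv_of_leftInverse (f := fun y => (r y, f y)) (h := c) (hrd.prodMk hfd) ?_ ?_
    ?_
  · refine (C.contMDiffOn_param.contMDiffAt ?_).mdifferentiableAt (by simp)
    have h1 : IsOpen {q : N × ℝ | 0 < q.2 ∧ q.2 < 4} :=
      (_root_.isOpen_lt continuous_const continuous_snd).inter
        (_root_.isOpen_lt continuous_snd continuous_const)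
    filter_upwards [h1.mem_nhds (show (r x, f x) ∈ {q : N × ℝ | 0 < q.2 ∧ q.2 < 4} from ⟨hx0, hx4⟩)]
      with q hq
    exact ⟨hq.1.le, hq.2⟩
  · filter_upwards [(C.isOpen_lt 4).mem_nhds hx4] with y hy
    exact C.param_proj y hy
  · rw [hrd.mfderiv_prod hfd]
    exact Prod.ext hr hf

end IsCollar

namespace IsCollaredOpenBook

/-- The threshold `3/2` in `spun` is immaterial: at heights between `1` and `2`, `spin` has reached
the circle and `pushIn` lands on the boundary, so both branches give `β (r x, circlePoint t) = α (ι
(r x), t)`. -/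
theorem spun_of_lt_two (D : IsCollaredOpenBook (k := k) ι f r c h α β)
    {x : V} (hx : f x < 2) (t : ℝ) :
    spun f r c α β (x, t) = β (r x, spin (f x) t) := by
  rw [spun]
  split_ifs with h1
  · rfl
  · simp only at h1 ⊢
    rw [D.pushIn_of_le_two hx.le, D.page_incl, spin_of_one_le (by linarith)]

theorem spun_of_one_le (D : IsCollaredOpenBook (k := k) ι f r c h α β)
    {x : V} (hx : 1 ≤ f x) (t : ℝ) :
    spun f r c α β (x, t) = α (pushIn f r c x, t) := by
  rw [spun]
  split_ifs with h1
  · simp only at h1 ⊢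
    rw [D.pushIn_of_le_two (by linarith), D.page_incl, spin_of_one_le hx]
  · rfl

theorem contMDiff_spun (D : IsCollaredOpenBook (k := k) ι f r c h α β) :
    ContMDiff ((𝓡∂ (k + 1)).prod 𝓘(ℝ, ℝ)) (𝓡 (k + 2)) ∞ (spun f r c α β) := by
  rintro ⟨x, t⟩
  rcases lt_or_ge (f x) 2 with hx | hx
  · have hopen : {q : V × ℝ | f q.1 < 2} ∈ 𝓝 (x, t) :=
      ((D.isOpen_lt 2).preimage continuous_fst).mem_nhds hx
    have h1 : ContMDiffAt ((𝓡∂ (k + 1)).prod 𝓘(ℝ, ℝ)) (𝓡 k) ∞ (fun q : V × ℝ => r q.1) (x, t) :=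
      (D.contMDiffOn_proj.contMDiffAt ((D.isOpen_lt 4).mem_nhds
        (show f x < 4 by linarith))).comp (x, t) contMDiffAt_fst
    have h2 : ContMDiffAt ((𝓡∂ (k + 1)).prod 𝓘(ℝ, ℝ)) (𝓡∂ 2) ∞
        (fun q : V × ℝ => spin (f q.1) q.2) (x, t) :=
      (contMDiff_spin.comp ((D.contMDiff.comp contMDiff_fst).prodMk contMDiff_snd)).contMDiffAt
    refine ((D.isSmoothEmbedding_binding.isImmersion.contMDiff.contMDiffAt).comp (x, t)
      (h1.prodMk h2)).congr_of_eventuallyEq ?_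
    filter_upwards [hopen] with q hq
    exact D.spun_of_lt_two hq q.2
  · have hopen : {q : V × ℝ | 1 < f q.1} ∈ 𝓝 (x, t) :=
      ((D.isOpen_gt 1).preimage continuous_fst).mem_nhds (show 1 < f x by linarith)
    refine ((D.isImmersion_page.contMDiff.comp ((D.contMDiff_pushIn.comp contMDiff_fst).prodMk
      contMDiff_snd)).contMDiffAt (x := (x, t))).congr_of_eventuallyEq ?_
    filter_upwards [hopen] with q hq
    exact D.spun_of_one_le (le_of_lt hq) q.2

theorem coe_spunDisk (D : IsCollaredOpenBook (k := k) ι f r c h α β) (q : V × ℝ) :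
    (spunDisk f r c α β q).1 = profile (f q.1) • (spun f r c α β q).1 := by
  refine coe_toDisk ?_
  rw [norm_smul, norm_eq_of_mem_sphere, mul_one, Real.norm_of_nonneg (profile_pos _).le]
  exact profile_le_one (D.nonneg _)

theorem norm_spunDisk (D : IsCollaredOpenBook (k := k) ι f r c h α β)
    (q : V × ℝ) : ‖(spunDisk f r c α β q).1‖ = profile (f q.1) := by
  rw [D.coe_spunDisk, norm_smul, norm_eq_of_mem_sphere, mul_one,
    Real.norm_of_nonneg (profile_pos _).le]

theorem contMDiff_spunDisk (D : IsCollaredOpenBook (k := k) ι f r c h α β) :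
    ContMDiff ((𝓡∂ (k + 1)).prod 𝓘(ℝ, ℝ)) 𝓘(ℝ, EuclideanSpace ℝ (Fin (k + 2 + 1))) ∞
      fun q => (spunDisk f r c α β q).1 := by
  simp only [D.coe_spunDisk]
  exact (contDiff_profile.contMDiff.comp (D.contMDiff.comp contMDiff_fst)).smul
    (contMDiff_coe_unitSphere.comp D.contMDiff_spun)

theorem norm_spunDisk_eq_one_iff (D : IsCollaredOpenBook (k := k) ι f r c h α β) (x : V) (t : ℝ) :
    ‖(spunDisk f r c α β (x, t)).1‖ = 1 ↔ x ∈ Bdry k V := by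
  rw [D.norm_spunDisk, profile_eq_one_iff, D.eq_zero_iff]

theorem page_injective (D : IsCollaredOpenBook (k := k) ι f r c h α β)
    (t : ℝ) : Function.Injective fun x => α (x, t) := by
  intro x y hxy
  obtain ⟨j, hj, hy⟩ := (D.page_eq_iff x y t t).1 hxy
  have : j = 0 := by
    have : (j : ℝ) = 0 := by linarith
    exact_mod_cast this
  rw [hy, this, zpow_zero]
  rfl

/-- The norm of the image gives the radius, its direction gives `spun`. If the heights agree, `β` or
the pushed page recovers the projection to the boundary, or the point itself beyond the collar.
Otherwise both heights exceed `7/2`, where `spun` is the injective page map. -/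
theorem spunDisk_injective (D : IsCollaredOpenBook (k := k) ι f r c h α β)
    (t : ℝ) : Function.Injective fun x => spunDisk f r c α β (x, t) := by
  intro x y hxy
  simp only at hxy
  have h1 : profile (f x) = profile (f y) := by
    have := congrArg (fun z : Disk (k + 2 + 1) => ‖z.1‖) hxy
    simpa only [D.norm_spunDisk] using this
  have h2 : spun f r c α β (x, t) = spun f r c α β (y, t) := by
    have := congrArg Subtype.val hxy
    rw [D.coe_spunDisk, D.coe_spunDisk] at this
    simp only at this
    rw [h1] at this
    exact Subtype.ext (smul_right_injective _ (profile_pos (f y)).ne' this)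
  have hrf : r x = r y → f x = f y → f y < 4 → x = y := fun e1 e2 e3 => by
    rw [← D.param_proj x (e2 ▸ e3), e1, e2, D.param_proj y e3]
  rcases profile_eq h1 with h3 | ⟨h3, h4⟩
  · rcases lt_or_ge (f y) 2 with hy | hy
    · rw [D.spun_of_lt_two (h3 ▸ hy), D.spun_of_lt_two hy] at h2
      have := D.isSmoothEmbedding_binding.isEmbedding.injective h2
      exact hrf (congrArg Prod.fst this) h3 (by linarith)
    · rw [D.spun_of_one_le (by linarith), D.spun_of_one_le (by linarith)] at h2
      have h5 := D.page_injective t h2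
      rcases lt_or_ge (f y) 4 with hy4 | hy4
      · refine hrf ?_ h3 hy4
        rw [← D.proj_pushIn (h3 ▸ hy4), ← D.proj_pushIn hy4, h5]
      · rwa [D.pushIn_of_three_le (by linarith), D.pushIn_of_three_le (by linarith)] at h5
  · rw [D.spun_of_one_le (by linarith), D.spun_of_one_le (by linarith)] at h2
    have h5 := D.page_injective t h2
    rwa [D.pushIn_of_three_le (by linarith), D.pushIn_of_three_le (by linarith)] at h5

theorem page_one (D : IsCollaredOpenBook (k := k) ι f r c h α β) (x : V) : α (x, 1) = α (h x, 0) :=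
  (D.page_eq_iff _ _ _ _).2 ⟨1, by norm_num, by rw [zpow_one]; rfl⟩

/-- In the collar `h` fixes both `x` and `pushIn x`, and `spin` has period `1` in the angle. Beyond
the collar the radius is constant and the relation `α (x, 1) = α (h x, 0)` decides. -/
theorem spunDisk_one (D : IsCollaredOpenBook (k := k) ι f r c h α β)
    (x : V) : spunDisk f r c α β (x, 1) = spunDisk f r c α β (h x, 0) := by
  apply Subtype.ext
  rw [D.coe_spunDisk, D.coe_spunDisk]
  simp only
  rcases lt_or_ge (f x) 4 with hx | hx
  · rw [D.eq_self x hx]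
    congr 2
    rcases lt_or_ge (f x) 2 with hx2 | hx2
    · rw [D.spun_of_lt_two hx2, D.spun_of_lt_two hx2, spin_one]
    · rw [D.spun_of_one_le (by linarith), D.spun_of_one_le (by linarith), D.page_one,
        D.eq_self _ (D.height_pushIn_lt hx)]
  -- A point outside the collar cannot be moved into it, since `h` is injective and already fixes
  -- every point of the collar.
  · have hhx : 4 ≤ f (h x) := by
      by_contra hlt
      have h1 := D.eq_self _ (not_le.1 hlt)
      have h2 : h x = x := h.injective h1
      rw [h2] at hlt
      exact hlt hx
    rw [profile_of_four_le hx, profile_of_four_le hhx, D.spun_of_one_le (by linarith),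
      D.spun_of_one_le (by linarith), D.pushIn_of_three_le (by linarith),
      D.pushIn_of_three_le (by linarith), D.page_one]

theorem spunDisk_boundary (D : IsCollaredOpenBook (k := k) ι f r c h α β)
    {x : V} (hx : x ∈ Bdry k V) (t : ℝ) :
    spunDisk f r c α β (x, t) = spunDisk f r c α β (x, 0) := by
  have h0 := (D.eq_zero_iff x).2 hx
  apply Subtype.ext
  rw [D.coe_spunDisk, D.coe_spunDisk, D.spun_of_lt_two (by linarith), D.spun_of_lt_two (by linarith),
    spin_of_le (by linarith), spin_of_le (by linarith)]

end IsCollaredOpenBook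

end SpunPage

/-! ### The spun page is immersed -/

section SpunPageImmersion

variable {k : ℕ} {V : Type*} [TopologicalSpace V] [ChartedSpace (EuclideanHalfSpace (k + 1)) V]
  [IsManifold (𝓡∂ (k + 1)) ∞ V]
  {N : Type*} [TopologicalSpace N] [ChartedSpace (EuclideanSpace ℝ (Fin k)) N]
  [IsManifold (𝓡 k) ∞ N]
  {ι : N → V} {f : V → ℝ} {r : V → N} {c : N × ℝ → V}
  {h : V ≃ₘ⟮𝓡∂ (k + 1), 𝓡∂ (k + 1)⟯ V} {α : V × ℝ → UnitSphere (k + 2)}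
  {β : N × Disk 2 → UnitSphere (k + 2)}

namespace IsCollaredOpenBook

/-- Below height `7/2` the radius is affine in `f`, so `df v = 0`. The immersion `β`, or `α`
together with `r ∘ pushIn = r`, gives `dr v = 0`, and the collar coordinates then force `v = 0`.
From height `7/2` on `pushIn` is locally the identity and the immersion `α` alone suffices. -/
theorem eq_zero_of_mfderiv_spun (D : IsCollaredOpenBook (k := k) ι f r c h α β) {x : V} (t : ℝ)
    (hx : 0 < f x) {v : TangentSpace (𝓡∂ (k + 1)) x}
    (hp : mfderiv (𝓡∂ (k + 1)) 𝓘(ℝ, ℝ) (fun y => profile (f y)) x v = 0)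
    (hs : mfderiv (𝓡∂ (k + 1)) (𝓡 (k + 2)) (fun y => spun f r c α β (y, t)) x v = 0) : v = 0 := by
  have hfd : MDifferentiableAt (𝓡∂ (k + 1)) 𝓘(ℝ, ℝ) f x := D.contMDiff.mdifferentiable (by simp) x
  have hpd : MDifferentiableAt (𝓡∂ (k + 1)) 𝓘(ℝ, ℝ) (fun y => profile (f y)) x :=
    (contDiff_profile.contMDiff.comp D.contMDiff).mdifferentiable (by simp) x
  have hdf : f x < 7 / 2 → mfderiv (𝓡∂ (k + 1)) 𝓘(ℝ, ℝ) f x v = 0 := by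
    intro hx7
    refine mfderiv_apply_eq_zero_of_comp hpd (h := fun s : ℝ => 8 * (1 - s)) ?_ ?_ hp
    · exact (((differentiableAt_const _).sub differentiableAt_id).const_mul _).mdifferentiableAt
    · filter_upwards [(D.isOpen_lt (7 / 2)).mem_nhds hx7] with y hy
      rw [profile_of_le (le_of_lt hy)]
      ring
  rcases lt_or_ge (f x) 2 with hx2 | hx2
  · have hrd := D.mdifferentiableAt_proj (show f x < 4 by linarith)
    have hsd : MDifferentiableAt (𝓡∂ (k + 1)) (𝓡∂ 2) (fun y => spin (f y) t) x :=
      (contMDiff_spin.comp (D.contMDiff.prodMk contMDiff_const)).mdifferentiable (by simp) x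
    have hβd : MDifferentiableAt ((𝓡 k).prod (𝓡∂ 2)) (𝓡 (k + 2)) β (r x, spin (f x) t) :=
      D.isSmoothEmbedding_binding.isImmersion.contMDiff.mdifferentiable (by simp) _
    have heq : (fun y => spun f r c α β (y, t)) =ᶠ[𝓝 x] β ∘ fun y => (r y, spin (f y) t) := by
      filter_upwards [(D.isOpen_lt 2).mem_nhds hx2] with y hy
      exact D.spun_of_lt_two hy t
    rw [heq.mfderiv_eq, mfderiv_comp x hβd (hrd.prodMk hsd)] at hs
    have h1 := eq_zero_of_mfderiv_of_isImmersionAt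
      (D.isSmoothEmbedding_binding.isImmersion.isImmersionAt (r x, spin (f x) t)) hs
    refine D.eq_zero_of_mfderiv hx (by linarith) (hdf (by linarith)) ?_
    exact mfderiv_apply_eq_zero_of_comp (hrd.prodMk hsd) (h := Prod.fst) mdifferentiableAt_fst
      (Eventually.of_forall fun y => rfl) h1
  · have hTd : MDifferentiableAt (𝓡∂ (k + 1)) (𝓡∂ (k + 1)) (pushIn f r c) x :=
      D.contMDiff_pushIn.mdifferentiable (by simp) x
    have htd : MDifferentiableAt (𝓡∂ (k + 1)) 𝓘(ℝ, ℝ) (fun _ : V => t) x := mdifferentiableAt_const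
    have hαd : MDifferentiableAt ((𝓡∂ (k + 1)).prod 𝓘(ℝ, ℝ)) (𝓡 (k + 2)) α (pushIn f r c x, t) :=
      D.isImmersion_page.contMDiff.mdifferentiable (by simp) _
    have heq : (fun y => spun f r c α β (y, t)) =ᶠ[𝓝 x] α ∘ fun y => (pushIn f r c y, t) := by
      filter_upwards [(D.isOpen_gt 1).mem_nhds (show 1 < f x by linarith)] with y hy
      exact D.spun_of_one_le (le_of_lt hy) t
    rw [heq.mfderiv_eq, mfderiv_comp x hαd (hTd.prodMk htd)] at hs
    have h1 := eq_zero_of_mfderiv_of_isImmersionAt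
      (D.isImmersion_page.isImmersionAt (pushIn f r c x, t)) hs
    have h2 : mfderiv (𝓡∂ (k + 1)) (𝓡∂ (k + 1)) (pushIn f r c) x v = 0 :=
      mfderiv_apply_eq_zero_of_comp (hTd.prodMk htd) (h := Prod.fst) mdifferentiableAt_fst
        (Eventually.of_forall fun y => rfl) h1
    rcases lt_or_ge (f x) (7 / 2) with hx7 | hx7
    · refine D.eq_zero_of_mfderiv hx (by linarith) (hdf hx7) ?_
      have hx4 : f x < 4 := by linarith
      refine mfderiv_apply_eq_zero_of_comp hTd (h := r)
        (D.mdifferentiableAt_proj (D.height_pushIn_lt hx4)) ?_ h2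
      filter_upwards [(D.isOpen_lt 4).mem_nhds hx4] with y hy
      exact (D.proj_pushIn hy).symm
    · refine eq_zero_of_mfderiv_of_leftInverse hTd (h := id) mdifferentiableAt_id ?_ h2
      filter_upwards [(D.isOpen_gt 3).mem_nhds (show 3 < f x by linarith)] with y hy
      exact D.pushIn_of_three_le (le_of_lt hy)

theorem eq_zero_of_mfderiv_spunDisk (D : IsCollaredOpenBook (k := k) ι f r c h α β) {x : V} (t : ℝ)
    (hx : x ∉ Bdry k V) {v : TangentSpace (𝓡∂ (k + 1)) x}
    (hv : mfderiv (𝓡∂ (k + 1)) 𝓘(ℝ, EuclideanSpace ℝ (Fin (k + 2 + 1)))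
      (fun y => (spunDisk f r c α β (y, t)).1) x v = 0) : v = 0 := by
  have hx0 : 0 < f x := lt_of_le_of_ne (D.nonneg x) fun h => hx ((D.eq_zero_iff x).1 h.symm)
  have hpd : MDifferentiableAt (𝓡∂ (k + 1)) 𝓘(ℝ, ℝ) (fun y => profile (f y)) x :=
    (contDiff_profile.contMDiff.comp D.contMDiff).mdifferentiable (by simp) x
  have hsd : MDifferentiableAt (𝓡∂ (k + 1)) (𝓡 (k + 2)) (fun y => spun f r c α β (y, t)) x :=
    (D.contMDiff_spun.comp (contMDiff_id.prodMk contMDiff_const)).mdifferentiable (by simp) x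
  have hcd : MDifferentiableAt (𝓡 (k + 2)) 𝓘(ℝ, EuclideanSpace ℝ (Fin (k + 2 + 1)))
      (Subtype.val : UnitSphere (k + 2) → _) (spun f r c α β (x, t)) :=
    contMDiff_coe_unitSphere.mdifferentiable (by simp) _
  rw [show (fun y => (spunDisk f r c α β (y, t)).1) =
    fun y => profile (f y) • (spun f r c α β (y, t)).1 from funext fun y => D.coe_spunDisk _] at hv
  obtain ⟨h1, h2⟩ := mfderiv_eq_zero_of_smul_unit (γ := fun y => (spun f r c α β (y, t)).1) hpd
    (MDifferentiableAt.comp x hcd hsd) (profile_pos _)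
    (Eventually.of_forall fun y => norm_eq_of_mem_sphere _) hv
  have h3 : mfderiv (𝓡∂ (k + 1)) 𝓘(ℝ, EuclideanSpace ℝ (Fin (k + 2 + 1)))
      (Subtype.val ∘ fun y => spun f r c α β (y, t)) x v = 0 := h2
  rw [mfderiv_comp x hcd hsd] at h3
  exact D.eq_zero_of_mfderiv_spun t hx0 h1 (eq_zero_of_mfderiv_coe_unitSphere _ h3)

/-- Near the boundary the map is `(1 - f/8) β (r, 0)`. In the collar chart it extends to `Ψ (u, w) =
(1 - u₀/8) β (χ⁻¹ u', w)`, where `u'` denotes the remaining coordinates of `u` and the normal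
directions are those of the `D²` factor. As `β` has values in the sphere, `‖Ψ‖ ≤ 1` exactly when `u₀
≥ 0`. -/
theorem isImmersionAtOfComplement_spunDisk_boundary
    (D : IsCollaredOpenBook (k := k) ι f r c h α β) {x : V} (t : ℝ) (hx : x ∈ Bdry k V) :
    IsImmersionAtOfComplement (EuclideanSpace ℝ (Fin 2)) (𝓡∂ (k + 1)) (𝓡∂ (k + 2 + 1)) ∞
      (fun y => spunDisk f r c α β (y, t)) x := by
  obtain ⟨b, rfl⟩ : ∃ b, ι b = x := ⟨r x, D.incl_proj hx⟩
  obtain ⟨κ, hκm, hκb, hκ⟩ := D.exists_chart b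
  set χ := chartAt (EuclideanSpace ℝ (Fin k)) b with hχ
  have hχm : χ ∈ IsManifold.maximalAtlas (𝓡 k) ∞ N := IsManifold.chart_mem_maximalAtlas _
  have hκx : κ.extend (𝓡∂ (k + 1)) (ι b) = consEquiv k (0, extChartAt (𝓡 k) b b) := by
    rw [(hκ _ hκb).2.2, D.height_incl, D.proj_incl]
  set P : EuclideanSpace ℝ (Fin (k + 1)) × EuclideanSpace ℝ (Fin 2) → N × Disk 2 := fun q =>
    ((extChartAt (𝓡 k) b).symm ((consEquiv k).symm q.1).2, toDisk q.2) with hP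
  -- The bound `u₀ < 8` keeps the radius positive, and `‖w‖ < 1` keeps `toDisk` away from its
  -- default value, so that it is smooth.
  set W : Set (EuclideanSpace ℝ (Fin (k + 1)) × EuclideanSpace ℝ (Fin 2)) :=
    {q | q.1 0 < 8 ∧ ((consEquiv k).symm q.1).2 ∈ (extChartAt (𝓡 k) b).target ∧ ‖q.2‖ < 1} with hW
  have hc0 : Continuous fun q : EuclideanSpace ℝ (Fin (k + 1)) × EuclideanSpace ℝ (Fin 2) =>
      q.1 0 := (EuclideanSpace.proj (𝕜 := ℝ) (0 : Fin (k + 1))).continuous.comp continuous_fst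
  have hL : ContDiff ℝ ∞ fun q : EuclideanSpace ℝ (Fin (k + 1)) × EuclideanSpace ℝ (Fin 2) =>
      ((consEquiv k).symm q.1).2 := contDiff_snd.comp ((consEquiv k).symm.contDiff.comp contDiff_fst)
  have hWo : IsOpen W :=
    (isOpen_lt hc0 continuous_const).inter (((isOpen_extChartAt_target b).preimage
      hL.continuous).inter (isOpen_lt continuous_snd.norm continuous_const))
  have hPs : ContMDiffOn 𝓘(ℝ, EuclideanSpace ℝ (Fin (k + 1)) × EuclideanSpace ℝ (Fin 2))
      ((𝓡 k).prod (𝓡∂ 2)) ∞ P W := by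
    refine ContMDiffOn.prodMk ?_ ?_
    · exact (contMDiffOn_extChartAt_symm b).comp hL.contMDiff.contMDiffOn fun q hq => hq.2.1
    · intro q hq
      refine (contMDiffAt_disk ?_).contMDiffWithinAt
      refine (contDiff_snd.contMDiff.contMDiffAt (x := q)).congr_of_eventuallyEq ?_
      filter_upwards [hWo.mem_nhds hq] with q hq
      exact coe_toDisk hq.2.2.le
  have hβs := D.isSmoothEmbedding_binding.isImmersion.contMDiff
  have hβP : ContMDiffOn 𝓘(ℝ, EuclideanSpace ℝ (Fin (k + 1)) × EuclideanSpace ℝ (Fin 2))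
      𝓘(ℝ, EuclideanSpace ℝ (Fin (k + 2 + 1))) ∞ (fun q => (β (P q)).1) W :=
    contMDiff_coe_unitSphere.comp_contMDiffOn (hβs.comp_contMDiffOn hPs)
  have hs : ContDiff ℝ ∞ fun q : EuclideanSpace ℝ (Fin (k + 1)) × EuclideanSpace ℝ (Fin 2) =>
      1 - q.1 0 / 8 :=
    contDiff_const.sub ((((EuclideanSpace.proj (𝕜 := ℝ) (0 : Fin (k + 1))).contDiff).comp
      contDiff_fst).div_const 8)
  have hxW : (κ.extend (𝓡∂ (k + 1)) (ι b), (0 : EuclideanSpace ℝ (Fin 2))) ∈ W := by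
    refine ⟨?_, ?_, by simp⟩
    · rw [hκx, consEquiv_apply_zero]
      norm_num
    · simp only [hκx, ContinuousLinearEquiv.symm_apply_apply]
      exact mem_extChartAt_target b
  refine isImmersionAtOfComplement_disk (Ψ := fun q => (1 - q.1 0 / 8) • (β (P q)).1) ?_ hκm hκb hWo
    (hs.contDiffOn.smul hβP.contDiffOn) hxW ?_ ?_ ?_
  · exact Topology.IsInducing.subtypeVal.continuousAt_iff.2
      (D.contMDiff_spunDisk.continuous.comp (Continuous.prodMk_left t)).continuousAt
  · intro v hv
    set q₀ : EuclideanSpace ℝ (Fin (k + 1)) × EuclideanSpace ℝ (Fin 2) :=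
      (κ.extend (𝓡∂ (k + 1)) (ι b), 0) with hq₀
    have hPd : MDifferentiableAt 𝓘(ℝ, EuclideanSpace ℝ (Fin (k + 1)) × EuclideanSpace ℝ (Fin 2))
        ((𝓡 k).prod (𝓡∂ 2)) P q₀ :=
      (hPs.contMDiffAt (hWo.mem_nhds hxW)).mdifferentiableAt (by simp)
    have hβd : MDifferentiableAt ((𝓡 k).prod (𝓡∂ 2)) (𝓡 (k + 2)) β (P q₀) :=
      hβs.mdifferentiable (by simp) _
    have hcd : MDifferentiableAt (𝓡 (k + 2)) 𝓘(ℝ, EuclideanSpace ℝ (Fin (k + 2 + 1)))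
        (Subtype.val : UnitSphere (k + 2) → _) (β (P q₀)) :=
      contMDiff_coe_unitSphere.mdifferentiable (by simp) _
    have hsd : MDifferentiableAt 𝓘(ℝ, EuclideanSpace ℝ (Fin (k + 1)) × EuclideanSpace ℝ (Fin 2))
        𝓘(ℝ, ℝ) (fun q => 1 - q.1 0 / 8) q₀ :=
      (hs.differentiable (by simp) q₀).mdifferentiableAt
    rw [← mfderiv_eq_fderiv] at hv
    have hpos : 0 < 1 - q₀.1 0 / 8 := by linarith [hxW.1]
    obtain ⟨h1, h2⟩ := mfderiv_eq_zero_of_smul_unit (γ := fun q => (β (P q)).1) hsd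
      (MDifferentiableAt.comp q₀ hcd (MDifferentiableAt.comp q₀ hβd hPd)) hpos
      (Eventually.of_forall fun y => norm_eq_of_mem_sphere _) hv
    have h3 : mfderiv 𝓘(ℝ, EuclideanSpace ℝ (Fin (k + 1)) × EuclideanSpace ℝ (Fin 2))
        𝓘(ℝ, EuclideanSpace ℝ (Fin (k + 2 + 1))) (Subtype.val ∘ (β ∘ P)) q₀ v = 0 := h2
    rw [mfderiv_comp q₀ hcd (MDifferentiableAt.comp q₀ hβd hPd)] at h3
    have h4 := eq_zero_of_mfderiv_coe_unitSphere _ h3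
    rw [mfderiv_comp q₀ hβd hPd] at h4
    have h5 := eq_zero_of_mfderiv_of_isImmersionAt
      (D.isSmoothEmbedding_binding.isImmersion.isImmersionAt (P q₀)) h4
    -- the three coordinates of `v` vanish
    set L0 : EuclideanSpace ℝ (Fin (k + 1)) × EuclideanSpace ℝ (Fin 2) →L[ℝ] ℝ :=
      (EuclideanSpace.proj (0 : Fin (k + 1))).comp (ContinuousLinearMap.fst ℝ _ _) with hL0
    set L1 : EuclideanSpace ℝ (Fin (k + 1)) × EuclideanSpace ℝ (Fin 2) →L[ℝ]
        EuclideanSpace ℝ (Fin k) := (ContinuousLinearMap.snd ℝ _ _).comp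
      (((consEquiv k).symm : EuclideanSpace ℝ (Fin (k + 1)) →L[ℝ] ℝ × EuclideanSpace ℝ (Fin k)).comp
        (ContinuousLinearMap.fst ℝ _ _)) with hL1
    set L2 : EuclideanSpace ℝ (Fin (k + 1)) × EuclideanSpace ℝ (Fin 2) →L[ℝ]
        EuclideanSpace ℝ (Fin 2) := ContinuousLinearMap.snd ℝ _ _ with hL2
    have hv0 : v.1 0 = 0 := by
      have h6 : mfderiv 𝓘(ℝ, EuclideanSpace ℝ (Fin (k + 1)) × EuclideanSpace ℝ (Fin 2)) 𝓘(ℝ, ℝ)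
          L0 q₀ v = 0 := by
        refine mfderiv_apply_eq_zero_of_comp hsd (h := fun s : ℝ => 8 * (1 - s)) ?_ ?_ h1
        · exact (((differentiableAt_const _).sub differentiableAt_id).const_mul _).mdifferentiableAt
        · refine Eventually.of_forall fun q => ?_
          change q.1 0 = 8 * (1 - (1 - q.1 0 / 8))
          ring
      rw [mfderiv_eq_fderiv, L0.fderiv] at h6
      exact h6
    have hv1 : ((consEquiv k).symm v.1).2 = 0 := by
      have h6 : mfderiv 𝓘(ℝ, EuclideanSpace ℝ (Fin (k + 1)) × EuclideanSpace ℝ (Fin 2))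
          𝓘(ℝ, EuclideanSpace ℝ (Fin k)) L1 q₀ v = 0 := by
        have hP1 : (P q₀).1 ∈ χ.source := by
          have := (extChartAt (𝓡 k) b).map_target hxW.2.1
          rwa [extChartAt_source] at this
        refine mfderiv_apply_eq_zero_of_comp hPd
          (h := fun p : N × Disk 2 => extChartAt (𝓡 k) b p.1) ?_ ?_ h5
        · exact MDifferentiableAt.comp (P q₀) ((χ.contMDiffAt_extend hχm hP1).mdifferentiableAt
            (by simp)) mdifferentiableAt_fst
        · filter_upwards [hWo.mem_nhds hxW] with q hq
          exact ((extChartAt (𝓡 k) b).right_inv hq.2.1).symm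
      rw [mfderiv_eq_fderiv, L1.fderiv] at h6
      exact h6
    have hv2 : v.2 = 0 := by
      have h6 : mfderiv 𝓘(ℝ, EuclideanSpace ℝ (Fin (k + 1)) × EuclideanSpace ℝ (Fin 2))
          𝓘(ℝ, EuclideanSpace ℝ (Fin 2)) L2 q₀ v = 0 := by
        refine mfderiv_apply_eq_zero_of_comp hPd (h := fun p : N × Disk 2 => p.2.1) ?_ ?_ h5
        · exact MDifferentiableAt.comp (P q₀) (contMDiff_coe_disk.mdifferentiable (by simp) _)
            mdifferentiableAt_snd
        · filter_upwards [hWo.mem_nhds hxW] with q hq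
          exact (coe_toDisk hq.2.2.le).symm
      rw [mfderiv_eq_fderiv, L2.fderiv] at h6
      exact h6
    refine Prod.ext ((consEquiv k).symm.map_eq_zero_iff.1 (Prod.ext ?_ hv1)) hv2
    rw [consEquiv_symm_fst]
    exact hv0
  · intro q hq
    have hpos : 0 < 1 - q.1 0 / 8 := by linarith [hq.1]
    rw [norm_smul, norm_eq_of_mem_sphere, mul_one, Real.norm_of_nonneg hpos.le]
    constructor <;> intro h <;> linarith
  · have hlt : f (ι b) < 1 / 2 := by
      rw [D.height_incl]
      norm_num
    filter_upwards [κ.open_source.mem_nhds hκb, (D.isOpen_lt (1 / 2)).mem_nhds hlt] with y hy1 hy2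
    have hy2' : f y < 1 / 2 := hy2
    rw [D.coe_spunDisk, D.spun_of_lt_two (by linarith), spin_of_le hy2'.le,
      profile_of_le (by linarith)]
    have hry : (extChartAt (𝓡 k) b).symm (extChartAt (𝓡 k) b (r y)) = r y :=
      (extChartAt (𝓡 k) b).left_inv (by rw [extChartAt_source]; exact (hκ y hy1).2.1)
    simp only [hP, (hκ y hy1).2.2, consEquiv_apply_zero, ContinuousLinearEquiv.symm_apply_apply, hry]

theorem spunEmbeds [CompactSpace V] (D : IsCollaredOpenBook (k := k) ι f r c h α β) :
    SpunEmbeds (k := k) (l := k + 2) V h (Disk (k + 2 + 1))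
      (Diffeomorph.refl (𝓡∂ (k + 2 + 1)) (Disk (k + 2 + 1)) ∞) :=
  spunEmbeds_disk_of_isotopy h (spunDisk f r c α β) D.contMDiff_spunDisk D.spunDisk_injective
    D.norm_spunDisk_eq_one_iff (fun _ t hx _ hv => D.eq_zero_of_mfderiv_spunDisk t hx hv)
    (fun _ t hx => D.isImmersionAtOfComplement_spunDisk_boundary t hx) D.spunDisk_one
    (fun _ hx t => D.spunDisk_boundary hx t)

end IsCollaredOpenBook

end SpunPageImmersion

/-! ### Open books of spheres spun embed in the disk -/

section SpunEmbedding

variable {k : ℕ} {V : Type*} [TopologicalSpace V] [ChartedSpace (EuclideanHalfSpace (k + 1)) V]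
  [IsManifold (𝓡∂ (k + 1)) ∞ V]

/-- An open book decomposition of a sphere whose pages are closed manifolds spun embeds in the open
book with page the disk. -/
theorem spunEmbeds_of_boundary_eq_empty [CompactSpace V] (hV : Bdry k V = ∅)
    {h : V ≃ₘ⟮𝓡∂ (k + 1), 𝓡∂ (k + 1)⟯ V} {α : V × ℝ → UnitSphere (k + 2)}
    (hα : IsImmersion ((𝓡∂ (k + 1)).prod 𝓘(ℝ, ℝ)) (𝓡 (k + 2)) ∞ α)
    (hαe : ∀ x y : V, ∀ s t : ℝ, α (x, s) = α (y, t) ↔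
      ∃ j : ℤ, s = t + j ∧ y = ((h.toEquiv : Equiv.Perm V) ^ j) x) :
    SpunEmbeds (k := k) (l := k + 2) V h (Disk (k + 2 + 1))
      (Diffeomorph.refl (𝓡∂ (k + 2 + 1)) (Disk (k + 2 + 1)) ∞) := by
  have hnorm : ∀ q, ‖(1 / 2 : ℝ) • (α q).1‖ = 1 / 2 := fun q => by
    rw [norm_smul, norm_eq_of_mem_sphere, mul_one, Real.norm_of_nonneg (by norm_num)]
  have hcoe : ∀ q, (toDisk ((1 / 2 : ℝ) • (α q).1)).1 = (1 / 2 : ℝ) • (α q).1 := fun q =>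
    coe_toDisk (by rw [hnorm]; norm_num)
  have hempty : ∀ x : V, x ∉ Bdry k V := fun x hx => by rw [hV] at hx; exact hx
  have hval : Function.Injective fun q : UnitSphere (k + 2) => toDisk ((1 / 2 : ℝ) • q.1) := by
    intro p q hpq
    have hn : ∀ q : UnitSphere (k + 2), ‖(1 / 2 : ℝ) • q.1‖ ≤ 1 := fun q => by
      rw [norm_smul, norm_eq_of_mem_sphere, mul_one, Real.norm_of_nonneg (by norm_num)]
      norm_num
    have h1 := congrArg Subtype.val hpq
    simp only [coe_toDisk (hn _)] at h1
    exact Subtype.ext (smul_right_injective _ (by norm_num) h1)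
  -- Without boundary there is nothing to hold fixed, and the pages are moved to the sphere of
  -- constant radius `1/2` inside the disk.
  refine spunEmbeds_disk_of_isotopy h (fun q => toDisk ((1 / 2 : ℝ) • (α q).1)) ?_ ?_ ?_ ?_
    (fun x _ hx => absurd hx (hempty x)) (fun x => ?_) (fun x hx => absurd hx (hempty x))
  · simp only [hcoe]
    exact (contDiff_const_smul (1 / 2 : ℝ)).contMDiff.comp
      (contMDiff_coe_unitSphere.comp hα.contMDiff)
  · intro t x y hxy
    obtain ⟨j, hj, hy⟩ := (hαe x y t t).1 (hval hxy)
    have : j = 0 := by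
      have : (j : ℝ) = 0 := by linarith
      exact_mod_cast this
    rw [hy, this, zpow_zero]
    rfl
  · intro x t
    rw [hcoe, hnorm]
    exact ⟨fun h => by norm_num at h, fun h => absurd h (hempty x)⟩
  · intro x t _ v hv
    rw [show (fun y => (toDisk ((1 / 2 : ℝ) • (α (y, t)).1)).1) =
      fun y => (1 / 2 : ℝ) • (α (y, t)).1 from funext fun y => hcoe _] at hv
    have hm : MDifferentiableAt (𝓡∂ (k + 1)) ((𝓡∂ (k + 1)).prod 𝓘(ℝ, ℝ)) (fun y : V => (y, t)) x :=
      mdifferentiableAt_id.prodMk mdifferentiableAt_const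
    have hαd : MDifferentiableAt ((𝓡∂ (k + 1)).prod 𝓘(ℝ, ℝ)) (𝓡 (k + 2)) α (x, t) :=
      hα.contMDiff.mdifferentiable (by simp) _
    have hcd : MDifferentiableAt (𝓡 (k + 2)) 𝓘(ℝ, EuclideanSpace ℝ (Fin (k + 2 + 1)))
        (Subtype.val : UnitSphere (k + 2) → _) (α (x, t)) :=
      contMDiff_coe_unitSphere.mdifferentiable (by simp) _
    have hαm := MDifferentiableAt.comp x hαd hm
    have h1 : mfderiv (𝓡∂ (k + 1)) 𝓘(ℝ, EuclideanSpace ℝ (Fin (k + 2 + 1)))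
        (Subtype.val ∘ (α ∘ fun y : V => (y, t))) x v = 0 :=
      (mfderiv_eq_zero_of_smul_unit (c := fun _ => (1 / 2 : ℝ)) (γ := fun y => (α (y, t)).1)
        mdifferentiableAt_const (MDifferentiableAt.comp x hcd hαm) (by norm_num)
        (Eventually.of_forall fun y => norm_eq_of_mem_sphere _) hv).2
    rw [mfderiv_comp x hcd hαm] at h1
    have h2 := eq_zero_of_mfderiv_coe_unitSphere _ h1
    rw [mfderiv_comp x hαd hm] at h2
    have h3 := eq_zero_of_mfderiv_of_isImmersionAt (hα.isImmersionAt (x, t)) h2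
    exact eq_zero_of_mfderiv_of_leftInverse hm (h := Prod.fst) mdifferentiableAt_fst
      (Eventually.of_forall fun y => rfl) h3
  · rw [(hαe x (h x) 1 0).2 ⟨1, by norm_num, by rw [zpow_one]; rfl⟩]

/-- Every open book decomposition of a sphere spun embeds in the open book with page the disk and
trivial monodromy. -/
theorem spunEmbeds_disk [T2Space V] {h : V ≃ₘ⟮𝓡∂ (k + 1), 𝓡∂ (k + 1)⟯ V}
    (hV : IsOpenBookDecomposition (k := k) V h (UnitSphere (k + 2))) :
    SpunEmbeds (k := k) (l := k + 2) V h (Disk (k + 2 + 1))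
      (Diffeomorph.refl (𝓡∂ (k + 2 + 1)) (Disk (k + 2 + 1)) ∞) := by
  have := hV.compact_page
  obtain ⟨_, hN, hι, α, β, hα, hαe, hβ, -, hαβ⟩ := hV.exists_diffeomorph
  rcases (Bdry k V).eq_empty_or_nonempty with hne | hne
  · exact spunEmbeds_of_boundary_eq_empty hne hα hαe
  have : Nonempty (Bdry k V) := hne.to_subtype
  have hcl : IsClosed (Bdry k V) := (𝓡∂ (k + 1)).isClosed_boundary (n := ∞) (by simp)
  have : CompactSpace (Bdry k V) := isCompact_iff_compactSpace.1 hcl.isCompact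
  obtain ⟨r, U, hU, hιU, hr, hrι⟩ := exists_retraction hι hβ
  obtain ⟨O, hO, hbO, hOh⟩ := mem_nhdsSet_iff_exists.1 hV.eq_self_near_boundary
  have hrange : range (Subtype.val : Bdry k V → V) = Bdry k V := Subtype.range_coe
  rw [hrange] at hιU
  -- The collar is taken inside both the domain of the retraction and the neighbourhood `O` of the
  -- boundary on which `h` is the identity.
  obtain ⟨f, c, hC, hf⟩ := exists_isCollar (hU.inter hO) (hr.mono inter_subset_left)
    hι.isImmersion.contMDiff hrange (subset_inter hιU hbO) hrι
  exact IsCollaredOpenBook.spunEmbeds (ι := Subtype.val) (f := f) (r := r) (c := c) (α := α) (β := β)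
    ⟨hC, fun x hx => hOh (hf hx).2, hα, hαe, hβ, fun b t => (hαβ _ _ _ _).2 ⟨rfl, rfl⟩⟩

end SpunEmbedding

end OpenBook

end

open OpenBook in
/-- Here `n = k + 4` ranges over all integers `n ≥ 4`; so `S^n = UnitSphere (k + 4)`,
`D^(n-1) = Disk (k + 3)`, `S^(n-2) = UnitSphere (k + 2)`, and the page `V` of an open book
decomposition of `S^(n-2)` has dimension `n - 3 = k + 1`. -/
theorem corollary1p2 (k : ℕ) :
    IsOpenBookDecomposition (k := k + 2) (Disk (k + 3))
      (Diffeomorph.refl (𝓡∂ (k + 3)) (Disk (k + 3)) ∞) (UnitSphere (k + 4)) ∧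
    ∀ (V : Type*) [TopologicalSpace V] [T2Space V] [ChartedSpace (EuclideanHalfSpace (k + 1)) V]
      [IsManifold (𝓡∂ (k + 1)) ∞ V] (h : V ≃ₘ⟮𝓡∂ (k + 1), 𝓡∂ (k + 1)⟯ V),
      IsOpenBookDecomposition (k := k) V h (UnitSphere (k + 2)) →
      SpunEmbeds (k := k) (l := k + 2) V h (Disk (k + 3))
        (Diffeomorph.refl (𝓡∂ (k + 3)) (Disk (k + 3)) ∞) := by
  exact ⟨isOpenBookDecomposition_disk (k + 2), fun V _ _ _ _ h hV => spunEmbeds_disk hV⟩
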